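/- For a hypergraph $H=(X,E)$ and $C\subseteq X$, call two hyperedges $e,f\in E$ equivalent if $e\cap C=f\cap C$; the classes of this relation are the equivalence classes induced by $C$. \textsc{Partial VC Dimension} asks, given $H$ and non-negative integers $k$ and $\ell$, whether there is a set $C\subseteq X$ of size exactly $k$ that induces at least $\ell$ equivalence classes. The neighborhood hypergraph of a finite simple graph $G$ has vertex set $V(G)$ and, as hyperedges, the closed neighborhoods $N[v]=\{v\}\cup N(v)$ of the vertices $v$ of $G$. Theorem. (1) There is an algorithm that, given a graph $G$ on the vertices $0,\dots,n-1$ by its adjacency lists, together with $k$ and $\ell$, decides \textsc{Partial VC Dimension} on the neighborhood hypergraph of $G$ in time $O\bigl(2^{k\Delta^2}\bigr)\,n\log n$, where $\Delta$ is the maximum degree of $G$. That is, there is one algorithm and one absolute constant $K$ such that on every instance the number of steps is at most $K\cdot 2^{k\Delta^2}\cdot\max\{1,\,n\log n\}$. (2) Consequently, for every fixed $d$, \textsc{Partial VC Dimension} parameterized by $k$, restricted to neighborhood hypergraphs of graphs of maximum degree at most $d$, is fixed-parameter tractable: there are an algorithm, a computable function $f$ and a constant $c$ such that it is decided in time at most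 $f(k)\cdot|I|^c$ on every such instance $I$, where $|I|$ is the size of the input. Time is the number of steps of a random access machine at unit cost whose only arithmetic is adding or subtracting one; the numbers $n$, $k$, $\ell$ and the entries of the adjacency lists occupy one memory cell each, and $|I|$ counts the occupied cells. -/

import Mathlib

/-! ## Hypergraphs and the problem Partial VC Dimension -/

namespace PartialVC

/-- Two hyperedges of `H` are related when they have the same intersection with `C`. -/
def classSetoid {α : Type*} (H : Hypergraph α) (C : Set α) : Setoid H.edgeSet where
  r e f := (e : Set α) ∩ C = (f : Set α) ∩ C
  iseqv := ⟨fun _ => rfl, fun h => h.symm, fun h h' => h.trans h'⟩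

/-- The number of neighborhood equivalence classes of hyperedges induced by `C`. -/
noncomputable def numClasses {α : Type*} (H : Hypergraph α) (C : Set α) : ℕ :=
  Nat.card (Quotient (classSetoid H C))

/-- The question of Partial VC Dimension: is there a set of exactly `k` vertices of `H` that
induces at least `l` equivalence classes? -/
def HasPartialVC {α : Type*} (H : Hypergraph α) (k l : ℕ) : Prop :=
  ∃ C : Finset α, (C : Set α) ⊆ H.vertexSet ∧ C.card = k ∧ l ≤ numClasses H (C : Set α)

/-- The closed neighborhood `N[v]`. -/
def closedNbhd {V : Type*} (G : SimpleGraph V) (v : V) : Set V :=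
  insert v (G.neighborSet v)

/-- The neighborhood hypergraph of `G`: its vertices are those of `G`, its hyperedges are the
closed neighborhoods of the vertices of `G`. -/
def nbhdHypergraph {V : Type*} (G : SimpleGraph V) : Hypergraph V where
  vertexSet := Set.univ
  edgeSet := Set.range (closedNbhd G)
  subset_vertexSet_of_mem_edgeSet' := fun _ _ => Set.subset_univ _

end PartialVC

/-! ## A random access machine with unit costs

The memory consists of registers and of arrays, all holding natural numbers; a program mentions
finitely many of both, and any array cell is reached in one step through an index held in a
register. The only arithmetic is adding or subtracting one, so after `t` steps no number exceeds
`t` plus the largest number among the input and the literals of the program: the unit cost hides no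
work on long numbers. Each elementary instruction and each evaluation of a test is one step. -/

namespace RAM

/-- A memory configuration: the registers and the arrays. -/
structure State where
  reg : ℕ → ℕ
  arr : ℕ → ℕ → ℕ

namespace State

/-- Overwrite register `x`. -/
def setReg (s : State) (x v : ℕ) : State :=
  { s with reg := Function.update s.reg x v }

/-- Overwrite cell `i` of array `a`. -/
def setArr (s : State) (a i v : ℕ) : State :=
  { s with arr := Function.update s.arr a (Function.update (s.arr a) i v) }

end State

/-- Comparisons between two registers. -/
inductive Test where
  | lt (x y : ℕ)
  | eq (x y : ℕ)

/-- The truth of a comparison in a configuration. -/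
def Test.Holds : Test → State → Prop
  | .lt x y, s => s.reg x < s.reg y
  | .eq x y, s => s.reg x = s.reg y

/-- Programs. Letters `x`, `y` are names of registers, `a` names an array, `c` is a literal. -/
inductive Prog where
  | skip
  /-- register `x` becomes `c` -/
  | const (x c : ℕ)
  /-- register `x` becomes the content of register `y` -/
  | copy (x y : ℕ)
  /-- register `x` is increased by one -/
  | inc (x : ℕ)
  /-- register `x` is decreased by one (and stays zero if it was zero) -/
  | dec (x : ℕ)
  /-- register `x` becomes the content of the cell of array `a` whose index is in register `y` -/
  | load (x a y : ℕ)
  /-- the cell of array `a` whose index is in register `x` becomes the content of register `y` -/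
  | store (a x y : ℕ)
  | seq (p q : Prog)
  | ite (b : Test) (p q : Prog)
  | while (b : Test) (p : Prog)

/-- `Exec p s t s'`: started in `s`, the program `p` halts after exactly `t` steps in `s'`. -/
inductive Exec : Prog → State → ℕ → State → Prop where
  | skip (s : State) : Exec .skip s 1 s
  | const (x c : ℕ) (s : State) : Exec (.const x c) s 1 (s.setReg x c)
  | copy (x y : ℕ) (s : State) : Exec (.copy x y) s 1 (s.setReg x (s.reg y))
  | inc (x : ℕ) (s : State) : Exec (.inc x) s 1 (s.setReg x (s.reg x + 1))
  | dec (x : ℕ) (s : State) : Exec (.dec x) s 1 (s.setReg x (s.reg x - 1))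
  | load (x a y : ℕ) (s : State) : Exec (.load x a y) s 1 (s.setReg x (s.arr a (s.reg y)))
  | store (a x y : ℕ) (s : State) : Exec (.store a x y) s 1 (s.setArr a (s.reg x) (s.reg y))
  | seq {p q : Prog} {s s₁ s₂ : State} {t₁ t₂ : ℕ} :
      Exec p s t₁ s₁ → Exec q s₁ t₂ s₂ → Exec (.seq p q) s (t₁ + t₂) s₂
  | ite_true {b : Test} {p q : Prog} {s s' : State} {t : ℕ} :
      b.Holds s → Exec p s t s' → Exec (.ite b p q) s (1 + t) s'
  | ite_false {b : Test} {p q : Prog} {s s' : State} {t : ℕ} :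
      ¬ b.Holds s → Exec q s t s' → Exec (.ite b p q) s (1 + t) s'
  | while_true {b : Test} {p : Prog} {s s₁ s₂ : State} {t₁ t₂ : ℕ} :
      b.Holds s → Exec p s t₁ s₁ → Exec (.while b p) s₁ t₂ s₂ →
      Exec (.while b p) s (1 + t₁ + t₂) s₂
  | while_false {b : Test} {p : Prog} {s : State} :
      ¬ b.Holds s → Exec (.while b p) s 1 s

/-- Started in `s`, the program `p` halts within `T` steps and leaves in register `0` the answer
to the question `yes`: `1` if it is true and `0` if it is false. -/
def DecidesWithin (p : Prog) (s : State) (yes : Prop) (T : ℝ) : Prop :=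
  ∃ (t : ℕ) (s' : State), Exec p s t s' ∧ (t : ℝ) ≤ T ∧
    ((yes ∧ s'.reg 0 = 1) ∨ (¬ yes ∧ s'.reg 0 = 0))

/-- A parameterized decision problem over a type of instances: how an instance is placed in the
memory, how many numbers it occupies there, its parameter, and the question. -/
structure ParamProblem (ι : Type) where
  init : ι → State
  size : ι → ℕ
  param : ι → ℕ
  yes : ι → Prop

/-- Fixed-parameter tractability: time `f(k) * |I| ^ c` with `f` computable and `c` constant. -/
def ParamProblem.IsFPT {ι : Type} (Q : ParamProblem ι) : Prop :=
  ∃ (p : Prog) (f : ℕ → ℕ) (c : ℕ), Computable f ∧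
    ∀ I : ι, DecidesWithin p (Q.init I) (Q.yes I) ((f (Q.param I) * Q.size I ^ c : ℕ) : ℝ)

end RAM

/-! ## Instances given by graphs -/

namespace PartialVC

/-- An instance of Partial VC Dimension on the neighborhood hypergraph of a graph: a graph `G` with
vertices `0, …, n - 1`, presented by adjacency lists in arbitrary order, and two integers. -/
structure GraphInstance where
  n : ℕ
  G : SimpleGraph (Fin n)
  adj : Fin n → List (Fin n)
  nodup_adj : ∀ v, (adj v).Nodup
  mem_adj : ∀ v w, w ∈ adj v ↔ G.Adj v w
  k : ℕ
  l : ℕ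

namespace GraphInstance

/-- The maximum degree of the graph. -/
noncomputable def Δ (I : GraphInstance) : ℕ :=
  open Classical in I.G.maxDegree

/-- The concatenation of the adjacency lists of `0, …, n - 1`. -/
def flatAdj (I : GraphInstance) : List ℕ :=
  (List.ofFn fun v => (I.adj v).map Fin.val).flatten

/-- The position at which the adjacency list of `i` starts within the concatenation; for `i = n`
the length of the concatenation. -/
def offset (I : GraphInstance) (i : ℕ) : ℕ :=
  ∑ v : Fin I.n, if (v : ℕ) < i then (I.adj v).length else 0

/-- The initial memory: registers `0`, `1`, `2` hold `n`, `k`, `l`; array `0` holds the `n + 1`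
offsets, array `1` the concatenated adjacency lists; everything else is zero. The maximum degree is
not part of the input. -/
def init (I : GraphInstance) : RAM.State where
  reg x := if x = 0 then I.n else if x = 1 then I.k else if x = 2 then I.l else 0
  arr a i :=
    if a = 0 then (if i ≤ I.n then I.offset i else 0)
    else if a = 1 then I.flatAdj.getD i 0
    else 0

/-- The number of memory cells that the input occupies. -/
def size (I : GraphInstance) : ℕ :=
  3 + (I.n + 1) + I.flatAdj.length

/-- The question of the instance. -/
def Yes (I : GraphInstance) : Prop :=
  HasPartialVC (nbhdHypergraph I.G) I.k I.l

end GraphInstance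

/-- Partial VC Dimension, parameterized by `k`, on neighborhood hypergraphs of graphs of maximum
degree at most `d`. -/
def boundedDegree (d : ℕ) : RAM.ParamProblem {I : GraphInstance // I.Δ ≤ d} where
  init I := I.1.init
  size I := I.1.size
  param I := I.1.k
  yes I := I.1.Yes

end PartialVC

/-! ## Step-counting weakest preconditions for the machine -/

namespace RAM

-- Let the value of a set `C` be the number of nonempty sets `N[v] ∩ C`. The number of classes
-- induced by `C` is its value, plus one if some `N[v]` misses `C`. A set of `k` vertices meets at
-- most `k(Δ+1)` closed neighborhoods, so if one is missed, then one is missed among those of the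
-- first `k(Δ+1)+1` vertices (`answer_iff`). Hence it suffices to compute, a number of times
-- polynomial in `k` and `Δ`, the largest value of a `k`-set avoiding a given set `M`, which is
-- empty or some `N[v]`.
--
-- Split `C` into pieces: the components of the relation "at distance at most two". No closed
-- neighborhood meets two pieces, so the value is additive over pieces (`val_union_of_far`).
-- Connected sets of `j` vertices are enumerated with a queue of candidates, each taken or rejected;
-- a vertex that is taken contributes the vertices at distance at most two as new candidates. At
-- most `Δ²-Δ` of these are new (`card_N2_sdiff_le`), so with `q = 2^(Δ²-Δ)` a best connected
-- `j`-set is found in time about `n·q^j` (`innerBest`, `inner_cost_le`).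
--
-- The outer search assembles `k` vertices piece by piece. When no candidate near the chosen
-- vertices is left, let `P₀` be a smallest piece of the unchosen rest of an optimal `C`, let `j` be
-- its size, and let `P` be a best connected `j`-set among the vertices still free. Either `C` has a
-- vertex at distance at most two from `P`, or `P₀` may be exchanged for `P` without loss. In both
-- cases the search may continue from one of at most `j(Δ²+1)` vertices near `P`. So `n` enters
-- through the computation of `P` only and not through the branching. As `P₀` is smallest, all later
-- pieces have at least `j` elements, and smaller ones are cut off. This is `outer_leaves_complete`.
--
-- The outer tree is measured by the potential `pot`, which bounds its cost by a polynomial times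
-- `n+1` times `β^k` with `β = 15/4·q` (`outer_cost_le`, `optTime_le`). For `Δ ≥ 2` one has `2^(Δ²)
-- = 4q·2^(Δ-2)`; the ratio `16/15` between `4q` and `β` absorbs polynomials in `k`, and the powers
-- of `2^(Δ-2)` those in `Δ` (`exists_absorb`). For `Δ ≤ 1` the closed neighborhoods partition the
-- vertices and a direct formula answers the question (`answer_iff_of_d_le_one`).
--
-- Both searches run on the machine as one generic backtracking program with an explicit stack
-- (`wp_search`), verified by step-counting preconditions `wp`. Fixed-parameter tractability then
-- follows from `2^(kΔ²) ≤ (2^(d²))^k` and `n log n ≤ n²`.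

notation:60 p:61 ";;" q:60 => Prog.seq p q

theorem State.setReg_reg (s : State) (x v y : ℕ) :
    (s.setReg x v).reg y = if y = x then v else s.reg y := by
  simp [State.setReg, Function.update_apply]

@[simp] theorem State.setReg_arr (s : State) (x v : ℕ) : (s.setReg x v).arr = s.arr := rfl

@[simp] theorem State.setArr_reg (s : State) (a i v : ℕ) : (s.setArr a i v).reg = s.reg := rfl

theorem State.setArr_arr (s : State) (a i v b : ℕ) :
    (s.setArr a i v).arr b = if b = a then Function.update (s.arr a) i v else s.arr b := by
  by_cases h : b = a
  · subst h; simp [State.setArr]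
  · simp [State.setArr, h]

instance (b : Test) (s : State) : Decidable (b.Holds s) := by
  cases b <;> simp only [Test.Holds] <;> infer_instance

@[simp] theorem Test.holds_lt (x y : ℕ) (s : State) :
    (Test.lt x y).Holds s ↔ s.reg x < s.reg y := Iff.rfl

@[simp] theorem Test.holds_eq (x y : ℕ) (s : State) :
    (Test.eq x y).Holds s ↔ s.reg x = s.reg y := Iff.rfl

/-- The program may overwrite register `r`. -/
def Prog.WritesReg : Prog → ℕ → Prop
  | .skip, _ => False
  | .const x _, r => r = x
  | .copy x _, r => r = x
  | .inc x, r => r = x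
  | .dec x, r => r = x
  | .load x _ _, r => r = x
  | .store _ _ _, _ => False
  | .seq p q, r => p.WritesReg r ∨ q.WritesReg r
  | .ite _ p q, r => p.WritesReg r ∨ q.WritesReg r
  | .while _ p, r => p.WritesReg r

/-- The program may overwrite a cell of array `a`. -/
def Prog.WritesArr : Prog → ℕ → Prop
  | .store b _ _, a => a = b
  | .seq p q, a => p.WritesArr a ∨ q.WritesArr a
  | .ite _ p q, a => p.WritesArr a ∨ q.WritesArr a
  | .while _ p, a => p.WritesArr a
  | _, _ => False

/-- `s'` agrees with `s` on everything that `p` does not write. -/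
def Unch (p : Prog) (s s' : State) : Prop :=
  (∀ r, ¬ p.WritesReg r → s'.reg r = s.reg r) ∧ (∀ a, ¬ p.WritesArr a → s'.arr a = s.arr a)

theorem Unch.refl (p : Prog) (s : State) : Unch p s s := ⟨fun _ _ => rfl, fun _ _ => rfl⟩

theorem Unch.trans {p : Prog} {s s' s'' : State} (h : Unch p s s') (h' : Unch p s' s'') :
    Unch p s s'' :=
  ⟨fun r hr => (h'.1 r hr).trans (h.1 r hr), fun a ha => (h'.2 a ha).trans (h.2 a ha)⟩

theorem Unch.mono {p q : Prog} {s s' : State} (h : Unch p s s')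
    (hr : ∀ r, p.WritesReg r → q.WritesReg r) (ha : ∀ a, p.WritesArr a → q.WritesArr a) :
    Unch q s s' :=
  ⟨fun r h' => h.1 r fun h'' => h' (hr r h''), fun a h' => h.2 a fun h'' => h' (ha a h'')⟩

/-- The frame rule. What a program may write is read off its syntax, so persistence of data across a
subprogram becomes a finite check on register and array names. -/
theorem Exec.unch {p : Prog} {s s' : State} {t : ℕ} (h : Exec p s t s') : Unch p s s' := by
  induction h with
  | skip => exact Unch.refl _ _
  | const | copy | inc | dec | load =>
    refine ⟨fun r hr => ?_, fun a _ => rfl⟩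
    simp only [Prog.WritesReg] at hr
    simp [State.setReg_reg, hr]
  | store =>
    refine ⟨fun r _ => rfl, fun a ha => ?_⟩
    simp only [Prog.WritesArr] at ha
    simp [State.setArr_arr, ha]
  | seq _ _ ih₁ ih₂ =>
    exact (ih₁.mono (fun _ => Or.inl) (fun _ => Or.inl)).trans
      (ih₂.mono (fun _ => Or.inr) (fun _ => Or.inr))
  | ite_true _ _ ih => exact ih.mono (fun _ => Or.inl) (fun _ => Or.inl)
  | ite_false _ _ ih => exact ih.mono (fun _ => Or.inr) (fun _ => Or.inr)
  | while_true _ _ _ ih₁ ih₂ =>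
    exact (ih₁.mono (fun _ h => h) (fun _ h => h)).trans ih₂
  | while_false => exact Unch.refl _ _

/-- Started in `s`, the program `p` halts within `T` steps in a configuration satisfying `Q`. -/
def wp (p : Prog) (s : State) (T : ℕ) (Q : State → Prop) : Prop :=
  ∃ (t : ℕ) (s' : State), Exec p s t s' ∧ t ≤ T ∧ Q s'

variable {p q : Prog} {s : State} {T T' T₁ T₂ : ℕ} {Q Q' : State → Prop} {b : Test}

/-- The weakened postcondition receives the frame information for free, so a specification needs to
mention only what its program changes. -/
theorem wp.mono (h : wp p s T Q) (hT : T ≤ T') (hQ : ∀ s', Unch p s s' → Q s' → Q' s') :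
    wp p s T' Q' := by
  obtain ⟨t, s', he, ht, hq⟩ := h
  exact ⟨t, s', he, ht.trans hT, hQ _ he.unch hq⟩

theorem wp.le (h : wp p s T Q) (hT : T ≤ T') : wp p s T' Q := h.mono hT fun _ _ h => h

theorem wp_seq (h : wp p s T₁ fun s₁ => Unch p s s₁ → wp q s₁ T₂ Q) :
    wp (p ;; q) s (T₁ + T₂) Q := by
  obtain ⟨t, s', he, ht, t', s'', he', ht', hq⟩ := (h.mono le_rfl fun s' hu h => h hu)
  exact ⟨t + t', s'', .seq he he', by omega, hq⟩

theorem wp_ite (h₁ : b.Holds s → wp p s T Q) (h₂ : ¬ b.Holds s → wp q s T Q) :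
    wp (.ite b p q) s (T + 1) Q := by
  by_cases hb : b.Holds s
  · obtain ⟨t, s', he, ht, hq⟩ := h₁ hb
    exact ⟨1 + t, s', .ite_true hb he, by omega, hq⟩
  · obtain ⟨t, s', he, ht, hq⟩ := h₂ hb
    exact ⟨1 + t, s', .ite_false hb he, by omega, hq⟩

theorem wp_while_true (hb : b.Holds s)
    (h : wp p s T₁ fun s₁ => Unch p s s₁ → wp (.while b p) s₁ T₂ Q) :
    wp (.while b p) s (T₁ + 1 + T₂) Q := by
  obtain ⟨t, s', he, ht, t', s'', he', ht', hq⟩ := (h.mono le_rfl fun s' hu h => h hu)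
  exact ⟨1 + t + t', s'', .while_true hb he he', by omega, hq⟩

theorem wp_while_false (hb : ¬ b.Holds s) (h : Q s) : wp (.while b p) s 1 Q :=
  ⟨1, s, .while_false hb, le_rfl, h⟩

/-- The configuration reached by a program without loops. -/
def Prog.eval : Prog → State → State
  | .skip, s => s
  | .const x c, s => s.setReg x c
  | .copy x y, s => s.setReg x (s.reg y)
  | .inc x, s => s.setReg x (s.reg x + 1)
  | .dec x, s => s.setReg x (s.reg x - 1)
  | .load x a y, s => s.setReg x (s.arr a (s.reg y))
  | .store a x y, s => s.setArr a (s.reg x) (s.reg y)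
  | .seq p q, s => q.eval (p.eval s)
  | .ite b p q, s => if b.Holds s then p.eval s else q.eval s
  | .while _ _, s => s

/-- The program has no loops. -/
def Prog.LoopFree : Prog → Prop
  | .seq p q => p.LoopFree ∧ q.LoopFree
  | .ite _ p q => p.LoopFree ∧ q.LoopFree
  | .while _ _ => False
  | _ => True

/-- An upper bound for the number of steps of a program without loops. -/
def Prog.time : Prog → ℕ
  | .seq p q => p.time + q.time
  | .ite _ p q => 1 + (p.time + q.time)
  | _ => 1

theorem wp_eval (hp : p.LoopFree) (hQ : Q (p.eval s)) : wp p s p.time Q := by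
  induction p generalizing s Q with
  | skip => exact ⟨1, _, .skip _, le_rfl, hQ⟩
  | const => exact ⟨1, _, .const _ _ _, le_rfl, hQ⟩
  | copy => exact ⟨1, _, .copy _ _ _, le_rfl, hQ⟩
  | inc => exact ⟨1, _, .inc _ _, le_rfl, hQ⟩
  | dec => exact ⟨1, _, .dec _ _, le_rfl, hQ⟩
  | load => exact ⟨1, _, .load _ _ _ _, le_rfl, hQ⟩
  | store => exact ⟨1, _, .store _ _ _ _, le_rfl, hQ⟩
  | seq p q ihp ihq => exact wp_seq (ihp hp.1 fun _ => ihq hp.2 hQ)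
  | ite b p q ihp ihq =>
    simp only [Prog.eval] at hQ
    refine wp.le (T := (p.time + q.time) + 1) (wp_ite (fun h => ?_) fun h => ?_)
      (by simp only [Prog.time]; omega)
    · rw [if_pos h] at hQ; exact (ihp hp.1 hQ).le (by omega)
    · rw [if_neg h] at hQ; exact (ihq hp.2 hQ).le (by omega)
  | _ => exact hp.elim

/-- The index of the invariant is the number of iterations still to come, so termination and the
step count come from the same induction. Every iteration pays one step for the test, and the final
`1` is the test that fails. -/
theorem wp_while {Inv : ℕ → State → Prop} (T : ℕ)
    (hstep : ∀ m s', Unch (.while b p) s s' → Inv (m + 1) s' → b.Holds s' ∧ wp p s' T (Inv m))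
    (h0 : ∀ s', Inv 0 s' → ¬ b.Holds s') (m : ℕ) (h : Inv m s) :
    wp (.while b p) s (m * (T + 1) + 1) (Inv 0) := by
  suffices H : ∀ m s', Unch (.while b p) s s' → Inv m s' →
      wp (.while b p) s' (m * (T + 1) + 1) (Inv 0) from H m s (Unch.refl _ _) h
  intro m
  induction m with
  | zero => intro s' _ h; exact (wp_while_false (h0 s' h) h).le (by omega)
  | succ m ih =>
    intro s' hu h
    obtain ⟨hb, hw⟩ := hstep m s' hu h
    refine (wp_while_true hb (hw.mono le_rfl fun s₁ hu₁ h₁ hu₂ => ih s₁ ?_ h₁)).le ?_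
    · exact hu.trans (hu₁.mono (fun _ h => h) (fun _ h => h))
    · rw [Nat.succ_mul]; omega

theorem wp_forLt {i c : ℕ} (N T : ℕ) {I : ℕ → State → Prop}
    (hI : ∀ m s', I m s' → s'.reg i = m ∧ s'.reg c = N)
    (hstep : ∀ m s', Unch (.while (.lt i c) p) s s' → m < N → I m s' → wp p s' T (I (m + 1)))
    (h : I 0 s) :
    wp (.while (.lt i c) p) s (N * (T + 1) + 1) (I N) := by
  refine (wp_while (s := s) (Inv := fun m s' => m ≤ N ∧ I (N - m) s') T ?_ ?_ N ?_).mono le_rfl ?_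
  · rintro m s' hu ⟨hm, hi⟩
    obtain ⟨h1, h2⟩ := hI _ _ hi
    refine ⟨by simp only [Test.holds_lt]; omega, (hstep _ s' hu (by omega) hi).mono le_rfl ?_⟩
    intro s'' _ h
    exact ⟨by omega, by rwa [show N - (m + 1) + 1 = N - m by omega] at h⟩
  · rintro s' ⟨-, hi⟩
    obtain ⟨h1, h2⟩ := hI _ _ hi
    simp only [Test.holds_lt]; omega
  · exact ⟨le_rfl, by simpa using h⟩
  · rintro s' _ ⟨-, h⟩; simpa using h

/-- The first cells of array `a` hold the list `L`. -/
def HoldsList (f : ℕ → ℕ) (L : List ℕ) : Prop := ∀ i, i < L.length → f i = L.getD i 0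

theorem HoldsList.of_isPrefix {f : ℕ → ℕ} {L L' : List ℕ} (h : HoldsList f L) (hp : L' <+: L) :
    HoldsList f L' := by
  obtain ⟨M, rfl⟩ := hp
  intro i hi
  rw [h i (by simp; omega), List.getD_append _ _ _ _ hi]

theorem HoldsList.snoc {f : ℕ → ℕ} {L : List ℕ} (h : HoldsList f L) (x : ℕ) :
    HoldsList (Function.update f L.length x) (L ++ [x]) := by
  intro i hi
  rw [List.length_append, List.length_singleton] at hi
  by_cases hi' : i = L.length
  · subst hi'; simp
  · rw [Function.update_of_ne hi', List.getD_append _ _ _ _ (by omega), h i (by omega)]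

theorem HoldsList.nil {f : ℕ → ℕ} : HoldsList f [] := fun i hi => by simp at hi

end RAM

/-! ### Bounded-degree graphs as adjacency lists -/

namespace PartialVC

/-- A finite graph on `0, …, n - 1` given by adjacency lists of length at most `d`. -/
structure ListGraph where
  n : ℕ
  d : ℕ
  nb : ℕ → List ℕ
  nb_lt : ∀ v w, w ∈ nb v → w < n
  symm : ∀ v w, w ∈ nb v → v ∈ nb w
  irrefl : ∀ v, v ∉ nb v
  nodup : ∀ v, (nb v).Nodup
  length_le : ∀ v, (nb v).length ≤ d

namespace ListGraph

/-- The closed neighborhood as a list. -/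
def cN (G : ListGraph) (v : ℕ) : List ℕ := v :: G.nb v

/-- All vertices at distance at most two, with repetitions, starting with `v` itself. -/
def N2 (G : ListGraph) (v : ℕ) : List ℕ := (G.cN v).flatMap G.cN

/-- The arrays `f` and `g` hold the offsets and the concatenated adjacency lists of `G`. -/
def StoredIn (G : ListGraph) (f g : ℕ → ℕ) : Prop :=
  ∀ v < G.n, f (v + 1) = f v + (G.nb v).length ∧
    ∀ i < (G.nb v).length, g (f v + i) = (G.nb v).getD i 0

end ListGraph

end PartialVC

/-! ### Iterating over a closed neighborhood on the machine -/

namespace RAM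

open PartialVC

/-- Run `body` with register `w` ranging over the closed neighborhood of the vertex in register
`v`; the registers `e` and `f` delimit the rest of the adjacency list. -/
def forN (v w e f : ℕ) (body : Prog) : Prog :=
  .copy w v ;; body ;; (.load e 0 v ;; .copy f v ;; .inc f ;; .load f 0 f) ;;
    .while (.lt e f) (.load w 1 e ;; body ;; .inc e)

@[simp] theorem forN_writesReg (v w e f : ℕ) (body : Prog) (r : ℕ) :
    (forN v w e f body).WritesReg r ↔ r = w ∨ r = e ∨ r = f ∨ body.WritesReg r := by
  simp only [forN, Prog.WritesReg]; tauto

@[simp] theorem forN_writesArr (v w e f : ℕ) (body : Prog) (a : ℕ) :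
    (forN v w e f body).WritesArr a ↔ body.WritesArr a := by
  simp only [forN, Prog.WritesArr]; tauto

/-- The invariant depends on the list of vertices already handled. By `hst` it does not see the
three registers of the loop, so only the body has to be analysed. Each of the at most `d + 1` calls
costs `T` and at most three steps of loop control. -/
theorem wp_forN (G : ListGraph) {v w e f : ℕ} {body : Prog} {s : State} (T : ℕ)
    {I : List ℕ → State → Prop} (hv : s.reg v < G.n) (hG : G.StoredIn (s.arr 0) (s.arr 1))
    (hd : v ≠ w ∧ v ≠ e ∧ v ≠ f ∧ w ≠ e ∧ w ≠ f ∧ e ≠ f)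
    (hb : ¬ body.WritesReg v ∧ ¬ body.WritesReg e ∧ ¬ body.WritesReg f ∧
      ¬ body.WritesArr 0 ∧ ¬ body.WritesArr 1)
    (hst : ∀ pre s' r x, r = w ∨ r = e ∨ r = f → I pre s' → I pre (s'.setReg r x))
    (hbody : ∀ pre x, x ∈ G.cN (s.reg v) → ∀ s', Unch (forN v w e f body) s s' →
      I pre s' → s'.reg w = x → wp body s' T (I (pre ++ [x])))
    (h : I [] s) :
    wp (forN v w e f body) s ((G.d + 1) * (T + 3) + 6) (I (G.cN (s.reg v))) := by
  obtain ⟨h1, h2, h3, h4, h5, h6⟩ := hd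
  obtain ⟨b1, b2, b3, b4, b5⟩ := hb
  set c := s.reg v with hc
  obtain ⟨hG1, hG2⟩ := hG c hv
  have hlen := G.length_le c
  set N := (G.nb c).length with hN
  set F := forN v w e f body with hF
  have hUb : ∀ s₁ s₂, Unch body s₁ s₂ → Unch F s₁ s₂ := fun s₁ s₂ hu =>
    hu.mono (fun r hr => by rw [hF, forN_writesReg]; tauto)
      (fun a ha => by rw [hF, forN_writesArr]; exact ha)
  have hUr : ∀ s₁ r x, (r = w ∨ r = e ∨ r = f) → Unch F s₁ (s₁.setReg r x) := by
    intro s₁ r x hr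
    refine ⟨fun r' hr' => ?_, fun a _ => rfl⟩
    rw [hF, forN_writesReg] at hr'
    rw [State.setReg_reg, if_neg]
    rintro rfl; tauto
  have hinc : F.WritesReg w ∧ F.WritesReg e ∧ F.WritesReg f ∧ ¬ F.WritesReg v ∧
      ¬ F.WritesArr 0 ∧ ¬ F.WritesArr 1 := by
    simp only [hF, forN_writesReg, forN_writesArr]; tauto
  obtain ⟨-, -, -, iv, i0, i1⟩ := hinc
  have hfirst : wp (.copy w v ;; body) s (1 + T) (I [c]) := by
    refine wp_seq ⟨1, _, .copy w v s, le_rfl, fun _ => ?_⟩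
    exact hbody [] c (by simp [ListGraph.cN]) _ (hUr _ _ _ (Or.inl rfl))
      (hst _ _ _ _ (Or.inl rfl) h) (by simp [State.setReg_reg, ← hc])
  have hloop : ∀ s₁, Unch F s s₁ → I [c] s₁ →
      wp ((.load e 0 v ;; .copy f v ;; .inc f ;; .load f 0 f) ;;
        .while (.lt e f) (.load w 1 e ;; body ;; .inc e)) s₁
        (4 + (N * ((1 + T + 1) + 1) + 1)) (I (G.cN c)) := by
    intro s₁ hu₁ hI₁
    have hrv : s₁.reg v = c := hu₁.1 v iv
    have ha0 : s₁.arr 0 = s.arr 0 := hu₁.2 0 i0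
    refine wp_seq (wp_eval (by simp [Prog.LoopFree]) fun _ => ?_)
    simp only [Prog.eval]
    set s₂ := ((((s₁.setReg e (s₁.arr 0 (s₁.reg v))).setReg f
      ((s₁.setReg e (s₁.arr 0 (s₁.reg v))).reg v)).setReg f _).setReg f _) with hs₂
    have hu₂ : Unch F s s₂ := by
      refine hu₁.trans ?_
      exact (((hUr _ _ _ (by tauto)).trans (hUr _ _ _ (by tauto))).trans
        (hUr _ _ _ (by tauto))).trans (hUr _ _ _ (by tauto))
    have hI₂ : I [c] s₂ :=
      hst _ _ _ _ (by tauto) (hst _ _ _ _ (by tauto) (hst _ _ _ _ (by tauto)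
        (hst _ _ _ _ (by tauto) hI₁)))
    have he₂ : s₂.reg e = s.arr 0 c := by
      simp [hs₂, State.setReg_reg, h6, hrv, ha0]
    have hf₂ : s₂.reg f = s.arr 0 c + N := by
      simp [hs₂, State.setReg_reg, h2, hrv, ha0, hG1]
    have key := wp_while (b := .lt e f) (p := .load w 1 e ;; body ;; .inc e) (s := s₂)
      (Inv := fun m s' => Unch F s s' ∧ m ≤ N ∧ s'.reg e = s.arr 0 c + (N - m) ∧
        s'.reg f = s.arr 0 c + N ∧ I (c :: (G.nb c).take (N - m)) s') (1 + T + 1) ?_ ?_ N ?_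
    · refine key.mono le_rfl ?_
      rintro s' - ⟨-, -, -, -, h⟩
      simpa [hN, ListGraph.cN] using h
    · rintro m s' - ⟨hu, hm, he, hf, hi⟩
      refine ⟨by simp only [Test.holds_lt]; omega, ?_⟩
      have hlt : N - (m + 1) < (G.nb c).length := by omega
      have hget : s'.arr 1 (s'.reg e) = (G.nb c)[N - (m + 1)] := by
        rw [hu.2 1 i1, he, hG2 _ hlt, List.getD_eq_getElem _ _ hlt]
      refine (wp_seq (T₁ := 1) (T₂ := T + 1) ⟨1, _, .load w 1 e s', le_rfl, fun _ => ?_⟩).le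
        (by omega)
      refine wp_seq (T₁ := T) (T₂ := 1) ((hbody (c :: (G.nb c).take (N - (m + 1)))
        ((G.nb c)[N - (m + 1)]) (by simp [ListGraph.cN]) _ (hu.trans (hUr _ _ _ (Or.inl rfl)))
        (hst _ _ _ _ (Or.inl rfl) hi) (by simp [State.setReg_reg, hget])).mono le_rfl ?_)
      intro s₃ hu₃ hi₃ _
      refine ⟨1, _, .inc e s₃, le_rfl, ?_⟩
      have he₃ : s₃.reg e = s'.reg e := by
        rw [hu₃.1 e b2, State.setReg_reg, if_neg h4.symm]
      have hf₃ : s₃.reg f = s'.reg f := by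
        rw [hu₃.1 f b3, State.setReg_reg, if_neg h5.symm]
      refine ⟨?_, by omega, ?_, ?_, ?_⟩
      · exact ((hu.trans (hUr _ _ _ (Or.inl rfl))).trans (hUb _ _ hu₃)).trans
          (hUr _ _ _ (by tauto))
      · simp [State.setReg_reg, he₃]; omega
      · simp [State.setReg_reg, h6.symm, hf₃, hf]
      · refine hst _ _ _ _ (by tauto) ?_
        have : N - m = N - (m + 1) + 1 := by omega
        rw [this, List.take_succ_eq_append_getElem hlt]
        simpa using hi₃
    · rintro s' ⟨-, -, he, hf, -⟩
      simp only [Test.holds_lt]; omega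
    · exact ⟨hu₂, le_rfl, by simp [he₂], hf₂, by simpa using hI₂⟩
  -- The analysis splits the program after the first call of the body, which brackets the sequence
  -- differently from `forN`; the derivation is rebracketed below at the same cost.
  have hall : wp ((.copy w v ;; body) ;; ((.load e 0 v ;; .copy f v ;; .inc f ;; .load f 0 f) ;;
        .while (.lt e f) (.load w 1 e ;; body ;; .inc e))) s
        ((1 + T) + (4 + (N * ((1 + T + 1) + 1) + 1))) (I (G.cN c)) := by
    refine wp_seq (hfirst.mono le_rfl fun s₁ hu h _ => hloop s₁ ?_ h)
    refine hu.mono (fun r hr => ?_) (fun a ha => ?_)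
    · simp only [Prog.WritesReg] at hr; rw [hF, forN_writesReg]; tauto
    · simp only [Prog.WritesArr] at ha; rw [hF, forN_writesArr]; tauto
  obtain ⟨t, s', he, ht, hq⟩ := hall
  have hb : N * (1 + T + 1 + 1) ≤ G.d * (T + 3) := Nat.mul_le_mul hlen (by omega)
  refine ⟨t, s', ?_, ?_, hq⟩
  · cases he with
    | seq ha hb =>
      cases ha with
      | seq ha1 ha2 =>
        rw [hF, forN, add_assoc]
        exact .seq ha1 (.seq ha2 hb)
  · have : (G.d + 1) * (T + 3) = G.d * (T + 3) + (T + 3) := by ring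
    omega

end RAM

/-! ## Traces of closed neighborhoods and pieces at distance greater than two -/

namespace PartialVC

namespace ListGraph

variable (G : ListGraph)

theorem mem_cN {v w : ℕ} : w ∈ G.cN v ↔ w = v ∨ w ∈ G.nb v := by simp [cN]

theorem self_mem_cN (v : ℕ) : v ∈ G.cN v := by simp [cN]

theorem cN_symm {v w : ℕ} (h : w ∈ G.cN v) : v ∈ G.cN w := by
  rw [mem_cN] at *
  exact h.imp Eq.symm (G.symm v w)

theorem mem_N2 {v w : ℕ} : w ∈ G.N2 v ↔ ∃ x ∈ G.cN v, w ∈ G.cN x := by simp [N2]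

theorem self_mem_N2 (v : ℕ) : v ∈ G.N2 v := G.mem_N2.2 ⟨v, G.self_mem_cN v, G.self_mem_cN v⟩

theorem N2_symm {v w : ℕ} (h : w ∈ G.N2 v) : v ∈ G.N2 w := by
  rw [mem_N2] at *
  obtain ⟨x, hx, hw⟩ := h
  exact ⟨x, G.cN_symm hw, G.cN_symm hx⟩

theorem cN_lt {v w : ℕ} (hv : v < G.n) (h : w ∈ G.cN v) : w < G.n := by
  rw [mem_cN] at h
  rcases h with rfl | h
  · exact hv
  · exact G.nb_lt _ _ h

theorem N2_lt {v w : ℕ} (hv : v < G.n) (h : w ∈ G.N2 v) : w < G.n := by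
  obtain ⟨x, hx, hw⟩ := G.mem_N2.1 h
  exact G.cN_lt (G.cN_lt hv hx) hw

theorem length_cN_le (v : ℕ) : (G.cN v).length ≤ G.d + 1 := by
  simpa [cN] using G.length_le v

theorem card_cN_erase_le {v u : ℕ} (h : u ∈ G.cN v) :
    ((G.cN v).toFinset.erase u).card ≤ G.d := by
  rw [Finset.card_erase_of_mem (by simpa using h)]
  have := (G.cN v).toFinset_card_le
  have := G.length_cN_le v
  omega

theorem card_nb_erase_le {v u : ℕ} (h : u ∈ G.nb v) :
    ((G.nb v).toFinset.erase u).card ≤ G.d - 1 := by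
  rw [Finset.card_erase_of_mem (by simpa using h)]
  have := (G.nb v).toFinset_card_le
  have := G.length_le v
  omega

theorem card_nb_le (v : ℕ) : (G.nb v).toFinset.card ≤ G.d :=
  ((G.nb v).toFinset_card_le).trans (G.length_le v)

/-- A vertex other than `v` within distance two lies in `N[w] \ {v}` for some neighbor `w` of `v`,
being itself that `w` if adjacent to `v`. There are at most `d` choices of `w`, and each such set
has at most `d` elements since `v` lies in `N[w]`. -/
theorem card_N2_le (v : ℕ) : (G.N2 v).toFinset.card ≤ G.d ^ 2 + 1 := by
  have hsub : (G.N2 v).toFinset ⊆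
      insert v ((G.nb v).toFinset.biUnion fun w => (G.cN w).toFinset.erase v) := by
    intro x hx
    rw [List.mem_toFinset, mem_N2] at hx
    obtain ⟨w, hw, hx⟩ := hx
    by_cases hxv : x = v
    · simp [hxv]
    rw [Finset.mem_insert, Finset.mem_biUnion]
    right
    rw [mem_cN] at hw
    rcases hw with rfl | hw
    · have hx' : x ∈ G.nb w := by
        rw [mem_cN] at hx; tauto
      exact ⟨x, by simpa using hx', by simp [hxv, self_mem_cN]⟩
    · exact ⟨w, by simpa using hw, by simp [hxv, hx]⟩
  refine (Finset.card_le_card hsub).trans ((Finset.card_insert_le _ _).trans ?_)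
  have h1 := Finset.card_biUnion_le_card_mul (G.nb v).toFinset
    (fun w => (G.cN w).toFinset.erase v) G.d (fun w hw => G.card_cN_erase_le
      (G.cN_symm (by rw [mem_cN]; right; simpa using hw)))
  have h2 := Nat.mul_le_mul_right G.d (G.card_nb_le v)
  have : G.d ^ 2 = G.d * G.d := sq _
  omega

/-- Some neighbor `w₀` of `u` has its whole closed neighborhood within distance two of `p`: the
middle vertex of a path from `p` to `u`, or `p` itself. New vertices thus arise only through the
other `d - 1` neighbors, at most `d` each. The saving of `d` over the trivial `d ^ 2` is what leaves
room for all polynomial factors in the final bound. -/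
theorem card_N2_sdiff_le {p u : ℕ} (hu : u ∈ G.N2 p) (hne : u ≠ p) :
    ((G.N2 u).toFinset \ (G.N2 p).toFinset).card ≤ G.d ^ 2 - G.d := by
  obtain ⟨w₀, hw₀, hsub⟩ : ∃ w₀ ∈ G.nb u, ∀ x ∈ G.cN w₀, x ∈ G.N2 p := by
    obtain ⟨x, hx, hux⟩ := G.mem_N2.1 hu
    by_cases h : x = u
    · subst h
      have hp : p ∈ G.nb x := by
        have := G.cN_symm hx; rw [mem_cN] at this; exact this.resolve_left hne.symm
      exact ⟨p, hp, fun y hy => G.mem_N2.2 ⟨p, G.self_mem_cN p, hy⟩⟩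
    · have hp : x ∈ G.nb u := by
        have := G.cN_symm hux; rw [mem_cN] at this; exact this.resolve_left h
      exact ⟨x, hp, fun y hy => G.mem_N2.2 ⟨x, hx, hy⟩⟩
  have hsub' : (G.N2 u).toFinset \ (G.N2 p).toFinset ⊆
      ((G.nb u).toFinset.erase w₀).biUnion fun w => (G.cN w).toFinset.erase u := by
    intro x hx
    simp only [Finset.mem_sdiff, List.mem_toFinset] at hx
    obtain ⟨hx, hxp⟩ := hx
    have hxu : x ≠ u := by rintro rfl; exact hxp hu
    obtain ⟨w, hw, hxw⟩ := G.mem_N2.1 hx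
    rw [Finset.mem_biUnion]
    rw [mem_cN] at hw
    rcases hw with rfl | hw
    · have hx' : x ∈ G.nb w := by
        rw [mem_cN] at hxw; tauto
      refine ⟨x, ?_, by simp [hxu, self_mem_cN]⟩
      rw [Finset.mem_erase]
      exact ⟨by rintro rfl; exact hxp (hsub x (G.self_mem_cN x)), by simpa using hx'⟩
    · refine ⟨w, ?_, by simp [hxu, hxw]⟩
      rw [Finset.mem_erase]
      exact ⟨by rintro rfl; exact hxp (hsub x hxw), by simpa using hw⟩
  refine (Finset.card_le_card hsub').trans ?_
  have h1 := Finset.card_biUnion_le_card_mul ((G.nb u).toFinset.erase w₀)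
    (fun w => (G.cN w).toFinset.erase u) G.d (fun w hw => G.card_cN_erase_le
      (G.cN_symm (by rw [mem_cN]; right; simpa using (Finset.mem_erase.1 hw).2)))
  have h2 := Nat.mul_le_mul_right G.d (G.card_nb_erase_le hw₀)
  refine h1.trans (h2.trans ?_)
  rw [Nat.sub_mul, sq, one_mul]

/-- The trace of the closed neighborhood of `v` on `C`. -/
def trace (C : Finset ℕ) (v : ℕ) : Finset ℕ := C.filter fun c => c ∈ G.cN v

/-- The nonempty traces of closed neighborhoods on `C`. -/
def traces (C : Finset ℕ) : Finset (Finset ℕ) := ((Finset.range G.n).image (G.trace C)).erase ∅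

/-- The number of nonempty traces on `C`. -/
def val (C : Finset ℕ) : ℕ := (G.traces C).card

theorem mem_trace {C : Finset ℕ} {v c : ℕ} : c ∈ G.trace C v ↔ c ∈ C ∧ c ∈ G.cN v := by
  simp [trace]

theorem mem_traces {C t : Finset ℕ} :
    t ∈ G.traces C ↔ t ≠ ∅ ∧ ∃ v < G.n, G.trace C v = t := by
  simp [traces]

/-- No vertex of `S` is at distance at most two of a vertex of `T`. -/
def Far (S T : Finset ℕ) : Prop := ∀ x ∈ S, ∀ y ∈ T, y ∉ G.N2 x

/-- A closed neighborhood that met both `S` and `T` would join them by a path of length at most two.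
-/
theorem trace_union_of_far {S T : Finset ℕ} (h : G.Far S T) {v c : ℕ} (hc : c ∈ S)
    (hcv : c ∈ G.cN v) : G.trace (S ∪ T) v = G.trace S v := by
  ext x
  simp only [mem_trace, Finset.mem_union]
  constructor
  · rintro ⟨hx | hx, hxv⟩
    · exact ⟨hx, hxv⟩
    · exact (h c hc x hx (G.mem_N2.2 ⟨v, G.cN_symm hcv, hxv⟩)).elim
  · rintro ⟨hx, hxv⟩; exact ⟨Or.inl hx, hxv⟩

theorem Far.symm {S T : Finset ℕ} (h : G.Far S T) : G.Far T S :=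
  fun x hx y hy hxy => h y hy x hx (G.N2_symm hxy)

/-- By `trace_union_of_far`, the nonempty traces on the union are those on `S` together with those
on `T`, and none is both. The empty trace would be common to the two sides, which is why `val`
leaves it out. -/
theorem val_union_of_far {S T : Finset ℕ} (h : G.Far S T) :
    G.val (S ∪ T) = G.val S + G.val T := by
  have hu : G.traces (S ∪ T) = G.traces S ∪ G.traces T := by
    ext t
    simp only [mem_traces, Finset.mem_union]
    constructor
    · rintro ⟨ht, v, hv, rfl⟩
      obtain ⟨c, hc⟩ := Finset.nonempty_iff_ne_empty.2 ht
      rw [mem_trace, Finset.mem_union] at hc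
      obtain ⟨hc | hc, hcv⟩ := hc
      · exact Or.inl ⟨ht, v, hv, (G.trace_union_of_far h hc hcv).symm⟩
      · refine Or.inr ⟨ht, v, hv, ?_⟩
        rw [Finset.union_comm]; exact (G.trace_union_of_far h.symm hc hcv).symm
    · rintro (⟨ht, v, hv, rfl⟩ | ⟨ht, v, hv, rfl⟩)
      · obtain ⟨c, hc⟩ := Finset.nonempty_iff_ne_empty.2 ht
        rw [mem_trace] at hc
        exact ⟨ht, v, hv, G.trace_union_of_far h hc.1 hc.2⟩
      · obtain ⟨c, hc⟩ := Finset.nonempty_iff_ne_empty.2 ht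
        rw [mem_trace] at hc
        refine ⟨ht, v, hv, ?_⟩
        rw [Finset.union_comm]; exact G.trace_union_of_far h.symm hc.1 hc.2
  rw [val, hu, Finset.card_union_of_disjoint, val, val]
  rw [Finset.disjoint_left]
  intro t ht ht'
  obtain ⟨hne, v, -, rfl⟩ := G.mem_traces.1 ht
  obtain ⟨-, v', -, hv'⟩ := G.mem_traces.1 ht'
  obtain ⟨c, hc⟩ := Finset.nonempty_iff_ne_empty.2 hne
  have hc' := hc
  rw [← hv'] at hc'
  rw [mem_trace] at hc hc'
  exact h c hc.1 c hc'.1 (G.self_mem_N2 c)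

/-- Positivity distinguishes a set that was really found from the initial record `(0, [])` of
`bestOf`. -/
theorem val_pos {C : Finset ℕ} {c : ℕ} (hc : c ∈ C) (hn : c < G.n) : 0 < G.val C := by
  refine Finset.card_pos.2 ⟨G.trace C c, G.mem_traces.2 ⟨?_, c, hn, rfl⟩⟩
  exact Finset.nonempty_iff_ne_empty.1 ⟨c, G.mem_trace.2 ⟨hc, G.self_mem_cN c⟩⟩

/-- `S` is a union of pieces of `R`: no vertex of `S` is at distance at most two of `R \ S`. -/
def Closed (S R : Finset ℕ) : Prop := S ⊆ R ∧ ∀ x ∈ S, ∀ y ∈ R, y ∈ G.N2 x → y ∈ S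

/-- `P` is connected by steps of length at most two. -/
def Conn (P : Finset ℕ) : Prop := ∀ S, G.Closed S P → S.Nonempty → S = P

/-- Every piece of `R` has at least `j` elements. -/
def PiecesGe (j : ℕ) (R : Finset ℕ) : Prop := ∀ S, G.Closed S R → S.Nonempty → j ≤ S.card

/-- Take a nonempty closed subset `P` of least size. A subset closed in `P` is closed in `R`, so
minimality forces it to be all of `P`. -/
theorem exists_min_piece {R : Finset ℕ} (hR : R.Nonempty) :
    ∃ P, G.Closed P R ∧ P.Nonempty ∧ G.Conn P ∧ G.PiecesGe P.card R := by
  classical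
  obtain ⟨P, hP, hmin⟩ := Finset.exists_min_image
    (R.powerset.filter fun S => G.Closed S R ∧ S.Nonempty) Finset.card
    ⟨R, by simp only [Finset.mem_filter, Finset.mem_powerset]
           exact ⟨subset_rfl, ⟨subset_rfl, fun _ _ y hy _ => hy⟩, hR⟩⟩
  simp only [Finset.mem_filter, Finset.mem_powerset] at hP hmin
  have hge : G.PiecesGe P.card R := fun S hS hne => hmin S ⟨hS.1, hS, hne⟩
  refine ⟨P, hP.2.1, hP.2.2, fun S hS hne => ?_, hge⟩
  refine Finset.eq_of_subset_of_card_le hS.1 (hge S ⟨hS.1.trans hP.1, fun x hx y hy hxy => ?_⟩ hne)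
  exact hS.2 x hx y (hP.2.1.2 x (hS.1 hx) y hy hxy) hxy

theorem conn_singleton (v : ℕ) : G.Conn {v} := by
  intro S hS hne
  exact (Finset.Nonempty.subset_singleton_iff hne).1 hS.1

/-- A closed set meeting `P` contains `P` by connectedness, and then also `u`, which is near `a`. A
closed set missing `P` would be `{u}`, but then `a` is near `u` and belongs to it. -/
theorem Conn.insert {P : Finset ℕ} (h : G.Conn P) {a u : ℕ} (ha : a ∈ P) (hu : u ∈ G.N2 a) :
    G.Conn (insert u P) := by
  intro S hS hne
  have hcl : G.Closed (S ∩ P) P := ⟨Finset.inter_subset_right, fun x hx y hy hxy => by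
    rw [Finset.mem_inter] at *
    exact ⟨hS.2 x hx.1 y (Finset.mem_insert_of_mem hy) hxy, hy⟩⟩
  by_cases hSP : (S ∩ P).Nonempty
  · have hP : P ⊆ S := by rw [← h _ hcl hSP]; exact Finset.inter_subset_left
    refine Finset.Subset.antisymm hS.1 (Finset.insert_subset ?_ hP)
    exact hS.2 a (hP ha) u (Finset.mem_insert_self _ _) hu
  · exfalso
    obtain ⟨x, hx⟩ := hne
    have hxu : x = u := by
      have := hS.1 hx
      rw [Finset.mem_insert] at this
      refine this.resolve_right fun hxP => hSP ⟨x, Finset.mem_inter.2 ⟨hx, hxP⟩⟩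
    subst hxu
    exact hSP ⟨a, Finset.mem_inter.2
      ⟨hS.2 x hx a (Finset.mem_insert_of_mem ha) (G.N2_symm hu), ha⟩⟩

end ListGraph

end PartialVC

/-! ## The search tree -/

namespace PartialVC

/-- Append to the queue `Q` those of the given vertices that are neither in `M` nor in the queue. -/
def pushL (M : Finset ℕ) (Q xs : List ℕ) : List ℕ :=
  xs.foldl (fun Q x => if x ∈ M ∨ x ∈ Q then Q else Q ++ [x]) Q

/-! ### The queue without repetitions -/

section pushL

variable {M : Finset ℕ} {Q xs ys : List ℕ}

@[simp] theorem pushL_nil : pushL M Q [] = Q := rfl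

theorem pushL_cons (x : ℕ) :
    pushL M Q (x :: xs) = pushL M (if x ∈ M ∨ x ∈ Q then Q else Q ++ [x]) xs := rfl

theorem pushL_append : pushL M Q (xs ++ ys) = pushL M (pushL M Q xs) ys := List.foldl_append

theorem pushL_snoc (x : ℕ) : pushL M Q (xs ++ [x]) =
    if x ∈ M ∨ x ∈ pushL M Q xs then pushL M Q xs else pushL M Q xs ++ [x] := by
  rw [pushL_append]; rfl

theorem prefix_pushL : Q <+: pushL M Q xs := by
  induction xs generalizing Q with
  | nil => exact List.prefix_rfl
  | cons x xs ih =>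
    rw [pushL_cons]
    refine List.IsPrefix.trans ?_ ih
    split_ifs
    · exact List.prefix_rfl
    · exact List.prefix_append _ _

theorem mem_pushL {x : ℕ} : x ∈ pushL M Q xs ↔ x ∈ Q ∨ (x ∈ xs ∧ x ∉ M) := by
  induction xs generalizing Q with
  | nil => simp
  | cons y xs ih =>
    rw [pushL_cons, ih]
    split_ifs with h
    · by_cases hxy : x = y
      · subst hxy; simp only [List.mem_cons, true_or, true_and]; tauto
      · simp [hxy]
    · by_cases hxy : x = y
      · subst hxy; simp only [List.mem_append, List.mem_cons, true_or, true_and]; tauto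
      · simp [hxy]

theorem nodup_pushL (h : Q.Nodup) : (pushL M Q xs).Nodup := by
  induction xs generalizing Q with
  | nil => exact h
  | cons y xs ih =>
    rw [pushL_cons]
    split_ifs with hy
    · exact ih h
    · refine ih (List.nodup_append.2 ⟨h, by simp, ?_⟩)
      simp only [List.mem_singleton, forall_eq]
      rintro a ha rfl; tauto

theorem nodup_drop_pushL (h : Q.Nodup) : ((pushL M Q xs).drop Q.length).Nodup :=
  (nodup_pushL h).sublist (List.drop_sublist _ _)

theorem pushL_eq_append : pushL M Q xs = Q ++ (pushL M Q xs).drop Q.length := by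
  obtain ⟨R, hR⟩ := prefix_pushL (M := M) (Q := Q) (xs := xs)
  rw [← hR]; simp

theorem mem_drop_pushL (h : Q.Nodup) {x : ℕ} :
    x ∈ (pushL M Q xs).drop Q.length ↔ x ∈ xs ∧ x ∉ M ∧ x ∉ Q := by
  have h1 := mem_pushL (M := M) (Q := Q) (xs := xs) (x := x)
  have h2 := nodup_pushL (M := M) (xs := xs) h
  rw [pushL_eq_append] at h1 h2
  rw [List.mem_append] at h1
  have h3 := List.disjoint_of_nodup_append h2
  have := @h3 x
  tauto

theorem length_pushL_le (h : Q.Nodup) : (pushL M Q xs).length ≤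
    Q.length + (xs.toFinset \ (M ∪ Q.toFinset)).card := by
  have h1 := congrArg List.length (pushL_eq_append (M := M) (Q := Q) (xs := xs))
  rw [List.length_append] at h1
  rw [h1, ← List.toFinset_card_of_nodup (nodup_drop_pushL h)]
  refine Nat.add_le_add_left (Finset.card_le_card fun x hx => ?_) _
  rw [List.mem_toFinset, mem_drop_pushL h] at hx
  simp only [Finset.mem_sdiff, Finset.mem_union, List.mem_toFinset]
  tauto

end pushL

/-- A node of the search tree: the queue of candidates, how many of them are decided, the chosen
vertices, the least size of a piece, and the number of vertices that must be chosen before the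
current piece may be complete. -/
structure Node where
  Q : List ℕ
  h : ℕ
  A : List ℕ
  j : ℕ
  need : ℕ

/-- The node without any choices. -/
def Node.start : Node := ⟨[], 0, [], 1, 0⟩

/-- Discard the next candidate. -/
def Node.outC (σ : Node) : Node := ⟨σ.Q, σ.h + 1, σ.A, σ.j, σ.need⟩

/-- A search for sets of `k` vertices outside `M`; when the queue is exhausted, `roots` lists the
ways to go on. -/
structure Search where
  G : ListGraph
  M : Finset ℕ
  k : ℕ
  roots : Node → List (Option (ℕ × ℕ × ℕ))

namespace Search

variable (S : Search)

/-- Choose the next candidate. -/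
def inC (σ : Node) : Node :=
  ⟨pushL S.M σ.Q (S.G.N2 (σ.Q.getD σ.h 0)), σ.h + 1, σ.A ++ [σ.Q.getD σ.h 0], σ.j, σ.need⟩

/-- Begin a new piece. -/
def rootC (σ : Node) (r : ℕ × ℕ × ℕ) : Node :=
  ⟨pushL S.M σ.Q (S.G.N2 r.2.2), σ.Q.length + 1, σ.A ++ [r.2.2], r.1, r.2.1⟩

/-- The sets of `k` vertices found below a node, in the order of the search. -/
def leaves (σ : Node) : List (List ℕ) :=
  if hk : S.k ≤ σ.A.length then [σ.A]
  else if hQ : σ.h < σ.Q.length then leaves (S.inC σ) ++ leaves (σ.outC)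
  else if σ.A.length < σ.need then []
  else (S.roots σ).flatMap fun o =>
    match o with
    | none => []
    | some r => leaves (S.rootC σ r)
termination_by (S.k - σ.A.length, σ.Q.length - σ.h)
decreasing_by
  · apply Prod.Lex.left; simp only [inC, List.length_append, List.length_singleton]; omega
  · apply Prod.Lex.right; simp only [Node.outC]; omega
  · apply Prod.Lex.left; simp only [rootC, List.length_append, List.length_singleton]; omega

/-- The cost of searching below a node, if a visit of a node costs `E` steps and finding one of the
roots of `σ` costs `R σ` steps. -/
def cost (E : ℕ) (R : Node → ℕ) (σ : Node) : ℕ :=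
  if hk : S.k ≤ σ.A.length then E
  else if hQ : σ.h < σ.Q.length then 3 * E + cost E R (S.inC σ) + cost E R (σ.outC)
  else if σ.A.length < σ.need then E
  else ((S.roots σ).length + 1) * (E + R σ) + ((S.roots σ).map fun o =>
    match o with
    | none => 0
    | some r => cost E R (S.rootC σ r)).sum
termination_by (S.k - σ.A.length, σ.Q.length - σ.h)
decreasing_by
  · apply Prod.Lex.left; simp only [inC, List.length_append, List.length_singleton]; omega
  · apply Prod.Lex.right; simp only [Node.outC]; omega
  · apply Prod.Lex.left; simp only [rootC, List.length_append, List.length_singleton]; omega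

/-- Induction along the lexicographic measure of `leaves`: choosing a vertex lowers the number of
missing vertices although it may lengthen the queue, and discarding one shortens the undecided part
of the queue. -/
theorem node_induction {P : Node → Prop}
    (h : ∀ σ, (σ.A.length < S.k → P (S.inC σ)) → (σ.h < σ.Q.length → P (σ.outC)) →
      (σ.A.length < S.k → ∀ r, P (S.rootC σ r)) → P σ) (σ : Node) : P σ := by
  suffices H : ∀ a b : ℕ, ∀ σ : Node, S.k - σ.A.length = a → σ.Q.length - σ.h = b → P σ from
    H _ _ σ rfl rfl
  intro a
  induction a using Nat.strong_induction_on with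
  | _ a iha =>
    intro b
    induction b using Nat.strong_induction_on with
    | _ b ihb =>
      intro σ ha hb
      refine h σ (fun hk => iha _ ?_ _ _ rfl rfl) (fun hQ => ihb _ ?_ _ ?_ rfl)
        (fun hk r => iha _ ?_ _ _ rfl rfl)
      · simp only [inC, List.length_append, List.length_singleton]; omega
      · simp only [Node.outC]; omega
      · simpa only [Node.outC] using ha
      · simp only [rootC, List.length_append, List.length_singleton]; omega

/-- The properties of all nodes that are met. -/
structure Ok (σ : Node) : Prop where
  nodup : σ.Q.Nodup
  fresh : ∀ x ∈ σ.Q, x < S.G.n ∧ x ∉ S.M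
  h_le : σ.h ≤ σ.Q.length
  A_nodup : σ.A.Nodup
  A_sub : ∀ a ∈ σ.A, a ∈ σ.Q.take σ.h
  N2_sub : ∀ a ∈ σ.A, ∀ x ∈ S.G.N2 a, x ∈ S.M ∨ x ∈ σ.Q
  A_le : σ.A.length ≤ S.k
  parent : ∀ x ∈ σ.Q.drop σ.h, ∃ a ∈ σ.A, x ∈ S.G.N2 a
  Q_len : σ.Q.length ≤ σ.A.length * (S.G.d ^ 2 + 1)

/-- The root `r` may be used at `σ`. -/
def RootOk (σ : Node) (r : ℕ × ℕ × ℕ) : Prop :=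
  r.2.2 < S.G.n ∧ r.2.2 ∉ S.M ∧ r.2.2 ∉ σ.Q

/-- All roots may be used. -/
def RootsOk : Prop := ∀ σ, S.Ok σ → ∀ r, some r ∈ S.roots σ → S.RootOk σ r

variable {S}

theorem Ok.start : S.Ok Node.start := by
  constructor <;> simp [Node.start]

theorem getD_mem {L : List ℕ} {i : ℕ} (h : i < L.length) : L.getD i 0 ∈ L := by
  rw [List.getD_eq_getElem _ _ h]; exact List.getElem_mem h

theorem take_succ_getD {L : List ℕ} {i : ℕ} (h : i < L.length) :
    L.take (i + 1) = L.take i ++ [L.getD i 0] := by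
  rw [List.getD_eq_getElem _ _ h, List.take_succ_eq_append_getElem h]

theorem Ok.getD_notMem {σ : Node} (hσ : S.Ok σ) (h : σ.h < σ.Q.length) :
    σ.Q.getD σ.h 0 ∉ σ.Q.take σ.h := by
  have h1 : (σ.Q.take (σ.h + 1)).Nodup := hσ.nodup.sublist (List.take_sublist _ _)
  rw [take_succ_getD h] at h1
  have := List.disjoint_of_nodup_append h1
  intro hm
  exact this hm (by simp)

theorem card_new_le {M : Finset ℕ} {Q : List ℕ} (u : ℕ) :
    ((S.G.N2 u).toFinset \ (M ∪ Q.toFinset)).card ≤ S.G.d ^ 2 + 1 :=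
  (Finset.card_le_card Finset.sdiff_subset).trans (S.G.card_N2_le u)

theorem take_of_isPrefix {L L' : List ℕ} (h : L <+: L') {i : ℕ} (hi : i ≤ L.length) :
    L'.take i = L.take i := by
  obtain ⟨R, rfl⟩ := h
  exact List.take_append_of_le_length hi

theorem take_inC {σ : Node} (h : σ.h < σ.Q.length) :
    (S.inC σ).Q.take (S.inC σ).h = σ.Q.take σ.h ++ [σ.Q.getD σ.h 0] := by
  simp only [inC]
  rw [take_of_isPrefix prefix_pushL (by omega), take_succ_getD h]

/-- The clause `parent` is preserved because an undecided candidate is either an old one or comes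
from the vertex just chosen. It later yields both connectedness of the leaves and the bound on new
candidates. -/
theorem Ok.inC {σ : Node} (hσ : S.Ok σ) (hk : σ.A.length < S.k) (h : σ.h < σ.Q.length) :
    S.Ok (S.inC σ) := by
  have hmem := getD_mem h
  have htake := take_inC (S := S) h
  set v := σ.Q.getD σ.h 0 with hv
  constructor
  · exact nodup_pushL hσ.nodup
  · intro x hx
    simp only [Search.inC] at hx
    rw [mem_pushL] at hx
    rcases hx with hx | ⟨hx, hM⟩
    · exact hσ.fresh x hx
    · exact ⟨S.G.N2_lt (hσ.fresh _ hmem).1 hx, hM⟩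
  · have := (prefix_pushL (M := S.M) (Q := σ.Q) (xs := S.G.N2 v)).length_le
    simp only [Search.inC, ← hv]; omega
  · simp only [Search.inC]
    refine List.nodup_append.2 ⟨hσ.A_nodup, by simp, ?_⟩
    simp only [List.mem_singleton, forall_eq]
    rintro a ha rfl
    exact hσ.getD_notMem h (hσ.A_sub _ ha)
  · intro a ha
    rw [htake]
    simp only [Search.inC, List.mem_append, List.mem_singleton] at ha ⊢
    exact ha.imp (hσ.A_sub a) id
  · intro a ha x hx
    simp only [Search.inC, List.mem_append, List.mem_singleton] at ha ⊢
    rw [mem_pushL]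
    rcases ha with ha | rfl
    · exact (hσ.N2_sub a ha x hx).imp id Or.inl
    · tauto
  · simp only [Search.inC, List.length_append, List.length_singleton]; omega
  · intro x hx
    have hx' : x ∈ σ.Q.drop σ.h ∨ x ∈ S.G.N2 v := by
      simp only [Search.inC, ← hv] at hx
      rw [pushL_eq_append, List.drop_append] at hx
      rw [List.mem_append] at hx
      rcases hx with hx | hx
      · left
        rw [← List.drop_drop] at hx
        exact List.mem_of_mem_drop hx
      · right
        exact ((mem_drop_pushL hσ.nodup).1 (List.mem_of_mem_drop hx)).1
    simp only [Search.inC, List.mem_append, List.mem_singleton]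
    rcases hx' with hx' | hx'
    · obtain ⟨a, ha, hxa⟩ := hσ.parent x hx'
      exact ⟨a, Or.inl ha, hxa⟩
    · exact ⟨v, Or.inr rfl, hx'⟩
  · have h1 := length_pushL_le (M := S.M) (xs := S.G.N2 v) hσ.nodup
    have h2 := card_new_le (S := S) (M := S.M) (Q := σ.Q) v
    have h3 := hσ.Q_len
    simp only [Search.inC, List.length_append, List.length_singleton, add_mul, ← hv]; omega

theorem Ok.outC {σ : Node} (hσ : S.Ok σ) (h : σ.h < σ.Q.length) : S.Ok (σ.outC) := by
  refine ⟨hσ.nodup, hσ.fresh, h, hσ.A_nodup, fun a ha => ?_, hσ.N2_sub, hσ.A_le, fun x hx => ?_,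
    hσ.Q_len⟩
  · simp only [Node.outC]; rw [take_succ_getD h]; simp [hσ.A_sub a ha]
  · simp only [Node.outC] at hx
    rw [← List.drop_drop] at hx
    exact hσ.parent x (List.mem_of_mem_drop hx)

theorem N2_eq_cons (G : ListGraph) (u : ℕ) : ∃ L, G.N2 u = u :: L := by
  simp [ListGraph.N2, ListGraph.cN]

/-- `N2` lists its vertex first, and a root is neither marked nor queued; so the root comes right
after the old queue, and `h = Q.length + 1` declares exactly the root decided. -/
theorem prefix_rootC {σ : Node} {r : ℕ × ℕ × ℕ} (hr : S.RootOk σ r) :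
    σ.Q ++ [r.2.2] <+: (S.rootC σ r).Q := by
  obtain ⟨L, hL⟩ := N2_eq_cons S.G r.2.2
  simp only [rootC]
  rw [hL, pushL_cons, if_neg (by have := hr.2; tauto)]
  exact prefix_pushL

theorem take_rootC {σ : Node} {r : ℕ × ℕ × ℕ} (hr : S.RootOk σ r) :
    (S.rootC σ r).Q.take (S.rootC σ r).h = σ.Q ++ [r.2.2] := by
  rw [take_of_isPrefix (prefix_rootC hr) (by simp [rootC])]
  simp [rootC]

theorem Ok.rootC {σ : Node} (hσ : S.Ok σ) (hk : σ.A.length < S.k) {r : ℕ × ℕ × ℕ}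
    (hr : S.RootOk σ r) : S.Ok (S.rootC σ r) := by
  have htake := take_rootC hr
  obtain ⟨hu, hM, hQ⟩ := hr
  have hpre := prefix_rootC ⟨hu, hM, hQ⟩
  set u := r.2.2 with hv
  constructor
  · exact nodup_pushL hσ.nodup
  · intro x hx
    simp only [Search.rootC] at hx
    rw [mem_pushL] at hx
    rcases hx with hx | ⟨hx, hM⟩
    · exact hσ.fresh x hx
    · exact ⟨S.G.N2_lt hu hx, hM⟩
  · simpa [Search.rootC] using hpre.length_le
  · simp only [Search.rootC]
    refine List.nodup_append.2 ⟨hσ.A_nodup, by simp, ?_⟩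
    simp only [List.mem_singleton, forall_eq]
    rintro a ha rfl
    exact hQ (List.mem_of_mem_take (hσ.A_sub _ ha))
  · intro a ha
    rw [htake]
    simp only [Search.rootC, List.mem_append, List.mem_singleton] at ha ⊢
    exact ha.imp (fun h => List.mem_of_mem_take (hσ.A_sub a h)) id
  · intro a ha x hx
    simp only [Search.rootC, List.mem_append, List.mem_singleton] at ha ⊢
    rw [mem_pushL]
    rcases ha with ha | rfl
    · exact (hσ.N2_sub a ha x hx).imp id Or.inl
    · tauto
  · simp only [Search.rootC, List.length_append, List.length_singleton]; omega
  · intro x hx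
    simp only [Search.rootC, List.mem_append, List.mem_singleton]
    refine ⟨u, Or.inr rfl, ?_⟩
    simp only [Search.rootC] at hx
    rw [← List.drop_drop] at hx
    exact ((mem_drop_pushL hσ.nodup).1 (List.mem_of_mem_drop hx)).1
  · have h1 := length_pushL_le (M := S.M) (xs := S.G.N2 u) hσ.nodup
    have h2 := card_new_le (S := S) (M := S.M) (Q := σ.Q) u
    have h3 := hσ.Q_len
    simp only [Search.rootC, List.length_append, List.length_singleton, add_mul, ← hv]; omega

theorem leaves_sound (hS : S.RootsOk) (σ : Node) (hσ : S.Ok σ) :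
    ∀ A ∈ S.leaves σ, A.Nodup ∧ A.length = S.k ∧ ∀ a ∈ A, a < S.G.n ∧ a ∉ S.M := by
  induction σ using S.node_induction with
  | h σ ih₁ ih₂ ih₃ =>
    intro A hA
    rw [leaves] at hA
    split_ifs at hA with hk hQ hn
    · rw [List.mem_singleton] at hA
      subst hA
      exact ⟨hσ.A_nodup, le_antisymm hσ.A_le hk,
        fun a ha => hσ.fresh a (List.mem_of_mem_take (hσ.A_sub a ha))⟩
    · rw [List.mem_append] at hA
      rcases hA with hA | hA
      · exact ih₁ (by omega) (hσ.inC (by omega) hQ) A hA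
      · exact ih₂ hQ (hσ.outC hQ) A hA
    · simp at hA
    · rw [List.mem_flatMap] at hA
      obtain ⟨o, ho, hA⟩ := hA
      cases o with
      | none => simp at hA
      | some r => exact ih₃ (by omega) r (hσ.rootC (by omega) (hS σ hσ r ho)) A hA

end Search

/-- Keep the better one of the best set so far and a new set. -/
def updBest (G : ListGraph) (b : ℕ × List ℕ) (A : List ℕ) : ℕ × List ℕ :=
  if b.1 < G.val A.toFinset then (G.val A.toFinset, A) else b

/-- The best one of a list of sets. -/
def bestOf (G : ListGraph) (L : List (List ℕ)) : ℕ × List ℕ := L.foldl (updBest G) (0, [])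

theorem bestOf_snoc (G : ListGraph) (L : List (List ℕ)) (A : List ℕ) :
    bestOf G (L ++ [A]) = updBest G (bestOf G L) A := by simp [bestOf]

theorem bestOf_spec (G : ListGraph) (L : List (List ℕ)) :
    (∀ A ∈ L, G.val A.toFinset ≤ (bestOf G L).1) ∧
    (((bestOf G L).2 ∈ L ∧ G.val (bestOf G L).2.toFinset = (bestOf G L).1) ∨
      bestOf G L = (0, [])) := by
  induction L using List.reverseRecOn with
  | nil => simp [bestOf]
  | append_singleton L A ih =>
    rw [bestOf_snoc, updBest]
    obtain ⟨ih₁, ih₂⟩ := ih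
    split_ifs with h
    · refine ⟨fun B hB => ?_, Or.inl ⟨by simp, rfl⟩⟩
      rw [List.mem_append, List.mem_singleton] at hB
      rcases hB with hB | rfl
      · exact (ih₁ B hB).trans h.le
      · exact le_rfl
    · refine ⟨fun B hB => ?_, ?_⟩
      · rw [List.mem_append, List.mem_singleton] at hB
        rcases hB with hB | rfl
        · exact ih₁ B hB
        · exact not_lt.1 h
      · exact ih₂.imp (fun h => ⟨List.mem_append_left _ h.1, h.2⟩) id

/-- The search for connected sets of `j` vertices outside `M`. -/
def innerSearch (G : ListGraph) (M : Finset ℕ) (j : ℕ) : Search where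
  G := G
  M := M
  k := j
  roots σ := (List.range G.n).map fun v =>
    if v ∈ M ∨ v ∈ σ.Q then none else some (j, j, v)

/-- A best connected set of `j` vertices outside `M`, and `[]` if there is none. -/
def innerBest (G : ListGraph) (M : Finset ℕ) (j : ℕ) : List ℕ :=
  (bestOf G ((innerSearch G M j).leaves Node.start)).2

/-- The search for an optimal set of `k` vertices outside `M`. -/
def outerSearch (G : ListGraph) (M : Finset ℕ) (k : ℕ) : Search where
  G := G
  M := M
  k := k
  roots σ := (List.range' σ.j (k + 1 - (σ.A.length + σ.j))).flatMap fun j =>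
    ((pushL M σ.Q ((innerBest G (M ∪ σ.Q.toFinset) j).flatMap G.N2)).drop σ.Q.length).map
      fun u => some (j, σ.A.length + j, u)

/-! ### Soundness and completeness of the search for connected sets -/

section inner

variable {G : ListGraph} {M : Finset ℕ} {j : ℕ}

theorem mem_innerSearch_roots {σ : Node} {r : ℕ × ℕ × ℕ} :
    some r ∈ (innerSearch G M j).roots σ ↔
      ∃ v < G.n, v ∉ M ∧ v ∉ σ.Q ∧ r = (j, j, v) := by
  simp only [innerSearch, List.mem_map, List.mem_range]
  constructor
  · rintro ⟨v, hv, h⟩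
    split_ifs at h with h'
    rw [not_or] at h'
    exact ⟨v, hv, h'.1, h'.2, (Option.some.inj h).symm⟩
  · rintro ⟨v, hv, h1, h2, rfl⟩
    exact ⟨v, hv, by simp [h1, h2]⟩

theorem innerSearch_rootsOk : (innerSearch G M j).RootsOk := by
  intro σ _ r hr
  obtain ⟨v, h1, h2, h3, rfl⟩ := mem_innerSearch_roots.1 hr
  exact ⟨h1, h2, h3⟩

/-- Each candidate is near a chosen vertex, so choosing it keeps the set connected. As `need = j`, a
queue exhausted before `j` choices ends the branch, and no second root is ever started. -/
theorem inner_leaves_conn (σ : Node) (hσ : (innerSearch G M j).Ok σ) (hA : G.Conn σ.A.toFinset)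
    (hn : σ.need = j) : ∀ A ∈ (innerSearch G M j).leaves σ, G.Conn A.toFinset := by
  induction σ using (innerSearch G M j).node_induction with
  | h σ ih₁ ih₂ ih₃ =>
    intro A hAl
    rw [Search.leaves] at hAl
    split_ifs at hAl with hk hQ hn'
    · rw [List.mem_singleton] at hAl
      exact hAl ▸ hA
    · rw [List.mem_append] at hAl
      rcases hAl with hAl | hAl
      · refine ih₁ (by omega) (hσ.inC (by omega) hQ) ?_ hn A hAl
        obtain ⟨a, ha, hN⟩ := hσ.parent (σ.Q.getD σ.h 0) (by
          rw [List.drop_eq_getElem_cons hQ, List.getD_eq_getElem _ _ hQ]; exact List.mem_cons_self)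
        have : (σ.A ++ [σ.Q.getD σ.h 0]).toFinset = insert (σ.Q.getD σ.h 0) σ.A.toFinset := by
          ext; simp [or_comm]
        simp only [Search.inC]
        rw [this]
        exact hA.insert G (by simpa using ha) hN
      · exact ih₂ hQ (hσ.outC hQ) hA hn A hAl
    · simp at hAl
    · exfalso
      have : (innerSearch G M j).k = j := rfl
      omega

theorem inner_leaves_start {A : List ℕ} (hj : 0 < j)
    (hA : A ∈ (innerSearch G M j).leaves Node.start) :
    A.Nodup ∧ A.length = j ∧ (∀ a ∈ A, a < G.n ∧ a ∉ M) ∧ G.Conn A.toFinset := by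
  obtain ⟨h1, h2, h3⟩ := Search.leaves_sound innerSearch_rootsOk _ Search.Ok.start A hA
  refine ⟨h1, h2, h3, ?_⟩
  rw [Search.leaves] at hA
  have hk : ¬ (innerSearch G M j).k ≤ Node.start.A.length := by
    simp [innerSearch, Node.start]; omega
  rw [dif_neg hk, dif_neg (by simp [Node.start]), if_neg (by simp [Node.start]),
    List.mem_flatMap] at hA
  obtain ⟨o, ho, hA⟩ := hA
  cases o with
  | none => simp at hA
  | some r =>
    have hr := innerSearch_rootsOk _ Search.Ok.start r ho
    obtain ⟨v, -, -, -, rfl⟩ := mem_innerSearch_roots.1 ho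
    refine inner_leaves_conn _ (Search.Ok.start.rootC (by simpa [Node.start, innerSearch] using hj)
      hr) ?_ rfl A hA
    simpa [Search.rootC, Node.start] using G.conn_singleton v

/-- Decide every candidate according to membership in `P`. If the queue ran out before `j` choices,
everything of `P` near a chosen vertex would be chosen; the chosen set would be closed in `P`, hence
equal to `P`, which is too large. -/
theorem inner_leaves_complete {P : Finset ℕ} (hP : G.Conn P) (hPM : ∀ x ∈ P, x < G.n ∧ x ∉ M)
    (hcard : P.card = j) (σ : Node) (hσ : (innerSearch G M j).Ok σ) (hne : σ.A ≠ [])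
    (hAP : σ.A.toFinset ⊆ P) (hdec : ∀ x ∈ σ.Q.take σ.h, x ∈ P → x ∈ σ.A) :
    ∃ A ∈ (innerSearch G M j).leaves σ, A.toFinset = P := by
  induction σ using (innerSearch G M j).node_induction with
  | h σ ih₁ ih₂ ih₃ =>
    rw [Search.leaves]
    have hcA : σ.A.toFinset.card = σ.A.length := List.toFinset_card_of_nodup hσ.A_nodup
    split_ifs with hk hQ hn
    · have hk' : j ≤ σ.A.length := hk
      exact ⟨σ.A, by simp, Finset.eq_of_subset_of_card_le hAP (by omega)⟩
    · by_cases hv : σ.Q.getD σ.h 0 ∈ P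
      · obtain ⟨A, hA, h⟩ := ih₁ (by omega) (hσ.inC (by omega) hQ) (by simp [Search.inC]) (by
            intro x hx
            simp only [Search.inC, List.toFinset_append, Finset.mem_union, List.mem_toFinset,
              List.mem_singleton] at hx
            rcases hx with hx | rfl
            · exact hAP (by simpa using hx)
            · exact hv) (by
            intro x hx hxP
            rw [Search.take_inC hQ] at hx
            simp only [Search.inC, List.mem_append, List.mem_singleton] at hx ⊢
            exact hx.imp (fun h => hdec x h hxP) id)
        exact ⟨A, List.mem_append_left _ hA, h⟩
      · obtain ⟨A, hA, h⟩ := ih₂ hQ (hσ.outC hQ) hne hAP (by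
            intro x hx hxP
            simp only [Node.outC] at hx ⊢
            rw [Search.take_succ_getD hQ, List.mem_append, List.mem_singleton] at hx
            rcases hx with hx | rfl
            · exact hdec x hx hxP
            · exact (hv hxP).elim)
        exact ⟨A, List.mem_append_right _ hA, h⟩
    -- Both ways of treating an exhausted queue, failing and starting a new root, are impossible
    -- here.
    all_goals
      exfalso
      have hk' : ¬ j ≤ σ.A.length := hk
      have hcl : G.Closed σ.A.toFinset P := by
        refine ⟨hAP, fun x hx y hy hxy => ?_⟩
        rw [List.mem_toFinset] at hx ⊢
        refine hdec y ?_ hy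
        rw [List.take_of_length_le (by omega)]
        exact (hσ.N2_sub x hx y hxy).resolve_left (hPM y hy).2
      have := hP _ hcl (by simpa using hne)
      rw [← this] at hcard
      omega

theorem exists_inner_leaf {P : Finset ℕ} (hP : G.Conn P) (hPM : ∀ x ∈ P, x < G.n ∧ x ∉ M)
    (hcard : P.card = j) (hj : 0 < j) :
    ∃ A ∈ (innerSearch G M j).leaves Node.start, A.toFinset = P := by
  obtain ⟨u, hu⟩ : P.Nonempty := Finset.card_pos.1 (by omega)
  have hk : ¬ (innerSearch G M j).k ≤ Node.start.A.length := by
    simp [innerSearch, Node.start]; omega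
  have hr : some (j, j, u) ∈ (innerSearch G M j).roots Node.start :=
    mem_innerSearch_roots.2 ⟨u, (hPM u hu).1, (hPM u hu).2, by simp [Node.start], rfl⟩
  have hrok := innerSearch_rootsOk _ Search.Ok.start _ hr
  obtain ⟨A, hA, h⟩ := inner_leaves_complete hP hPM hcard _
    (Search.Ok.start.rootC (by omega) hrok) (by simp [Search.rootC])
    (by simpa [Search.rootC, Node.start] using hu) (by
      intro x hx _
      rw [Search.take_rootC hrok] at hx
      simpa [Search.rootC, Node.start] using hx)
  refine ⟨A, ?_, h⟩
  rw [Search.leaves, dif_neg hk, dif_neg (by simp [Node.start]), if_neg (by simp [Node.start]),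
    List.mem_flatMap]
  exact ⟨_, hr, hA⟩

theorem innerBest_sub {x : ℕ} (hx : x ∈ innerBest G M j) : x < G.n ∧ x ∉ M := by
  rcases (bestOf_spec G ((innerSearch G M j).leaves Node.start)).2 with h | h
  · exact (Search.leaves_sound innerSearch_rootsOk _ Search.Ok.start _ h.1).2.2 x hx
  · rw [innerBest, h] at hx; simp at hx

theorem length_innerBest_le : (innerBest G M j).length ≤ j := by
  rcases (bestOf_spec G ((innerSearch G M j).leaves Node.start)).2 with h | h
  · exact (Search.leaves_sound innerSearch_rootsOk _ Search.Ok.start _ h.1).2.1.le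
  · rw [innerBest, h]; simp

/-- The existence of one connected `j`-set makes the recorded maximum positive, so the record is a
genuine leaf and not the default `[]`. -/
theorem innerBest_spec {P : Finset ℕ} (hP : G.Conn P) (hPM : ∀ x ∈ P, x < G.n ∧ x ∉ M)
    (hcard : P.card = j) (hj : 0 < j) :
    (innerBest G M j).Nodup ∧ (innerBest G M j).length = j ∧
      (∀ a ∈ innerBest G M j, a < G.n ∧ a ∉ M) ∧ G.Conn (innerBest G M j).toFinset ∧
      G.val P ≤ G.val (innerBest G M j).toFinset := by
  obtain ⟨A, hA, rfl⟩ := exists_inner_leaf hP hPM hcard hj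
  obtain ⟨h1, h2⟩ := bestOf_spec G ((innerSearch G M j).leaves Node.start)
  have hle := h1 A hA
  rcases h2 with ⟨h2, h3⟩ | h2
  · obtain ⟨a1, a2, a3, a4⟩ := inner_leaves_start hj h2
    refine ⟨a1, a2, a3, a4, ?_⟩
    rw [innerBest, h3]; exact hle
  · exfalso
    rw [h2] at hle
    obtain ⟨x, hx⟩ : A.toFinset.Nonempty := Finset.card_pos.1 (by omega)
    have := G.val_pos hx (hPM x hx).1
    simp at hle
    omega

end inner

end PartialVC

/-! ## Correctness of the search -/

namespace PartialVC

section outer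

variable {G : ListGraph} {M : Finset ℕ} {k : ℕ}

theorem mem_outerSearch_roots {σ : Node} (hQ : σ.Q.Nodup) {r : ℕ × ℕ × ℕ} :
    some r ∈ (outerSearch G M k).roots σ ↔
      ∃ j u, σ.j ≤ j ∧ σ.A.length + j ≤ k ∧ u ∉ M ∧ u ∉ σ.Q ∧
        (∃ p ∈ innerBest G (M ∪ σ.Q.toFinset) j, u ∈ G.N2 p) ∧ r = (j, σ.A.length + j, u) := by
  simp only [outerSearch, List.mem_flatMap, List.mem_map, List.mem_range'_1, mem_drop_pushL hQ,
    Option.some.injEq]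
  constructor
  · rintro ⟨j, hj, u, ⟨⟨p, hp, hup⟩, hM, hu⟩, rfl⟩
    exact ⟨j, u, by omega, by omega, hM, hu, ⟨p, hp, hup⟩, rfl⟩
  · rintro ⟨j, u, h1, h2, h3, h4, ⟨p, hp, hup⟩, rfl⟩
    exact ⟨j, by omega, u, ⟨⟨p, hp, hup⟩, h3, h4⟩, rfl⟩

theorem outerSearch_rootsOk : (outerSearch G M k).RootsOk := by
  intro σ hσ r hr
  obtain ⟨j, u, h1, h2, h3, h4, ⟨p, hp, hup⟩, rfl⟩ := (mem_outerSearch_roots hσ.nodup).1 hr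
  exact ⟨G.N2_lt (innerBest_sub hp).1 hup, h3, h4⟩

-- The competitor `C` agrees with all decisions made so far, and it is generalized because exchanges
-- replace it on the way down. The set `B` consists of the vertices chosen before the current piece
-- was started. All pieces of `C \ B` have at least `σ.j` elements, which justifies cutting off
-- branches whose current piece closes too early.
set_option maxHeartbeats 1000000 in
theorem outer_leaves_complete (σ : Node) (hσ : (outerSearch G M k).Ok σ) (hj : 1 ≤ σ.j)
    {C : Finset ℕ} (hCM : ∀ x ∈ C, x < G.n ∧ x ∉ M) (hcard : C.card = k)
    (hAC : σ.A.toFinset ⊆ C) (hdec : ∀ x ∈ σ.Q.take σ.h, x ∈ C → x ∈ σ.A)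
    (hB : ∃ B ⊆ σ.A.toFinset, G.PiecesGe σ.j (C \ B) ∧
      (σ.need ≤ B.card ∨ ((σ.A.toFinset \ B).Nonempty ∧ σ.need ≤ B.card + σ.j))) :
    ∃ A ∈ (outerSearch G M k).leaves σ, G.val C ≤ G.val A.toFinset := by
  induction σ using (outerSearch G M k).node_induction generalizing C with
  | h σ ih₁ ih₂ ih₃ =>
    rw [Search.leaves]
    have hcA : σ.A.toFinset.card = σ.A.length := List.toFinset_card_of_nodup hσ.A_nodup
    split_ifs with hk hQ hn
    · have hk' : k ≤ σ.A.length := hk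
      exact ⟨σ.A, by simp, by rw [Finset.eq_of_subset_of_card_le hAC (by omega)]⟩
    · by_cases hv : σ.Q.getD σ.h 0 ∈ C
      · obtain ⟨A, hA, h⟩ := ih₁ (by omega) (hσ.inC (by omega) hQ) hj hCM hcard (by
            intro x hx
            simp only [Search.inC, List.toFinset_append, Finset.mem_union, List.mem_toFinset,
              List.mem_singleton] at hx
            rcases hx with hx | rfl
            · exact hAC (by simpa using hx)
            · exact hv) (by
            intro x hx hxC
            rw [Search.take_inC hQ] at hx
            simp only [Search.inC, List.mem_append, List.mem_singleton] at hx ⊢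
            exact hx.imp (fun h => hdec x h hxC) id) (by
            obtain ⟨B, hBA, hP, hB⟩ := hB
            have hsub : σ.A.toFinset ⊆ (σ.A ++ [σ.Q.getD σ.h 0]).toFinset := by
              intro x hx; simp at hx ⊢; tauto
            exact ⟨B, hBA.trans hsub, hP, hB.imp id fun h =>
              ⟨h.1.mono (Finset.sdiff_subset_sdiff hsub subset_rfl), h.2⟩⟩)
        exact ⟨A, List.mem_append_left _ hA, h⟩
      · obtain ⟨A, hA, h⟩ := ih₂ hQ (hσ.outC hQ) hj hCM hcard hAC (by
            intro x hx hxC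
            simp only [Node.outC] at hx ⊢
            rw [Search.take_succ_getD hQ, List.mem_append, List.mem_singleton] at hx
            rcases hx with hx | rfl
            · exact hdec x hx hxC
            · exact (hv hxC).elim) hB
        exact ⟨A, List.mem_append_right _ hA, h⟩
    · -- the queue is exhausted, and the current piece is complete
      exfalso
      rw [List.take_of_length_le (by omega)] at hdec
      obtain ⟨B, hBA, hP, hB⟩ := hB
      have hcB := Finset.card_le_card hBA
      rcases hB with hB | ⟨hne, hB⟩
      · omega
      · have hcl : G.Closed (σ.A.toFinset \ B) (C \ B) := by
          refine ⟨Finset.sdiff_subset_sdiff hAC subset_rfl, fun x hx y hy hxy => ?_⟩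
          simp only [Finset.mem_sdiff, List.mem_toFinset] at *
          refine ⟨hdec y ?_ hy.1, hy.2⟩
          exact (hσ.N2_sub x hx.1 y hxy).resolve_left (hCM y hy.1).2
        have h1 := hP _ hcl hne
        have h2 := Finset.card_sdiff_add_card_eq_card hBA
        omega
    · rw [List.take_of_length_le (by omega)] at hdec
      have hkk : (outerSearch G M k).k = k := rfl
      have hlt : σ.A.length < k := by omega
      set R := C \ σ.A.toFinset with hR
      have hRcard : R.card = k - σ.A.length := by
        rw [hR, Finset.card_sdiff_of_subset hAC]; omega
      have hfarA : ∀ x ∈ σ.A, ∀ y, y ∉ M → y ∉ σ.Q → y ∉ G.N2 x :=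
        fun x hx y h1 h2 hxy => (hσ.N2_sub x hx y hxy).elim h1 h2
      have hRQ : ∀ x ∈ R, x < G.n ∧ x ∉ M ∧ x ∉ σ.Q := by
        intro x hx
        simp only [hR, Finset.mem_sdiff, List.mem_toFinset] at hx
        exact ⟨(hCM x hx.1).1, (hCM x hx.1).2, fun h => hx.2 (hdec x h hx.1)⟩
      -- Every queue member in `C` has been chosen, so `R` is far from the chosen vertices;
      -- therefore a union of pieces of `R` is also one of `C \ B`.
      have hRP : G.PiecesGe σ.j R := by
        obtain ⟨B, hBA, hP, -⟩ := hB
        intro T hT hne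
        refine hP T ⟨hT.1.trans (Finset.sdiff_subset_sdiff subset_rfl hBA), ?_⟩ hne
        intro x hx y hy hxy
        refine hT.2 x hx y ?_ hxy
        simp only [hR, Finset.mem_sdiff, List.mem_toFinset] at hy ⊢
        refine ⟨hy.1, fun hyA => ?_⟩
        have := hRQ x (hT.1 hx)
        exact hfarA y hyA x this.2.1 this.2.2 (G.N2_symm hxy)
      -- `P₀` is a smallest piece of the rest of `C`, and `P` below is a best connected set of the
      -- same size outside the marked vertices.
      obtain ⟨P₀, hP₀R, hP₀ne, hP₀c, hP₀min⟩ :=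
        G.exists_min_piece (R := R) (Finset.card_pos.1 (by omega))
      have hjle := hRP P₀ hP₀R hP₀ne
      have hP₀card := Finset.card_le_card hP₀R.1
      set j := P₀.card with hjdef
      obtain ⟨hn1, hn2, hn3, hn4, hn5⟩ := innerBest_spec (M := M ∪ σ.Q.toFinset) hP₀c (by
        intro x hx
        have := hRQ x (hP₀R.1 hx)
        simp only [Finset.mem_union, List.mem_toFinset]; tauto) hjdef.symm (by omega)
      set P := innerBest G (M ∪ σ.Q.toFinset) j with hPdef
      have hPfresh : ∀ x ∈ P, x < G.n ∧ x ∉ M ∧ x ∉ σ.Q := by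
        intro x hx
        have := hn3 x hx
        simp only [Finset.mem_union, List.mem_toFinset, not_or] at this
        exact this
      -- a set with a vertex near the piece, to be extended through a root
      suffices H : ∃ C' : Finset ℕ, (∀ x ∈ C', x < G.n ∧ x ∉ M) ∧ C'.card = k ∧
          σ.A.toFinset ⊆ C' ∧ (∀ x ∈ σ.Q, x ∈ C' → x ∈ σ.A) ∧
          G.PiecesGe j (C' \ σ.A.toFinset) ∧ G.val C ≤ G.val C' ∧
          ∃ u ∈ C', u ∉ σ.Q ∧ ∃ p ∈ P, u ∈ G.N2 p by
        obtain ⟨C', c1, c2, c3, c4, c5, c6, u, hu, huQ, p, hp, hup⟩ := H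
        have hr : some (j, σ.A.length + j, u) ∈ (outerSearch G M k).roots σ :=
          (mem_outerSearch_roots hσ.nodup).2
            ⟨j, u, hjle, by omega, (c1 u hu).2, huQ, ⟨p, hp, hup⟩, rfl⟩
        have hrok := outerSearch_rootsOk σ hσ _ hr
        have huA : u ∉ σ.A := fun h => huQ (List.mem_of_mem_take (hσ.A_sub u h))
        obtain ⟨A, hA, hval⟩ := ih₃ (by omega) (j, σ.A.length + j, u) (hσ.rootC (by omega) hrok)
          (by simp only [Search.rootC]; omega) c1 c2 (by
            intro x hx
            simp only [Search.rootC, List.toFinset_append, Finset.mem_union, List.mem_toFinset,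
              List.mem_singleton] at hx
            rcases hx with hx | rfl
            · exact c3 (by simpa using hx)
            · exact hu) (by
            intro x hx hxC
            rw [Search.take_rootC hrok] at hx
            simp only [Search.rootC, List.mem_append, List.mem_singleton] at hx ⊢
            exact hx.imp (fun h => c4 x h hxC) id)
          ⟨σ.A.toFinset, by simp only [Search.rootC]; intro x hx; simp at hx ⊢; tauto,
            c5, Or.inr ⟨⟨u, by simp [Search.rootC, huA]⟩, by simp only [Search.rootC]; omega⟩⟩
        refine ⟨A, ?_, c6.trans hval⟩
        rw [List.mem_flatMap]
        exact ⟨_, hr, hA⟩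
      -- If `C` comes near `P`, a vertex of `C` there is the next root and `C` is kept. Otherwise
      -- `P` replaces `P₀`, and any vertex of `P` serves as root.
      by_cases hmeet : ∃ p ∈ P, ∃ u ∈ C, u ∈ G.N2 p
      · obtain ⟨p, hp, u, hu, hup⟩ := hmeet
        refine ⟨C, hCM, hcard, hAC, hdec, hP₀min, le_rfl, u, hu, fun huQ => ?_, p, hp, hup⟩
        have := hPfresh p hp
        exact hfarA u (hdec u huQ hu) p this.2.1 this.2.2 (G.N2_symm hup)
      · push Not at hmeet
        have hP₀C : P₀ ⊆ C := hP₀R.1.trans Finset.sdiff_subset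
        -- Both `P₀` and its substitute `P` are far from `C \ P₀`. The value is additive in both
        -- cases, so the comparison reduces to the values of `P₀` and `P`.
        have hfar₁ : G.Far (C \ P₀) P₀ := by
          intro x hx y hy hxy
          rw [Finset.mem_sdiff] at hx
          by_cases hxA : x ∈ σ.A
          · have := hRQ y (hP₀R.1 hy)
            exact hfarA x hxA y this.2.1 this.2.2 hxy
          · exact hx.2 (hP₀R.2 y hy x (by simp [hR, hx.1, hxA]) (G.N2_symm hxy))
        have hfar₂ : G.Far (C \ P₀) P.toFinset := by
          intro x hx y hy hxy
          rw [Finset.mem_sdiff] at hx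
          exact hmeet y (by simpa using hy) x hx.1 (G.N2_symm hxy)
        have hdisj : Disjoint (C \ P₀) P.toFinset := by
          rw [Finset.disjoint_left]
          intro x hx hx'
          exact hfar₂ x hx x hx' (G.self_mem_N2 x)
        have hPcard : P.toFinset.card = j := by
          rw [List.toFinset_card_of_nodup hn1, hn2]
        have hAP₀ : ∀ x ∈ σ.A, x ∉ P₀ := by
          intro x hx hx'
          have := hP₀R.1 hx'
          simp [hR, hx] at this
        have hAP : ∀ x ∈ σ.A, x ∉ P := fun x hx hx' =>
          (hPfresh x hx').2.2 (List.mem_of_mem_take (hσ.A_sub x hx))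
        obtain ⟨u, hu⟩ : P.toFinset.Nonempty := Finset.card_pos.1 (by omega)
        rw [List.mem_toFinset] at hu
        refine ⟨C \ P₀ ∪ P.toFinset, ?_, ?_, ?_, ?_, ?_, ?_, u, ?_, (hPfresh u hu).2.2, u, hu,
          G.self_mem_N2 u⟩
        · intro x hx
          rw [Finset.mem_union, Finset.mem_sdiff, List.mem_toFinset] at hx
          rcases hx with hx | hx
          · exact hCM x hx.1
          · exact ⟨(hPfresh x hx).1, (hPfresh x hx).2.1⟩
        · rw [Finset.card_union_of_disjoint hdisj, Finset.card_sdiff_of_subset hP₀C, hPcard]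
          have := Finset.card_le_card hP₀C
          omega
        · intro x hx
          simp only [Finset.mem_union, Finset.mem_sdiff]
          exact Or.inl ⟨hAC hx, hAP₀ x (by simpa using hx)⟩
        · intro x hx hx'
          rw [Finset.mem_union, Finset.mem_sdiff, List.mem_toFinset] at hx'
          rcases hx' with hx' | hx'
          · exact hdec x hx hx'.1
          · exact ((hPfresh x hx').2.2 hx).elim
        · intro T hT hne
          have hTmem : ∀ x ∈ T, (x ∈ R ∧ x ∉ P₀) ∨ x ∈ P := by
            intro x hx
            have := hT.1 hx
            simp only [hR, Finset.mem_union, Finset.mem_sdiff, List.mem_toFinset] at this ⊢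
            tauto
          have hmemT : ∀ x, ((x ∈ R ∧ x ∉ P₀) ∨ x ∈ P) →
              x ∈ (C \ P₀ ∪ P.toFinset) \ σ.A.toFinset := by
            intro x hx
            simp only [hR, Finset.mem_union, Finset.mem_sdiff, List.mem_toFinset] at hx ⊢
            rcases hx with hx | hx
            · tauto
            · exact ⟨Or.inr hx, fun h => hAP x h hx⟩
          -- A union of pieces that meets `P` contains it, by connectedness. One that misses `P` is
          -- a union of pieces of `R`, so the minimality of `P₀` applies.
          by_cases hTP : (T ∩ P.toFinset).Nonempty
          · have := hn4 (T ∩ P.toFinset) ⟨Finset.inter_subset_right, fun x hx y hy hxy => by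
              rw [Finset.mem_inter] at *
              exact ⟨hT.2 x hx.1 y (hmemT y (Or.inr (by simpa using hy))) hxy, hy⟩⟩ hTP
            rw [← hPcard, ← this]
            exact Finset.card_le_card Finset.inter_subset_left
          · have hTR : ∀ x ∈ T, x ∈ R ∧ x ∉ P₀ := by
              intro x hx
              refine (hTmem x hx).resolve_right fun h => hTP ⟨x, ?_⟩
              simp [hx, h]
            refine hP₀min T ⟨fun x hx => (hTR x hx).1, fun x hx y hy hxy => ?_⟩ hne
            refine hT.2 x hx y (hmemT y (Or.inl ⟨hy, fun hy₀ => ?_⟩)) hxy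
            exact (hTR x hx).2 (hP₀R.2 y hy₀ x (hTR x hx).1 (G.N2_symm hxy))
        · have e1 := G.val_union_of_far hfar₁
          rw [Finset.sdiff_union_of_subset hP₀C] at e1
          rw [e1, G.val_union_of_far hfar₂]
          omega
        · simp [hu]

/-- The largest value found by the search. -/
def outerBest (G : ListGraph) (M : Finset ℕ) (k : ℕ) : ℕ :=
  (bestOf G ((outerSearch G M k).leaves Node.start)).1

theorem le_outerBest {C : Finset ℕ} (hCM : ∀ x ∈ C, x < G.n ∧ x ∉ M) (hcard : C.card = k) :
    G.val C ≤ outerBest G M k := by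
  obtain ⟨A, hA, h⟩ := outer_leaves_complete (M := M) (k := k) Node.start Search.Ok.start le_rfl
    hCM hcard (by simp [Node.start]) (by simp [Node.start])
    ⟨∅, by simp, fun S _ hne => hne.card_pos, Or.inl (by simp [Node.start])⟩
  exact h.trans ((bestOf_spec G _).1 A hA)

theorem exists_of_outerBest_pos (h : 0 < outerBest G M k) :
    ∃ C : Finset ℕ, (∀ x ∈ C, x < G.n ∧ x ∉ M) ∧ C.card = k ∧ G.val C = outerBest G M k := by
  rcases (bestOf_spec G ((outerSearch G M k).leaves Node.start)).2 with h' | h'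
  · obtain ⟨h1, h2, h3⟩ := Search.leaves_sound outerSearch_rootsOk _ Search.Ok.start _ h'.1
    refine ⟨_, fun x hx => h3 x (by simpa using hx), ?_, h'.2⟩
    rw [List.toFinset_card_of_nodup h1, h2]; rfl
  · rw [outerBest, h'] at h; simp at h

end outer

end PartialVC

/-! ## The size of the search trees -/

namespace PartialVC

/-! ### Branching bounds for connected sets -/

section growth

namespace Search

variable {S : Search}

/-- The candidate has a chosen parent `a`, and everything within distance two of `a` is already in
`M` or in the queue; `card_N2_sdiff_le` bounds the rest. -/
theorem length_inC_le {σ : Node} (hσ : S.Ok σ) (h : σ.h < σ.Q.length) :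
    (S.inC σ).Q.length ≤ σ.Q.length + (S.G.d ^ 2 - S.G.d) := by
  have hnot := hσ.getD_notMem h
  obtain ⟨a, ha, hN⟩ := hσ.parent (σ.Q.getD σ.h 0) (by
    rw [List.drop_eq_getElem_cons h, List.getD_eq_getElem _ _ h]; exact List.mem_cons_self)
  set v := σ.Q.getD σ.h 0 with hv
  have hva : v ≠ a := by rintro rfl; exact hnot (hσ.A_sub _ ha)
  refine (length_pushL_le hσ.nodup).trans (Nat.add_le_add_left ?_ _)
  refine (Finset.card_le_card ?_).trans (S.G.card_N2_sdiff_le hN hva)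
  refine Finset.sdiff_subset_sdiff subset_rfl fun x hx => ?_
  have := hσ.N2_sub a ha x (by simpa using hx)
  simpa using this

theorem length_rootC_le {σ : Node} (hσ : S.Ok σ) (r : ℕ × ℕ × ℕ) :
    (S.rootC σ r).Q.length ≤ σ.Q.length + (S.G.d ^ 2 + 1) :=
  (length_pushL_le hσ.nodup).trans (Nat.add_le_add_left (card_new_le _) _)

/-- Each undecided candidate doubles the tree, and each vertex still to be chosen brings at most `d
^ 2 - d` candidates. The last choice ends the branch, so what it brings does not count; hence the
exponent minus one. The added `3 * E` makes the recursion exact: the cost of a node plus `3 * E` is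
the sum of the same quantities for its two children. -/
theorem cost_le_of_k_le_need (E : ℕ) (R : Node → ℕ) (σ : Node) (hσ : S.Ok σ)
    (hn : S.k ≤ σ.need) :
    S.cost E R σ + 3 * E ≤ 4 * E * (if S.k - σ.A.length = 0 then 1 else
      2 ^ (σ.Q.length - σ.h) * (2 ^ (S.G.d ^ 2 - S.G.d)) ^ (S.k - σ.A.length - 1)) := by
  induction σ using S.node_induction with
  | h σ ih₁ ih₂ ih₃ =>
    have hAle := hσ.A_le
    rw [cost]
    by_cases hk : S.k ≤ σ.A.length
    · rw [dif_pos hk, if_pos (by omega)]; omega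
    have h0 : ¬ S.k - σ.A.length = 0 := by omega
    rw [dif_neg hk, if_neg h0]
    split_ifs with hQ hn'
    · have h1 := ih₁ (by omega) (hσ.inC (by omega) hQ) hn
      have h2 := ih₂ hQ (hσ.outC hQ) hn
      have hlen := length_inC_le hσ hQ
      have e1 : (S.inC σ).A.length = σ.A.length + 1 := by simp [inC]
      have e2 : (S.inC σ).h = σ.h + 1 := rfl
      have e3 : σ.outC.A = σ.A := rfl
      have e4 : σ.outC.h = σ.h + 1 := rfl
      have e5 : σ.outC.Q = σ.Q := rfl
      rw [e1, e2] at h1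
      rw [e3, e4, e5, if_neg h0] at h2
      set c := S.G.d ^ 2 - S.G.d
      obtain ⟨m, hm⟩ : ∃ m, σ.Q.length - σ.h = m + 1 := ⟨σ.Q.length - σ.h - 1, by omega⟩
      obtain ⟨r, hr⟩ : ∃ r, S.k - σ.A.length = r + 1 := ⟨S.k - σ.A.length - 1, by omega⟩
      rw [show σ.Q.length - (σ.h + 1) = m by omega, hr] at h2
      rw [show S.k - (σ.A.length + 1) = r by omega] at h1
      rw [hm, hr]
      simp only [Nat.add_sub_cancel] at *
      have h3 : (if r = 0 then 1 else
          2 ^ ((S.inC σ).Q.length - (σ.h + 1)) * (2 ^ c) ^ (r - 1)) ≤ 2 ^ m * (2 ^ c) ^ r := by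
        split_ifs with hr0
        · exact Nat.one_le_iff_ne_zero.2 (by positivity)
        · obtain ⟨r', rfl⟩ : ∃ r', r = r' + 1 := ⟨r - 1, by omega⟩
          rw [Nat.add_sub_cancel, pow_succ, mul_comm ((2 ^ c) ^ r') _, ← mul_assoc, ← pow_add]
          exact Nat.mul_le_mul_right _ (Nat.pow_le_pow_right (by norm_num) (by omega))
      have h4 := Nat.mul_le_mul_left (4 * E) h3
      have h5 : 4 * E * (2 ^ (m + 1) * (2 ^ c) ^ r) =
          4 * E * (2 ^ m * (2 ^ c) ^ r) + 4 * E * (2 ^ m * (2 ^ c) ^ r) := by ring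
      omega
    · have : 1 ≤ 2 ^ (σ.Q.length - σ.h) *
          (2 ^ (S.G.d ^ 2 - S.G.d)) ^ (S.k - σ.A.length - 1) :=
        Nat.one_le_iff_ne_zero.2 (by positivity)
      have := Nat.mul_le_mul_left (4 * E) this
      omega
    · omega

end Search

/-- After its root a connected set has at most `d ^ 2` candidates and `j - 1` missing vertices, of
which the last brings nothing. The bound `2 ^ (d ^ 2) * q ^ (j - 2)` is at most `q ^ j` because `d ^
2 ≤ 2 * (d ^ 2 - d)` for `d ≥ 2`. -/
theorem inner_cost_le {G : ListGraph} (hd : 2 ≤ G.d) (M : Finset ℕ) {j : ℕ} (hj : 0 < j)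
    (E : ℕ) (R₀ : ℕ) :
    (innerSearch G M j).cost E (fun _ => R₀) Node.start ≤
      (G.n + 1) * (E + R₀) + G.n * (4 * E * (2 ^ (G.d ^ 2 - G.d)) ^ j) := by
  have hk : (innerSearch G M j).k = j := rfl
  have hG : (innerSearch G M j).G = G := rfl
  have hlen : ((innerSearch G M j).roots Node.start).length = G.n := by simp [innerSearch]
  rw [Search.cost, dif_neg (by rw [hk]; simp [Node.start]; omega), dif_neg (by simp [Node.start]),
    if_neg (by simp [Node.start])]
  rw [hlen]
  refine Nat.add_le_add_left ?_ _
  refine (List.sum_le_card_nsmul _ (4 * E * (2 ^ (G.d ^ 2 - G.d)) ^ j) ?_).trans ?_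
  · intro x hx
    rw [List.mem_map] at hx
    obtain ⟨o, ho, rfl⟩ := hx
    cases o with
    | none => exact Nat.zero_le _
    | some r =>
      have hrok := innerSearch_rootsOk _ Search.Ok.start r ho
      obtain ⟨v, -, -, -, rfl⟩ := mem_innerSearch_roots.1 ho
      have hok := Search.Ok.start.rootC (by rw [hk]; simpa [Node.start] using hj) hrok
      have h1 := Search.cost_le_of_k_le_need E (fun _ => R₀) _ hok (by simp [Search.rootC, hk])
      have h2 := Search.length_rootC_le (S := innerSearch G M j) Search.Ok.start (j, j, v)
      refine (Nat.le_add_right _ (3 * E)).trans (h1.trans (Nat.mul_le_mul_left _ ?_))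
      rw [hk, hG] at *
      have e1 : ((innerSearch G M j).rootC Node.start (j, j, v)).A.length = 1 := by
        simp [Search.rootC, Node.start]
      have e2 : ((innerSearch G M j).rootC Node.start (j, j, v)).h = 1 := by
        simp [Search.rootC, Node.start]
      have e3 : Node.start.Q.length = 0 := rfl
      rw [e1, e2]
      rw [e3] at h2
      split_ifs with h0
      · exact Nat.one_le_iff_ne_zero.2 (by positivity)
      · obtain ⟨i, rfl⟩ : ∃ i, j = i + 2 := ⟨j - 2, by omega⟩
        rw [show i + 2 - 1 - 1 = i by omega, pow_add, mul_comm]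
        refine Nat.mul_le_mul_left _ ?_
        rw [← pow_mul]
        refine Nat.pow_le_pow_right (by norm_num) ?_
        have h3 : 2 * G.d ≤ G.d ^ 2 := by nlinarith
        omega
  · simp [hlen]

end growth

/-! ### A potential for the search through several pieces -/

section potential

/-- The bound for the number of nodes below a node with `m` candidates, `r` missing vertices and
`s` missing vertices of the current piece. -/
noncomputable def pot (q : ℝ) (m r s : ℕ) : ℝ :=
  if s = 0 then (15 / 4 * q) ^ r * (1 + 4 / (11 * q) * 2 ^ m)
  else 15 / (11 * q) * 2 ^ m * (15 / 4 * q) ^ r * (4 / 15) ^ s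

theorem pot_mono {q : ℝ} (hq : 0 < q) {m m' : ℕ} (h : m ≤ m') (r s : ℕ) :
    pot q m r s ≤ pot q m' r s := by
  unfold pot
  split_ifs
  · gcongr; norm_num
  · gcongr; norm_num

/-- For `s ≥ 1`, pairing each factor `4 / 15` with one factor `15 / 4 * q` leaves a power of `q`, so
the potential pays for a leaf. This pairing needs `s ≤ r`. -/
theorem one_le_pot {q : ℝ} (hq : 1 ≤ q) {r s : ℕ} (m : ℕ) (h : s ≤ r) :
    1 ≤ pot q m r s := by
  have hq0 : 0 < q := by linarith
  unfold pot
  split_ifs with hs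
  · have h1 : (1 : ℝ) ≤ (15 / 4 * q) ^ r := one_le_pow₀ (by linarith)
    have h2 : 0 ≤ 4 / (11 * q) * 2 ^ m := by positivity
    nlinarith
  · obtain ⟨t, rfl⟩ := Nat.exists_eq_add_of_le h
    obtain ⟨s, rfl⟩ : ∃ s', s = s' + 1 := ⟨s - 1, by omega⟩
    have e : 15 / (11 * q) * 2 ^ m * (15 / 4 * q) ^ (s + 1 + t) * (4 / 15 : ℝ) ^ (s + 1) =
        15 / 11 * (2 ^ m * (15 / 4 * q) ^ t * (((15 / 4 * q) * (4 / 15)) ^ s)) := by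
      rw [mul_pow (15 / 4 * q) (4 / 15) s]
      rw [pow_add, pow_succ, pow_succ]
      field_simp
    rw [e]
    have h1 : (1 : ℝ) ≤ (15 / 4 * q) ^ t := one_le_pow₀ (by linarith)
    have h2 : (1 : ℝ) ≤ 2 ^ m := one_le_pow₀ (by norm_num)
    have h3 : (1 : ℝ) ≤ ((15 / 4 * q) * (4 / 15)) ^ s := one_le_pow₀ (by linarith)
    have h4 : (1 : ℝ) ≤ 2 ^ m * (15 / 4 * q) ^ t * ((15 / 4 * q) * (4 / 15)) ^ s :=
      one_le_mul_of_one_le_of_one_le (one_le_mul_of_one_le_of_one_le h2 h1) h3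
    linarith

/-- Taking a candidate adds `c` candidates, a factor `q`, and lowers `r` and `s`; rejecting it only
lowers `m`. For `s ≥ 2` both branches weigh the same and equality holds. For `s ≤ 1` the excess of
the right side is `B * (2 ^ m - 1)`: the coefficient `4 / 11` satisfies `4 / 11 * 15 / 4 - 4 / 11 =
1`, which pays for the summand `1` that the first branch acquires once its piece is large enough. -/
theorem pot_step {q : ℝ} {c : ℕ} (hq : q = 2 ^ c) (m r s : ℕ) :
    pot q (m + c) r (s - 1) + pot q m (r + 1) s ≤ pot q (m + 1) (r + 1) s := by
  have hq0 : 0 < q := by rw [hq]; positivity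
  have hm : (1 : ℝ) ≤ 2 ^ m := one_le_pow₀ (by norm_num)
  have hpow : (2 : ℝ) ^ (m + c) = 2 ^ m * q := by rw [hq, pow_add]
  have hB : 0 < (15 / 4 * q) ^ r := by positivity
  set B := (15 / 4 * q) ^ r with hBdef
  rcases s with _ | _ | s
  · simp only [pot, if_true, Nat.zero_sub, hpow, ← hBdef, pow_succ]
    have : B * (15 / 4 * q) * (1 + 4 / (11 * q) * (2 ^ m * 2)) -
        (B * (1 + 4 / (11 * q) * (2 ^ m * q)) + B * (15 / 4 * q) * (1 + 4 / (11 * q) * 2 ^ m)) =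
        B * (2 ^ m - 1) := by
      field_simp
      ring
    nlinarith [mul_nonneg hB.le (sub_nonneg.2 hm)]
  · simp only [pot, if_true, zero_add, Nat.sub_self, if_neg one_ne_zero, hpow, pow_succ, ← hBdef,
      pow_zero]
    have : 15 / (11 * q) * (2 ^ m * 2) * (B * (15 / 4 * q)) * (1 * (4 / 15)) -
        (B * (1 + 4 / (11 * q) * (2 ^ m * q)) +
          15 / (11 * q) * 2 ^ m * (B * (15 / 4 * q)) * (1 * (4 / 15))) = B * (2 ^ m - 1) := by
      field_simp
      ring
    nlinarith [mul_nonneg hB.le (sub_nonneg.2 hm)]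
  · simp only [pot, Nat.add_eq_zero_iff, one_ne_zero, and_false, if_false, Nat.add_sub_cancel,
      hpow, pow_succ, ← hBdef]
    apply le_of_eq
    field_simp
    ring

/-- Equality holds at `d = 2`, whence the constant `5`. From `d = 3` on, `3 * d ≤ d ^ 2` gives room
enough. -/
theorem le_two_pow_aux {d : ℕ} (hd : 2 ≤ d) : (d ^ 2 + 1) * 2 ^ d ≤ 5 * 2 ^ (d ^ 2 - d) := by
  obtain rfl | hd : d = 2 ∨ 3 ≤ d := by omega
  · norm_num
  · have h1 : d ^ 2 + 1 ≤ 5 * 2 ^ d := by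
      induction d, hd using Nat.le_induction with
      | base => norm_num
      | succ d hd ih =>
        have := ih (by omega)
        rw [pow_succ 2 d]
        nlinarith
    have h2 : 3 * d ≤ d ^ 2 := by nlinarith
    calc (d ^ 2 + 1) * 2 ^ d ≤ 5 * 2 ^ d * 2 ^ d := Nat.mul_le_mul_right _ h1
      _ = 5 * 2 ^ (d + d) := by rw [pow_add]; ring
      _ ≤ 5 * 2 ^ (d ^ 2 - d) :=
        Nat.mul_le_mul_left _ (Nat.pow_le_pow_right (by norm_num) (by omega))

/-- The share of the pieces of size at least `j` that are started near a best piece of size `j`. -/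
noncomputable def share (j : ℕ) : ℝ :=
  if j = 1 then 9 / 11 else 20 / 11 * j * (4 / 15) ^ (j - 1)

/-- Here `2 ^ (d ^ 2) = q * 2 ^ d`, `(d ^ 2 + 1) * 2 ^ d ≤ 5 * q` and `d ^ 2 + 1 ≤ 5 / 4 * q`.
Dividing by `15 / 4 * q` gives `(5 / 4 + 20 / 11) / (15 / 4) = 9 / 11` for single vertices and the
factor `(75 / 11) / (15 / 4) = 20 / 11` for larger pieces. -/
theorem pot_root_le {d : ℕ} (hd : 2 ≤ d) {q : ℝ} (hq : q = 2 ^ (d ^ 2 - d)) {j : ℕ} (hj : 1 ≤ j)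
    (r : ℕ) :
    j * (d ^ 2 + 1) * pot q (d ^ 2) r (j - 1) ≤ (15 / 4 * q) ^ (r + 1) * share j := by
  have hq0 : 0 < q := by rw [hq]; positivity
  have h1 : ((d : ℝ) ^ 2 + 1) * 2 ^ d ≤ 5 * q := by
    rw [hq]; exact_mod_cast le_two_pow_aux hd
  have h2 : (4 : ℝ) ≤ 2 ^ d := by
    calc (4 : ℝ) = 2 ^ 2 := by norm_num
      _ ≤ 2 ^ d := pow_le_pow_right₀ (by norm_num) hd
  have h3 : ((d : ℝ) ^ 2 + 1) ≤ 5 / 4 * q := by nlinarith [sq_nonneg (d : ℝ)]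
  have h4 : (2 : ℝ) ^ (d ^ 2) = q * 2 ^ d := by
    rw [hq, ← pow_add]; congr 1
    have : d ≤ d ^ 2 := by nlinarith
    omega
  have hB : 0 < (15 / 4 * q) ^ r := by positivity
  rw [pow_succ (15 / 4 * q)]
  set B := (15 / 4 * q) ^ r with hBdef
  obtain rfl | hj : j = 1 ∨ 2 ≤ j := by omega
  · simp only [pot, share, if_true, Nat.sub_self, ← hBdef, h4]
    have e : (1 : ℕ) * ((d : ℝ) ^ 2 + 1) * (B * (1 + 4 / (11 * q) * (q * 2 ^ d))) =
        B * (((d : ℝ) ^ 2 + 1) + 4 / 11 * (((d : ℝ) ^ 2 + 1) * 2 ^ d)) := by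
      push_cast; field_simp
    rw [e, mul_assoc]
    refine mul_le_mul_of_nonneg_left ?_ hB.le
    linarith
  · simp only [pot, share, if_neg (show ¬ j - 1 = 0 by omega), if_neg (show ¬ j = 1 by omega),
      ← hBdef, h4]
    have hF : 0 < (4 / 15 : ℝ) ^ (j - 1) := by positivity
    set F := (4 / 15 : ℝ) ^ (j - 1)
    have e : (j : ℝ) * ((d : ℝ) ^ 2 + 1) * (15 / (11 * q) * (q * 2 ^ d) * B * F) =
        (15 / 11 * j * B * F) * (((d : ℝ) ^ 2 + 1) * 2 ^ d) := by
      field_simp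
    rw [e]
    calc (15 / 11 * j * B * F) * (((d : ℝ) ^ 2 + 1) * 2 ^ d)
        ≤ (15 / 11 * j * B * F) * (5 * q) := by gcongr
      _ = B * (15 / 4 * q) * (20 / 11 * j * F) := by ring

/-- The overhead for the pieces of size at least `j`. -/
noncomputable def overhead (j : ℕ) : ℝ :=
  if j ≤ 1 then 726 else if j = 2 then 132 else 1 + 8 * (3 / 8) ^ (j - 2)

theorem one_le_overhead (j : ℕ) : 1 ≤ overhead j := by
  unfold overhead
  split_ifs
  · norm_num
  · norm_num
  · have : (0 : ℝ) ≤ 8 * (3 / 8) ^ (j - 2) := by positivity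
    linarith

/-- The shares sum to more than one, so the potential alone would not close the induction. Since
piece sizes never decrease, a weight depending on the least size telescopes the sum. The constants
solve the recursion with equality at the start: `overhead 3 = 4`, `132 * (1 - 32 / 33) = 4` and `726
* (1 - 9 / 11) = 132`. -/
theorem share_mul_overhead_le {j : ℕ} (hj : 1 ≤ j) :
    share j * overhead j ≤ overhead j - overhead (j + 1) := by
  rcases j with _ | _ | _ | j
  · omega
  · norm_num [share, overhead]
  · norm_num [share, overhead]
  · have e1 : share (j + 1 + 1 + 1) = 20 / 11 * (j + 3) * (4 / 15) ^ (j + 2) := by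
      simp only [share, if_neg (show ¬ j + 1 + 1 + 1 = 1 by omega)]
      push_cast
      ring
    have e2 : overhead (j + 1 + 1 + 1) = 1 + 3 * (3 / 8) ^ j := by
      simp only [overhead, if_neg (show ¬ j + 1 + 1 + 1 ≤ 1 by omega),
        if_neg (show ¬ j + 1 + 1 + 1 = 2 by omega)]
      rw [show j + 1 + 1 + 1 - 2 = j + 1 by omega, pow_succ]; ring
    have e3 : overhead (j + 1 + 1 + 1 + 1) = 1 + 9 / 8 * (3 / 8) ^ j := by
      simp only [overhead, if_neg (show ¬ j + 1 + 1 + 1 + 1 ≤ 1 by omega),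
        if_neg (show ¬ j + 1 + 1 + 1 + 1 = 2 by omega)]
      rw [show j + 1 + 1 + 1 + 1 - 2 = j + 2 by omega, pow_succ, pow_succ]; ring
    rw [e1, e2, e3]
    have h1 : (3 / 8 : ℝ) ^ j ≤ 1 := pow_le_one₀ (by norm_num) (by norm_num)
    -- From `j` to `j + 1` the left side shrinks by a factor of at most `4 / 15 * 4 / 3 = 16 / 45`,
    -- which is below `3 / 8`. The constant `15 / 32` is the drop `15 / 8` of the overhead divided
    -- by its largest value `4`.
    have h2 : 20 / 11 * ((j : ℝ) + 3) * (4 / 15) ^ (j + 2) ≤ 15 / 32 * (3 / 8) ^ j := by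
      clear e1 e2 e3 h1 hj
      induction j with
      | zero => norm_num
      | succ j ih =>
        push_cast
        rw [show j + 1 + 2 = (j + 2) + 1 by omega, pow_succ _ (j + 2), pow_succ _ j]
        have hp : (0 : ℝ) ≤ (4 / 15) ^ (j + 2) := by positivity
        have hp' : (0 : ℝ) ≤ (3 / 8) ^ j := by positivity
        have h3 : 20 / 11 * ((j : ℝ) + 1 + 3) * ((4 / 15) ^ (j + 2) * (4 / 15)) ≤
            16 / 45 * (20 / 11 * ((j : ℝ) + 3) * (4 / 15) ^ (j + 2)) := by
          have : (0 : ℝ) ≤ j * (4 / 15) ^ (j + 2) := by positivity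
          nlinarith
        nlinarith
    have h0 : (0 : ℝ) ≤ 20 / 11 * ((j : ℝ) + 3) * (4 / 15) ^ (j + 2) := by positivity
    nlinarith

theorem sum_share_overhead_le (j N : ℕ) (hj : 1 ≤ j) :
    ((List.range' j N).map fun i => share i * overhead i).sum ≤ overhead j - 1 := by
  suffices H : ((List.range' j N).map fun i => share i * overhead i).sum ≤
      overhead j - overhead (j + N) by
    linarith [one_le_overhead (j + N)]
  induction N generalizing j with
  | zero => simp
  | succ N ih =>
    rw [List.range'_succ, List.map_cons, List.sum_cons]
    have h1 := ih (j + 1) (by omega)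
    have h2 := share_mul_overhead_le hj
    rw [show j + 1 + N = j + (N + 1) by omega] at h1
    linarith

end potential

/-! ### The cost of the search for an optimal set -/

section outerCost

variable {G : ListGraph} {M : Finset ℕ} {k : ℕ}

theorem card_candidates_le (σ : Node) (hQ : σ.Q.Nodup) (j : ℕ) :
    ((pushL M σ.Q ((innerBest G (M ∪ σ.Q.toFinset) j).flatMap G.N2)).drop σ.Q.length).length ≤
      j * (G.d ^ 2 + 1) := by
  set P := innerBest G (M ∪ σ.Q.toFinset) j with hP
  rw [← List.toFinset_card_of_nodup (nodup_drop_pushL hQ)]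
  have hsub : ((pushL M σ.Q (P.flatMap G.N2)).drop σ.Q.length).toFinset ⊆
      P.toFinset.biUnion fun p => (G.N2 p).toFinset := by
    intro x hx
    rw [List.mem_toFinset, mem_drop_pushL hQ] at hx
    simpa using hx.1
  refine (Finset.card_le_card hsub).trans ?_
  refine (Finset.card_biUnion_le_card_mul _ _ _ fun p _ => G.card_N2_le p).trans ?_
  exact Nat.mul_le_mul_right _ (P.toFinset_card_le.trans length_innerBest_le)

theorem length_outer_roots_le (σ : Node) (hσ : (outerSearch G M k).Ok σ) :
    ((outerSearch G M k).roots σ).length ≤ (k + 1) * (k * (G.d ^ 2 + 1)) := by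
  simp only [outerSearch, List.length_flatMap, List.length_map]
  refine (List.sum_le_card_nsmul _ (k * (G.d ^ 2 + 1)) ?_).trans ?_
  · intro x hx
    rw [List.mem_map] at hx
    obtain ⟨j, hj, rfl⟩ := hx
    rw [List.mem_range'_1] at hj
    exact (card_candidates_le σ hσ.nodup j).trans (Nat.mul_le_mul_right _ (by omega))
  · simp only [List.length_map, List.length_range', smul_eq_mul]
    exact Nat.mul_le_mul_right _ (by omega)

theorem outer_roots_sum_le (σ : Node) (hQ : σ.Q.Nodup) (f : Option (ℕ × ℕ × ℕ) → ℕ) (g : ℕ → ℝ)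
    (hg : ∀ j, 0 ≤ g j)
    (hf : ∀ j u, some (j, σ.A.length + j, u) ∈ (outerSearch G M k).roots σ →
      (f (some (j, σ.A.length + j, u)) : ℝ) ≤ g j) :
    (((((outerSearch G M k).roots σ).map f).sum : ℕ) : ℝ) ≤
      ((List.range' σ.j (k + 1 - (σ.A.length + σ.j))).map fun j : ℕ =>
        (j * (G.d ^ 2 + 1) : ℝ) * g j).sum := by
  have hmem : ∀ j ∈ List.range' σ.j (k + 1 - (σ.A.length + σ.j)),
      ∀ u ∈ (pushL M σ.Q ((innerBest G (M ∪ σ.Q.toFinset) j).flatMap G.N2)).drop σ.Q.length,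
      some (j, σ.A.length + j, u) ∈ (outerSearch G M k).roots σ := by
    intro j hj u hu
    simp only [outerSearch, List.mem_flatMap, List.mem_map]
    exact ⟨j, hj, u, hu, rfl⟩
  simp only [outerSearch, List.map_flatMap, List.map_map]
  rw [Nat.cast_list_sum, List.map_flatMap, List.flatMap_def, List.sum_flatten, List.map_map]
  refine List.sum_le_sum fun j hj' => ?_
  simp only [Function.comp_def, List.map_map]
  refine (List.sum_le_card_nsmul _ (g j) ?_).trans ?_
  · intro x hx
    rw [List.mem_map] at hx
    obtain ⟨u, hu, rfl⟩ := hx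
    exact hf j u (hmem j hj' u hu)
  · rw [nsmul_eq_mul, List.length_map]
    have h1 := card_candidates_le (G := G) (M := M) σ hQ j
    exact mul_le_mul_of_nonneg_right (by exact_mod_cast h1) (hg j)

/-- While candidates remain, `pot_step` carries the induction. At an exhausted queue the potential
leaves `(15 / 4 * q) ^ (r + 1)`, weighted by the overhead of the least size: one unit of the
overhead pays for the requests for roots, and the remaining `overhead σ.j - 1` for the subtrees, by
`pot_root_le` and the telescoping sum. -/
theorem outer_cost_le (hd : 2 ≤ G.d) {q e : ℝ} (hq : q = 2 ^ (G.d ^ 2 - G.d)) (E : ℕ)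
    (R : Node → ℕ) (hE : (4 * E : ℝ) ≤ e)
    (hR : ∀ σ, (outerSearch G M k).Ok σ → σ.A.length < k →
      ((((outerSearch G M k).roots σ).length + 1) * (E + R σ) + 3 * E : ℝ) ≤
        e * (15 / 4 * q) ^ (k - σ.A.length))
    (σ : Node) (hσ : (outerSearch G M k).Ok σ) (hj : 1 ≤ σ.j) (hn : σ.need ≤ k) :
    ((outerSearch G M k).cost E R σ : ℝ) + 3 * E ≤
      e * overhead σ.j * pot q (σ.Q.length - σ.h) (k - σ.A.length) (σ.need - σ.A.length) := by
  have hq1 : 1 ≤ q := by rw [hq]; exact one_le_pow₀ (by norm_num)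
  have he : 0 ≤ e := le_trans (by positivity) hE
  have hk : (outerSearch G M k).k = k := rfl
  induction σ using (outerSearch G M k).node_induction with
  | h σ ih₁ ih₂ ih₃ =>
    have hAle := hσ.A_le
    rw [hk] at hAle
    have hov := one_le_overhead σ.j
    have hpot := one_le_pot hq1 (σ.Q.length - σ.h) (r := k - σ.A.length)
      (s := σ.need - σ.A.length) (by omega)
    have hbase : (E : ℝ) + 3 * E ≤
        e * overhead σ.j * pot q (σ.Q.length - σ.h) (k - σ.A.length) (σ.need - σ.A.length) := by
      have := mul_le_mul hov hpot (by norm_num) (by linarith)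
      rw [mul_assoc]
      nlinarith
    rw [Search.cost]
    split_ifs with hkA hQ hn'
    · exact hbase
    · have h1 := ih₁ (by omega) (hσ.inC (by omega) hQ) hj hn
      have h2 := ih₂ hQ (hσ.outC hQ) hj hn
      have hlen := Search.length_inC_le hσ hQ
      have e1 : ((outerSearch G M k).inC σ).A.length = σ.A.length + 1 := by simp [Search.inC]
      have e2 : ((outerSearch G M k).inC σ).h = σ.h + 1 := rfl
      have e2j : ((outerSearch G M k).inC σ).j = σ.j := rfl
      have e2n : ((outerSearch G M k).inC σ).need = σ.need := rfl
      have e3 : σ.outC.A = σ.A := rfl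
      have e4 : σ.outC.h = σ.h + 1 := rfl
      have e5 : σ.outC.Q = σ.Q := rfl
      have e5j : σ.outC.j = σ.j := rfl
      have e5n : σ.outC.need = σ.need := rfl
      have e6 : (outerSearch G M k).G = G := rfl
      rw [e1, e2, e2j, e2n] at h1
      rw [e3, e4, e5, e5j, e5n] at h2
      rw [e6] at hlen
      obtain ⟨m, hm⟩ : ∃ m, σ.Q.length - σ.h = m + 1 := ⟨σ.Q.length - σ.h - 1, by omega⟩
      obtain ⟨r, hr⟩ : ∃ r, k - σ.A.length = r + 1 := ⟨k - σ.A.length - 1, by omega⟩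
      rw [show σ.Q.length - (σ.h + 1) = m by omega, hr] at h2
      rw [show k - (σ.A.length + 1) = r by omega,
        show σ.need - (σ.A.length + 1) = σ.need - σ.A.length - 1 by omega] at h1
      rw [hm, hr]
      have h3 := pot_mono (q := q) (by linarith)
        (show ((outerSearch G M k).inC σ).Q.length - (σ.h + 1) ≤ m + (G.d ^ 2 - G.d) by omega)
        r (σ.need - σ.A.length - 1)
      have h4 := pot_step hq m r (σ.need - σ.A.length)
      have h5 : 0 ≤ e * overhead σ.j := mul_nonneg he (by linarith)
      have h6 := mul_le_mul_of_nonneg_left h3 h5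
      have h7 := mul_le_mul_of_nonneg_left h4 h5
      push_cast
      linarith
    · exact hbase
    · have hRσ := hR σ hσ (by omega)
      obtain ⟨r, hr⟩ : ∃ r, k - σ.A.length = r + 1 := ⟨k - σ.A.length - 1, by omega⟩
      have hB : (0 : ℝ) < (15 / 4 * q) ^ (r + 1) := by positivity
      -- A fresh root is itself decided and chosen. It leaves at most `d ^ 2` candidates and `j - 1`
      -- missing vertices of its piece.
      have hchild : ∀ ρ, some ρ ∈ (outerSearch G M k).roots σ →
          ((outerSearch G M k).cost E R ((outerSearch G M k).rootC σ ρ) : ℝ) ≤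
            e * overhead ρ.1 * pot q (G.d ^ 2) r (ρ.1 - 1) := by
        intro ρ hρ
        have hrok := outerSearch_rootsOk σ hσ ρ hρ
        obtain ⟨j, u, j1, j2, -, -, -, rfl⟩ := (mem_outerSearch_roots hσ.nodup).1 hρ
        have h1 := ih₃ (by omega) (j, σ.A.length + j, u) (hσ.rootC (by omega) hrok)
          (by simp only [Search.rootC]; omega) j2
        have h2 := Search.length_rootC_le hσ (j, σ.A.length + j, u)
        have e1 : ((outerSearch G M k).rootC σ (j, σ.A.length + j, u)).A.length =
          σ.A.length + 1 := by simp [Search.rootC]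
        have e2 : ((outerSearch G M k).rootC σ (j, σ.A.length + j, u)).h =
          σ.Q.length + 1 := rfl
        have e3 : ((outerSearch G M k).rootC σ (j, σ.A.length + j, u)).j = j := rfl
        have e4 : ((outerSearch G M k).rootC σ (j, σ.A.length + j, u)).need =
          σ.A.length + j := rfl
        have e6 : (outerSearch G M k).G = G := rfl
        rw [e6] at h2
        rw [e1, e2, e3, e4, show k - (σ.A.length + 1) = r by omega,
          show σ.A.length + j - (σ.A.length + 1) = j - 1 by omega] at h1
        have h3 := pot_mono (q := q) (by linarith)
          (show ((outerSearch G M k).rootC σ (j, σ.A.length + j, u)).Q.length -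
            (σ.Q.length + 1) ≤ G.d ^ 2 by omega) r (j - 1)
        have h4 := mul_le_mul_of_nonneg_left h3
          (mul_nonneg he (by linarith [one_le_overhead j]) : 0 ≤ e * overhead j)
        have : (0 : ℝ) ≤ 3 * E := by positivity
        dsimp only
        linarith
      have hsum := outer_roots_sum_le σ hσ.nodup (fun o => match o with
          | none => 0
          | some r => (outerSearch G M k).cost E R ((outerSearch G M k).rootC σ r))
        (fun j => e * overhead j * pot q (G.d ^ 2) r (j - 1))
        (fun j => mul_nonneg (mul_nonneg he (by linarith [one_le_overhead j]))
          (by unfold pot; split_ifs <;> positivity))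
        (fun j u h => hchild (j, σ.A.length + j, u) h)
      have hsum' : ((List.range' σ.j (k + 1 - (σ.A.length + σ.j))).map fun j : ℕ =>
          (j * (G.d ^ 2 + 1) : ℝ) * (e * overhead j * pot q (G.d ^ 2) r (j - 1))).sum ≤
          e * (15 / 4 * q) ^ (r + 1) * (overhead σ.j - 1) := by
        refine le_trans ?_ (mul_le_mul_of_nonneg_left (sum_share_overhead_le σ.j
          (k + 1 - (σ.A.length + σ.j)) hj) (by positivity))
        rw [← List.sum_map_mul_left]
        refine List.sum_le_sum fun j hj' => ?_
        have hj1 : 1 ≤ j := by rw [List.mem_range'_1] at hj'; omega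
        have hovj := one_le_overhead j
        have h2 := pot_root_le hd hq hj1 r
        calc (j * (G.d ^ 2 + 1) : ℝ) * (e * overhead j * pot q (G.d ^ 2) r (j - 1))
            = e * overhead j * (j * (G.d ^ 2 + 1) * pot q (G.d ^ 2) r (j - 1)) := by ring
          _ ≤ e * overhead j * ((15 / 4 * q) ^ (r + 1) * share j) :=
              mul_le_mul_of_nonneg_left h2 (by positivity)
          _ = _ := by ring
      have hsum := hsum.trans hsum'
      have hm : σ.Q.length - σ.h = 0 := by omega
      have hs : σ.need - σ.A.length = 0 := by omega
      have hfin : (15 / 4 * q) ^ (r + 1) ≤ pot q (σ.Q.length - σ.h) (r + 1)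
          (σ.need - σ.A.length) := by
        rw [hm, hs]
        simp only [pot, if_true]
        have : 0 ≤ 4 / (11 * q) * (2 : ℝ) ^ 0 := by positivity
        nlinarith
      rw [hr] at hRσ ⊢
      have h5 : 0 ≤ e * overhead σ.j := mul_nonneg he (by linarith)
      have h6 := mul_le_mul_of_nonneg_left hfin h5
      rw [Nat.cast_add, Nat.cast_mul, Nat.cast_add, Nat.cast_add, Nat.cast_one]
      refine le_trans (add_le_add (add_le_add le_rfl hsum) le_rfl) ?_
      linarith

theorem outer_cost_start_le (hd : 2 ≤ G.d) {q e : ℝ} (hq : q = 2 ^ (G.d ^ 2 - G.d)) (E : ℕ)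
    (R : Node → ℕ) (hE : (4 * E : ℝ) ≤ e)
    (hR : ∀ σ, (outerSearch G M k).Ok σ → σ.A.length < k →
      ((((outerSearch G M k).roots σ).length + 1) * (E + R σ) + 3 * E : ℝ) ≤
        e * (15 / 4 * q) ^ (k - σ.A.length)) :
    ((outerSearch G M k).cost E R Node.start : ℝ) ≤ 1000 * e * (15 / 4 * q) ^ k := by
  have hq4 : 1 ≤ q := by rw [hq]; exact one_le_pow₀ (by norm_num)
  have hq4' : 4 ≤ q := by
    rw [hq]
    calc (4 : ℝ) = 2 ^ 2 := by norm_num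
      _ ≤ _ := pow_le_pow_right₀ (by norm_num) (by
        have : G.d * 2 ≤ G.d ^ 2 := by nlinarith
        omega)
  have h := outer_cost_le hd hq E R hE hR Node.start Search.Ok.start le_rfl (by simp [Node.start])
  have he : 0 ≤ e := le_trans (by positivity) hE
  simp only [Node.start, overhead, pot, List.length_nil] at h
  norm_num at h
  have hB : (0 : ℝ) < (15 / 4 * q) ^ k := by positivity
  -- With `q ≥ 4` the potential of the start is at most `12 / 11 * (15 / 4 * q) ^ k`, and `726 * 12
  -- / 11 = 792` is below the stated `1000`.
  have h1 : 4 / (11 * q) ≤ 1 / 11 := by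
    rw [div_le_div_iff₀ (by positivity) (by norm_num)]; linarith
  have h2 : (0 : ℝ) ≤ E := by positivity
  have h3 : e * 726 * ((15 / 4 * q) ^ k * (1 + 4 / (11 * q))) ≤
      e * 726 * ((15 / 4 * q) ^ k * (1 + 1 / 11)) := by gcongr
  have h4 : (0 : ℝ) ≤ e * (15 / 4 * q) ^ k := by positivity
  simp only [Node.start]
  nlinarith

end outerCost

end PartialVC

/-! ## Subroutines -/

namespace RAM

open PartialVC

/-- The input graph is in memory, register `0` holds the number of its vertices, and the registers
`3` and `4` hold the constants zero and one. -/
structure Base (G : ListGraph) (s : State) : Prop where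
  stored : G.StoredIn (s.arr 0) (s.arr 1)
  n : s.reg 0 = G.n
  zero : s.reg 3 = 0
  one : s.reg 4 = 1

theorem Base.of_unch {G : ListGraph} {s s' : State} {p : Prog} (h : Base G s) (hu : Unch p s s')
    (hr : ¬ p.WritesReg 0 ∧ ¬ p.WritesReg 3 ∧ ¬ p.WritesReg 4)
    (ha : ¬ p.WritesArr 0 ∧ ¬ p.WritesArr 1) : Base G s' :=
  ⟨by rw [hu.2 0 ha.1, hu.2 1 ha.2]; exact h.stored, by rw [hu.1 0 hr.1, h.n],
    by rw [hu.1 3 hr.2.1, h.zero], by rw [hu.1 4 hr.2.2, h.one]⟩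

/-- Array `qa` holds the queue `Q`, register `ql` its length, and array `2` marks the elements of
`M` and of the queue. -/
structure QueueAt (M : Finset ℕ) (Q : List ℕ) (qa ql : ℕ) (s : State) : Prop where
  list : HoldsList (s.arr qa) Q
  len : s.reg ql = Q.length
  mark : ∀ x, s.arr 2 x = if x ∈ M ∨ x ∈ Q then 1 else 0

theorem QueueAt.of_eq {M : Finset ℕ} {Q : List ℕ} {qa ql : ℕ} {s s' : State}
    (h : QueueAt M Q qa ql s) (h1 : s'.arr qa = s.arr qa) (h2 : s'.reg ql = s.reg ql)
    (h3 : s'.arr 2 = s.arr 2) : QueueAt M Q qa ql s' :=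
  ⟨by rw [h1]; exact h.list, by rw [h2, h.len], by rw [h3]; exact h.mark⟩

theorem QueueAt.of_unch {M : Finset ℕ} {Q : List ℕ} {qa ql : ℕ} {s s' : State} {p : Prog}
    (h : QueueAt M Q qa ql s) (hu : Unch p s s') (h1 : ¬ p.WritesArr qa) (h2 : ¬ p.WritesReg ql)
    (h3 : ¬ p.WritesArr 2) : QueueAt M Q qa ql s' :=
  h.of_eq (hu.2 _ h1) (hu.1 _ h2) (hu.2 _ h3)

/-- Append the vertex in register `w` to the queue unless it is marked. -/
def pushOne (qa ql w : ℕ) : Prog :=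
  .load 16 2 w ;; .ite (.eq 16 3) (.store qa ql w ;; .store 2 w 4 ;; .inc ql) .skip

theorem wp_pushOne {G : ListGraph} {M : Finset ℕ} {Q : List ℕ} {qa ql w : ℕ} {s : State}
    (hqa : 40 ≤ qa) (hql : 40 ≤ ql) (hw : w < 16) (hb : Base G s) (h : QueueAt M Q qa ql s) :
    wp (pushOne qa ql w) s 6
      (QueueAt M (if s.reg w ∈ M ∨ s.reg w ∈ Q then Q else Q ++ [s.reg w]) qa ql) := by
  refine wp_eval (by simp [pushOne, Prog.LoopFree]) ?_
  have hq2 : qa ≠ 2 := by omega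
  have hq2' : 2 ≠ qa := by omega
  have hl16 : ql ≠ 16 := by omega
  have hw16 : w ≠ 16 := by omega
  simp only [pushOne, Prog.eval, Test.holds_eq, State.setReg_reg,
    if_true, hb.zero, h.mark, if_neg hw16, if_neg hl16, State.setArr_reg]
  by_cases hm : s.reg w ∈ M ∨ s.reg w ∈ Q
  · simp only [if_pos hm]
    norm_num
    exact h.of_eq rfl (by simp [State.setReg_reg, hl16]) rfl
  · simp only [if_neg hm]
    norm_num
    constructor
    · simp only [State.setReg_arr, State.setArr_arr, if_neg hq2, if_true, h.len]
      exact h.list.snoc _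
    · simp [State.setReg_reg, h.len]
    · intro x
      simp only [State.setReg_arr, State.setArr_arr, if_true, if_neg hq2']
      rw [Function.update_apply]
      by_cases hx : x = s.reg w
      · simp [hx, hb.one]
      · simp [h.mark, hx]

/-- Append the unmarked vertices at distance at most two of the vertex in register `v`. -/
def pushN2 (qa ql v : ℕ) : Prog := forN v 10 11 12 (forN 10 13 14 15 (pushOne qa ql 13))

@[simp] theorem pushN2_writesReg (qa ql v r : ℕ) :
    (pushN2 qa ql v).WritesReg r ↔ r = 10 ∨ r = 11 ∨ r = 12 ∨ r = 13 ∨ r = 14 ∨ r = 15 ∨ r = 16 ∨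
      r = ql := by
  simp [pushN2, pushOne, Prog.WritesReg]

@[simp] theorem pushN2_writesArr (qa ql v a : ℕ) :
    (pushN2 qa ql v).WritesArr a ↔ a = qa ∨ a = 2 := by
  simp [pushN2, pushOne, Prog.WritesArr]

theorem wp_pushN2 {G : ListGraph} {M : Finset ℕ} {Q : List ℕ} {qa ql v : ℕ} {s : State}
    (hqa : 40 ≤ qa) (hql : 40 ≤ ql) (hv : 40 ≤ v) (hvl : v ≠ ql) (hb : Base G s)
    (hvn : s.reg v < G.n) (h : QueueAt M Q qa ql s) :
    wp (pushN2 qa ql v) s (24 * (G.d + 1) ^ 2)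
      (QueueAt M (pushL M Q (G.N2 (s.reg v))) qa ql) := by
  refine wp.le (T := (G.d + 1) * (((G.d + 1) * (6 + 3) + 6) + 3) + 6) ?_ (by nlinarith)
  refine wp_forN G _ (I := fun pre s' => QueueAt M (pushL M Q (pre.flatMap G.cN)) qa ql s')
    hvn hb.stored (by omega) ?_ ?_ ?_ h
  · simp [pushOne, Prog.WritesReg, Prog.WritesArr]; omega
  · intro pre s' r x hr hq
    refine hq.of_eq rfl ?_ rfl
    rw [State.setReg_reg, if_neg (by omega)]
  · intro pre x hx s' hu hq hw
    have hb' : Base G s' := hb.of_unch hu (by simp [pushOne, Prog.WritesReg]; omega)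
      (by simp [pushOne, Prog.WritesArr]; omega)
    have hxn : x < G.n := G.cN_lt hvn hx
    have := wp_forN G (v := 10) (w := 13) (e := 14) (f := 15) (body := pushOne qa ql 13) (s := s')
      6 (I := fun pre' s'' => QueueAt M (pushL M Q (pre.flatMap G.cN ++ pre')) qa ql s'')
      (by rw [hw]; exact hxn) hb'.stored (by omega)
      (by simp [pushOne, Prog.WritesReg, Prog.WritesArr]; omega) ?_ ?_ (by simpa using hq)
    · refine this.mono le_rfl fun s'' _ h => ?_
      simpa [hw] using h
    · intro pre' s'' r y hr hq'
      refine hq'.of_eq rfl ?_ rfl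
      rw [State.setReg_reg, if_neg (by omega)]
    · intro pre' y _ s'' hu' hq' hy
      have hb'' : Base G s'' := hb'.of_unch hu' (by simp [pushOne, Prog.WritesReg]; omega)
        (by simp [pushOne, Prog.WritesArr]; omega)
      refine (wp_pushOne hqa hql (by omega) hb'' hq').mono le_rfl fun s₃ _ h₃ => ?_
      rw [← List.append_assoc, pushL_snoc, ← hy]
      exact h₃

/-- Shorten the queue to the length in register `t`. -/
def trunc (qa ql t : ℕ) : Prog :=
  .while (.lt t ql) (.dec ql ;; .load 16 qa ql ;; .store 2 16 3)

@[simp] theorem trunc_writesReg (qa ql t r : ℕ) :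
    (trunc qa ql t).WritesReg r ↔ r = ql ∨ r = 16 := by
  simp [trunc, Prog.WritesReg]

@[simp] theorem trunc_writesArr (qa ql t a : ℕ) : (trunc qa ql t).WritesArr a ↔ a = 2 := by
  simp [trunc, Prog.WritesArr]

/-- Removing a vertex clears its mark. This is harmless because the queue has no repetitions and is
disjoint from `M`, so nothing that remains needs this mark. -/
theorem wp_trunc {M : Finset ℕ} {Q Qc : List ℕ} {qa ql t : ℕ} {s : State}
    (hqa : 40 ≤ qa) (hql : 40 ≤ ql) (ht : t ≠ 16) (htl : t ≠ ql) (hz : s.reg 3 = 0)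
    (h : QueueAt M Qc qa ql s) (hpre : Q <+: Qc) (hnd : Qc.Nodup) (hM : ∀ x ∈ Qc, x ∉ M)
    (hts : s.reg t = Q.length) :
    wp (trunc qa ql t) s (4 * Qc.length + 1) (QueueAt M Q qa ql) := by
  have hle := hpre.length_le
  have key := wp_while (b := .lt t ql) (p := .dec ql ;; .load 16 qa ql ;; .store 2 16 3) (s := s)
    (Inv := fun m s' => Q.length + m ≤ Qc.length ∧ s'.reg t = Q.length ∧ s'.reg 3 = 0 ∧
      QueueAt M (Qc.take (Q.length + m)) qa ql s') 3 ?_ ?_ (Qc.length - Q.length) ?_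
  · refine key.mono (by omega) ?_
    rintro s' - ⟨-, -, -, hq⟩
    rwa [add_zero, Search.take_of_isPrefix hpre le_rfl, List.take_length] at hq
  · rintro m s' - ⟨hm, hst, h3, hq⟩
    have hlen : (Qc.take (Q.length + (m + 1))).length = Q.length + (m + 1) := by
      rw [List.length_take]; omega
    have hl := hq.len
    rw [hlen] at hl
    refine ⟨by simp only [Test.holds_lt]; omega, wp_eval (by simp [Prog.LoopFree]) ?_⟩
    have hm' : Q.length + m < Qc.length := by omega
    have htk : Qc.take (Q.length + (m + 1)) =
        Qc.take (Q.length + m) ++ [Qc.getD (Q.length + m) 0] := by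
      rw [← add_assoc, Search.take_succ_getD hm']
    have hx : s'.arr qa (Q.length + m) = Qc.getD (Q.length + m) 0 := by
      rw [hq.list _ (by omega), htk, List.getD_append_right _ _ _ _ (by simp)]
      simp [List.length_take, Nat.min_eq_left hm'.le]
    have hxmem := Search.getD_mem hm'
    set x := Qc.getD (Q.length + m) 0 with hxdef
    have hql16 : ql ≠ 16 := by omega
    have hql3 : (3 : ℕ) ≠ ql := by omega
    have hqa2 : qa ≠ 2 := by omega
    have hnd' : (Qc.take (Q.length + (m + 1))).Nodup := hnd.sublist (List.take_sublist _ _)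
    rw [htk] at hnd' hq
    have hxnot : x ∉ Qc.take (Q.length + m) := fun hx' =>
      (List.disjoint_of_nodup_append hnd') hx' (by simp)
    simp only [Prog.eval, State.setReg_reg, State.setReg_arr, if_true, hl,
      show Q.length + (m + 1) - 1 = Q.length + m by omega, hx, if_neg hql3,
      show (3 : ℕ) ≠ 16 by norm_num, if_false, h3]
    refine ⟨by omega, ?_, ?_, ?_⟩
    · simp [State.setReg_reg, ht, htl, hst]
    · simp [State.setReg_reg, hql3, h3]
    · constructor
      · simp only [State.setArr_arr, if_neg hqa2, State.setReg_arr]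
        exact hq.list.of_isPrefix (List.prefix_append _ _)
      · simp [State.setReg_reg, hql16, hm'.le]
      · intro y
        simp only [State.setArr_arr, if_true, State.setReg_arr, Function.update_apply]
        by_cases hy : y = x
        · rw [if_pos hy, if_neg]
          rw [hy, not_or]; exact ⟨hM x hxmem, hxnot⟩
        · rw [if_neg hy, hq.mark]
          simp [hy]
  · rintro s' ⟨-, hst, -, hq⟩
    have := hq.len
    rw [List.length_take] at this
    simp only [Test.holds_lt]; omega
  · refine ⟨by omega, hts, hz, ?_⟩
    rwa [show Q.length + (Qc.length - Q.length) = Qc.length by omega, List.take_length]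

/-- Register `f` becomes `1` if the vertex in register `c` is in the closed neighborhood of the one
in register `x`, and `0` otherwise. -/
def memTest (c x f : ℕ) : Prog :=
  .const f 0 ;; forN x 20 21 22 (.ite (.eq 20 c) (.const f 1) .skip)

@[simp] theorem memTest_writesReg (c x f r : ℕ) :
    (memTest c x f).WritesReg r ↔ r = f ∨ r = 20 ∨ r = 21 ∨ r = 22 := by
  simp [memTest, Prog.WritesReg]; tauto

@[simp] theorem memTest_writesArr (c x f a : ℕ) : ¬ (memTest c x f).WritesArr a := by
  simp [memTest, Prog.WritesArr]

theorem wp_memTest {G : ListGraph} {c x f : ℕ} {s : State} (hb : Base G s) (hxn : s.reg x < G.n)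
    (hc : 23 ≤ c) (hx : 23 ≤ x) (hf : 23 ≤ f) (hcf : c ≠ f) (hxf : x ≠ f) :
    wp (memTest c x f) s (6 * (G.d + 1) + 7)
      (fun s' => s'.reg f = if s.reg c ∈ G.cN (s.reg x) then 1 else 0) := by
  refine wp.le (T := 1 + ((G.d + 1) * (3 + 3) + 6)) ?_ (by omega)
  refine wp_seq ⟨1, _, .const f 0 s, le_rfl, fun hu => ?_⟩
  have hsx : (s.setReg f 0).reg x = s.reg x := by rw [State.setReg_reg, if_neg hxf]
  have key := wp_forN G (v := x) (w := 20) (e := 21) (f := 22) (s := s.setReg f 0)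
    (body := .ite (.eq 20 c) (.const f 1) .skip) 3
    (I := fun pre s' => s'.reg c = s.reg c ∧ s'.reg f = if s.reg c ∈ pre then 1 else 0)
    (by rw [hsx]; exact hxn) hb.stored (by omega)
    (by simp [Prog.WritesReg, Prog.WritesArr]; omega) ?_ ?_ ?_
  · refine key.mono le_rfl fun s' _ h => ?_
    rw [hsx] at h
    exact h.2
  · rintro pre s' r y hr ⟨h1, h2⟩
    simp only [State.setReg_reg]
    rw [if_neg (by omega), if_neg (by omega)]
    exact ⟨h1, h2⟩
  · rintro pre y _ s' _ ⟨h1, h2⟩ hy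
    refine wp.le (wp_eval (by simp [Prog.LoopFree]) ?_) (le_refl 3)
    simp only [Prog.eval, Test.holds_eq, hy, h1]
    by_cases h : y = s.reg c
    · rw [if_pos h]
      simp [State.setReg_reg, hcf, h, h1]
    · rw [if_neg h]
      refine ⟨h1, ?_⟩
      rw [h2]
      simp [Ne.symm h]
  · simp [State.setReg_reg, hcf]

end RAM

/-! ## Counting the traces on a set -/

namespace PartialVC

/-- A vertex with nonempty trace lies in the closed neighborhood of an element of `A`. Only `|A| *
(d + 1)` vertices have to be inspected, so evaluating a set takes time independent of `n`. -/
theorem ListGraph.traces_toFinset (G : ListGraph) {A : List ℕ} (hA : ∀ a ∈ A, a < G.n) :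
    G.traces A.toFinset = ((A.flatMap G.cN).map (G.trace A.toFinset)).toFinset := by
  ext t
  simp only [mem_traces, List.mem_toFinset, List.mem_map, List.mem_flatMap]
  constructor
  · rintro ⟨hne, v, hv, rfl⟩
    obtain ⟨c, hc⟩ := Finset.nonempty_iff_ne_empty.2 hne
    rw [mem_trace, List.mem_toFinset] at hc
    exact ⟨v, ⟨c, hc.1, G.cN_symm hc.2⟩, rfl⟩
  · rintro ⟨v, ⟨c, hc, hv⟩, rfl⟩
    refine ⟨Finset.nonempty_iff_ne_empty.1 ⟨c, ?_⟩, v, G.cN_lt (hA c hc) hv, rfl⟩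
    rw [mem_trace, List.mem_toFinset]
    exact ⟨hc, G.cN_symm hv⟩

theorem ListGraph.trace_eq_iff (G : ListGraph) {A : List ℕ} {x y : ℕ} :
    G.trace A.toFinset x = G.trace A.toFinset y ↔ ∀ c ∈ A, (c ∈ G.cN x ↔ c ∈ G.cN y) := by
  simp only [Finset.ext_iff, mem_trace, List.mem_toFinset]
  exact ⟨fun h c hc => by simpa [hc] using h c, fun h c => and_congr_right (h c)⟩

end PartialVC

namespace RAM

open PartialVC

/-- Compare the traces of the vertices in the registers `28` and `31`. -/
def cmpLoop (aa al : ℕ) : Prog :=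
  .while (.lt 24 al) (.load 25 aa 24 ;; memTest 25 28 33 ;; memTest 25 31 34 ;;
    (.ite (.eq 33 34) .skip (.const 32 0) ;; .inc 24))

/-- Look for an earlier vertex with the trace of the vertex in register `28`. -/
def newLoop (aa al : ℕ) : Prog :=
  .while (.lt 30 27) ((.load 31 3 30 ;; .const 32 1 ;; .const 24 0) ;; cmpLoop aa al ;;
    (.ite (.eq 32 4) (.const 29 0) .skip ;; .inc 30))

/-- Count the different traces of the vertices listed in array `3`. -/
def countLoop (aa al : ℕ) : Prog :=
  .while (.lt 27 23) ((.load 28 3 27 ;; .const 29 1 ;; .const 30 0) ;; newLoop aa al ;;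
    (.ite (.eq 29 4) (.inc 26) .skip ;; .inc 27))

/-- List in array `3` the closed neighborhoods of the vertices listed in array `aa`. -/
def listLoop (aa al : ℕ) : Prog :=
  .while (.lt 24 al) (.load 25 aa 24 ;; forN 25 20 21 22 (.store 3 23 20 ;; .inc 23) ;; .inc 24)

/-- Register `26` becomes the number of nonempty traces on the set listed in array `aa`. -/
def evalProg (aa al : ℕ) : Prog :=
  (.const 23 0 ;; .const 24 0) ;; listLoop aa al ;; (.const 26 0 ;; .const 27 0) ;; countLoop aa al

@[simp] theorem cmpLoop_writesReg (aa al r : ℕ) : (cmpLoop aa al).WritesReg r ↔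
    r = 20 ∨ r = 21 ∨ r = 22 ∨ r = 24 ∨ r = 25 ∨ r = 32 ∨ r = 33 ∨ r = 34 := by
  simp [cmpLoop, Prog.WritesReg]; tauto

@[simp] theorem cmpLoop_writesArr (aa al a : ℕ) : ¬ (cmpLoop aa al).WritesArr a := by
  simp [cmpLoop, Prog.WritesArr]

@[simp] theorem newLoop_writesReg (aa al r : ℕ) : (newLoop aa al).WritesReg r ↔
    r = 20 ∨ r = 21 ∨ r = 22 ∨ r = 24 ∨ r = 25 ∨ r = 29 ∨ r = 30 ∨ r = 31 ∨ r = 32 ∨ r = 33 ∨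
      r = 34 := by
  simp [newLoop, Prog.WritesReg]; tauto

@[simp] theorem newLoop_writesArr (aa al a : ℕ) : ¬ (newLoop aa al).WritesArr a := by
  simp [newLoop, Prog.WritesArr]

@[simp] theorem evalProg_writesReg (aa al r : ℕ) :
    (evalProg aa al).WritesReg r ↔ 20 ≤ r ∧ r ≤ 34 := by
  simp [evalProg, listLoop, countLoop, Prog.WritesReg]; omega

@[simp] theorem evalProg_writesArr (aa al a : ℕ) : (evalProg aa al).WritesArr a ↔ a = 3 := by
  simp [evalProg, listLoop, countLoop, Prog.WritesArr]

section

variable {G : ListGraph} {A : List ℕ} {aa al : ℕ} {s : State}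

theorem wp_cmpLoop (hal : 40 ≤ al) (hb : Base G s) (hA : HoldsList (s.arr aa) A)
    (hl : s.reg al = A.length) (hx : s.reg 28 < G.n) (hy : s.reg 31 < G.n)
    (h32 : s.reg 32 = 1) (h24 : s.reg 24 = 0) :
    wp (cmpLoop aa al) s (A.length * (12 * (G.d + 1) + 20) + 1) (fun s' => s'.reg 32 =
      if G.trace A.toFinset (s.reg 28) = G.trace A.toFinset (s.reg 31) then 1 else 0) := by
  set x := s.reg 28 with hxd
  set y := s.reg 31 with hyd
  have key := wp_forLt (i := 24) (c := al) (s := s)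
    (p := .load 25 aa 24 ;; memTest 25 28 33 ;; memTest 25 31 34 ;;
      (.ite (.eq 33 34) .skip (.const 32 0) ;; .inc 24)) A.length (12 * (G.d + 1) + 19)
    (I := fun m s' => s'.reg 24 = m ∧ s'.reg al = A.length ∧
      s'.reg 32 = if ∀ c ∈ A.take m, (c ∈ G.cN x ↔ c ∈ G.cN y) then 1 else 0)
    (fun m s' h => ⟨h.1, h.2.1⟩) ?_ ?_
  · refine key.mono le_rfl ?_
    rintro s' - ⟨-, -, h⟩
    rw [List.take_length] at h
    simp only [h, G.trace_eq_iff]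
  · rintro m s' hu hm ⟨h1, h2, h3⟩
    change Unch (cmpLoop aa al) s s' at hu
    have hb' : Base G s' := hb.of_unch hu (by simp) (by simp)
    have hx' : s'.reg 28 = x := hu.1 28 (by simp)
    have hy' : s'.reg 31 = y := hu.1 31 (by simp)
    have ha' : s'.arr aa = s.arr aa := hu.2 aa (by simp)
    refine wp.le (T := 1 + ((6 * (G.d + 1) + 7) + ((6 * (G.d + 1) + 7) + 4))) ?_ (by omega)
    refine wp_seq ⟨1, _, .load 25 aa 24 s', le_rfl, fun hu₁ => ?_⟩
    set s₁ := s'.setReg 25 (s'.arr aa (s'.reg 24)) with hs₁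
    have hb₁ : Base G s₁ := hb'.of_unch hu₁ (by simp [Prog.WritesReg]) (by simp [Prog.WritesArr])
    have hc₁ : s₁.reg 25 = A.getD m 0 := by
      simp only [hs₁, State.setReg_reg, if_true]; rw [h1, ha', hA m hm]
    have hx₁ : s₁.reg 28 = x := by rw [hu₁.1 28 (by simp [Prog.WritesReg]), hx']
    have hy₁ : s₁.reg 31 = y := by rw [hu₁.1 31 (by simp [Prog.WritesReg]), hy']
    refine wp_seq ((wp_memTest hb₁ (by rw [hx₁]; exact hx) (by omega) (by omega) (by omega)
      (by omega) (by omega)).mono le_rfl fun s₂ hu₂ hf₂ _ => ?_)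
    have hb₂ : Base G s₂ := hb₁.of_unch hu₂ (by simp) (by simp)
    have hc₂ : s₂.reg 25 = A.getD m 0 := by rw [hu₂.1 25 (by simp), hc₁]
    have hy₂ : s₂.reg 31 = y := by rw [hu₂.1 31 (by simp), hy₁]
    refine wp_seq ((wp_memTest hb₂ (by rw [hy₂]; exact hy) (by omega) (by omega) (by omega)
      (by omega) (by omega)).mono le_rfl fun s₃ hu₃ hf₃ _ => ?_)
    rw [hc₁, hx₁] at hf₂
    rw [hc₂, hy₂] at hf₃
    have h33 : s₃.reg 33 = _ := (hu₃.1 33 (by simp)).trans hf₂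
    have h24 : s₃.reg 24 = m := by
      rw [hu₃.1 24 (by simp), hu₂.1 24 (by simp), hu₁.1 24 (by simp [Prog.WritesReg]), h1]
    have h32' : s₃.reg 32 = s'.reg 32 := by
      rw [hu₃.1 32 (by simp), hu₂.1 32 (by simp), hu₁.1 32 (by simp [Prog.WritesReg])]
    have hal' : s₃.reg al = A.length := by
      rw [hu₃.1 al (by simp; omega), hu₂.1 al (by simp; omega),
        hu₁.1 al (by simp [Prog.WritesReg]; omega), h2]
    refine wp.le (wp_eval (by simp [Prog.LoopFree]) ?_) (le_refl 4)
    have hal24 : al ≠ 24 := by omega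
    have hal32 : al ≠ 32 := by omega
    simp only [Prog.eval, Test.holds_eq]
    rw [Search.take_succ_getD hm]
    by_cases hiff : (A.getD m 0 ∈ G.cN x ↔ A.getD m 0 ∈ G.cN y)
    · have heq : s₃.reg 33 = s₃.reg 34 := by rw [h33, hf₃]; simp only [hiff]
      rw [if_pos heq]
      refine ⟨by simp [State.setReg_reg, h24], by simp [State.setReg_reg, hal24, hal'], ?_⟩
      simp only [State.setReg_reg]
      norm_num
      rw [h32', h3]
      congr 1
      rw [eq_iff_iff]
      constructor
      · intro h c hc
        rcases List.mem_append.1 hc with hc | hc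
        · exact h c hc
        · rw [List.mem_singleton.1 hc]; exact hiff
      · exact fun h c hc => h c (List.mem_append.2 (Or.inl hc))
    · have hne : s₃.reg 33 ≠ s₃.reg 34 := by
        rw [h33, hf₃]
        by_cases h1 : A.getD m 0 ∈ G.cN x <;> by_cases h2 : A.getD m 0 ∈ G.cN y <;>
          simp_all
      rw [if_neg hne]
      refine ⟨by simp [State.setReg_reg, h24],
        by simp [State.setReg_reg, hal24, hal32, hal'], ?_⟩
      simp only [State.setReg_reg]
      norm_num
      exact Or.inr (by simpa using hiff)
  · exact ⟨h24, hl, by simpa using h32⟩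

theorem wp_newLoop {L : List ℕ} (hal : 40 ≤ al) (hb : Base G s)
    (hA : HoldsList (s.arr aa) A) (hl : s.reg al = A.length) (hL : HoldsList (s.arr 3) L)
    (hLn : ∀ x ∈ L, x < G.n) (hp : s.reg 27 < L.length) (hx : s.reg 28 < G.n)
    (h29 : s.reg 29 = 1) (h30 : s.reg 30 = 0) :
    wp (newLoop aa al) s (s.reg 27 * (A.length * (12 * (G.d + 1) + 20) + 9) + 1)
      (fun s' => s'.reg 29 = if G.trace A.toFinset (s.reg 28) ∈
        (L.take (s.reg 27)).map (G.trace A.toFinset) then 0 else 1) := by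
  set p := s.reg 27 with hpd
  set x := s.reg 28 with hxd
  refine (wp_forLt (i := 30) (c := 27) (s := s)
    (p := (.load 31 3 30 ;; .const 32 1 ;; .const 24 0) ;; cmpLoop aa al ;;
    (.ite (.eq 32 4) (.const 29 0) .skip ;; .inc 30)) p (A.length * (12 * (G.d + 1) + 20) + 8)
    (I := fun m s' => (s'.reg 30 = m ∧ s'.reg 27 = p) ∧
      s'.reg 29 = if G.trace A.toFinset x ∈ (L.take m).map (G.trace A.toFinset) then 0 else 1)
    (fun m s' h => h.1) ?_ ?_).mono le_rfl fun s' _ h => h.2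
  · rintro m s' hu hm ⟨⟨h1, h2⟩, h3⟩
    change Unch (newLoop aa al) s s' at hu
    have hb' : Base G s' := hb.of_unch hu (by simp) (by simp)
    have hmL : m < L.length := by omega
    refine wp.le (T := 3 + ((A.length * (12 * (G.d + 1) + 20) + 1) + 4)) ?_ (by omega)
    refine wp_seq (wp_eval (by simp [Prog.LoopFree]) fun hu₁ => ?_)
    simp only [Prog.eval] at hu₁ ⊢
    set s₁ := ((s'.setReg 31 (s'.arr 3 (s'.reg 30))).setReg 32 1).setReg 24 0 with hs₁
    have hb₁ : Base G s₁ := hb'.of_unch hu₁ (by simp [Prog.WritesReg]) (by simp [Prog.WritesArr])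
    have hx₁ : s₁.reg 28 = x := by
      rw [hu₁.1 28 (by simp [Prog.WritesReg]), hu.1 28 (by simp)]
    have hal₁ : s₁.reg al = A.length := by
      rw [hu₁.1 al (by simp [Prog.WritesReg]; omega), hu.1 al (by simp; omega), hl]
    have hA₁ : HoldsList (s₁.arr aa) A := by
      rw [hu₁.2 aa (by simp [Prog.WritesArr]), hu.2 aa (by simp)]; exact hA
    have hy₁ : s₁.reg 31 = L.getD m 0 := by
      simp [hs₁, State.setReg_reg, h1, hu.2 3 (by simp), hL m hmL]
    refine wp_seq ((wp_cmpLoop hal hb₁ hA₁ hal₁ (by rw [hx₁]; exact hx)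
      (by rw [hy₁]; exact hLn _ (Search.getD_mem hmL)) (by simp [hs₁, State.setReg_reg])
      (by simp [hs₁, State.setReg_reg])).mono le_rfl fun s₂ hu₂ h32 _ => ?_)
    rw [hx₁, hy₁] at h32
    have h4 : s₂.reg 4 = 1 := by rw [hu₂.1 4 (by simp), hb₁.one]
    have h30' : s₂.reg 30 = m := by
      rw [hu₂.1 30 (by simp), hu₁.1 30 (by simp [Prog.WritesReg]), h1]
    have h27' : s₂.reg 27 = p := by
      rw [hu₂.1 27 (by simp), hu₁.1 27 (by simp [Prog.WritesReg]), h2]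
    have h29' : s₂.reg 29 = s'.reg 29 := by
      rw [hu₂.1 29 (by simp), hu₁.1 29 (by simp [Prog.WritesReg])]
    refine wp.le (wp_eval (by simp [Prog.LoopFree]) ?_) (le_refl 4)
    simp only [Prog.eval, Test.holds_eq, h4, h32]
    rw [Search.take_succ_getD hmL, List.map_append]
    by_cases he : G.trace A.toFinset x = G.trace A.toFinset (L.getD m 0)
    · rw [if_pos (by rw [if_pos he])]
      refine ⟨by simp [State.setReg_reg, h30', h27'], ?_⟩
      rw [if_pos (List.mem_append.2 (Or.inr (by simp [he])))]
      simp [State.setReg_reg]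
    · rw [if_neg (by rw [if_neg he]; norm_num)]
      refine ⟨by simp [State.setReg_reg, h30', h27'], ?_⟩
      simp only [State.setReg_reg]
      norm_num
      rw [h29', h3]
      congr 1
      rw [eq_iff_iff]
      constructor
      · intro h; left; simpa using h
      · rintro (h | h)
        · simpa using h
        · exact (he (by simpa using h)).elim
  · exact ⟨⟨h30, rfl⟩, by simpa using h29⟩

/-- An entry is counted exactly when no earlier entry has the same trace. -/
theorem wp_countLoop {L : List ℕ} (hal : 40 ≤ al) (hb : Base G s)
    (hA : HoldsList (s.arr aa) A) (hl : s.reg al = A.length) (hL : HoldsList (s.arr 3) L)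
    (hLn : ∀ x ∈ L, x < G.n) (h23 : s.reg 23 = L.length) (h26 : s.reg 26 = 0)
    (h27 : s.reg 27 = 0) :
    wp (countLoop aa al) s
      (L.length * (L.length * (A.length * (12 * (G.d + 1) + 20) + 9) + 9) + 1)
      (fun s' => s'.reg 26 = (L.map (G.trace A.toFinset)).toFinset.card) := by
  refine (wp_forLt (i := 27) (c := 23) (s := s)
    (p := (.load 28 3 27 ;; .const 29 1 ;; .const 30 0) ;; newLoop aa al ;;
    (.ite (.eq 29 4) (.inc 26) .skip ;; .inc 27)) L.length
    (L.length * (A.length * (12 * (G.d + 1) + 20) + 9) + 8)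
    (I := fun m s' => (s'.reg 27 = m ∧ s'.reg 23 = L.length) ∧
      s'.reg 26 = ((L.take m).map (G.trace A.toFinset)).toFinset.card)
    (fun m s' h => h.1) ?_ ?_).mono le_rfl fun s' _ h => by simpa using h.2
  · rintro m s' hu hm ⟨⟨h1, h2⟩, h3⟩
    change Unch (countLoop aa al) s s' at hu
    have hb' : Base G s' := hb.of_unch hu (by simp [countLoop, Prog.WritesReg])
      (by simp [countLoop, Prog.WritesArr])
    have hle := Nat.mul_le_mul_right (A.length * (12 * (G.d + 1) + 20) + 9) hm.le
    refine wp.le (T := 3 + ((m * (A.length * (12 * (G.d + 1) + 20) + 9) + 1) + 4)) ?_ (by omega)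
    refine wp_seq (wp_eval (by simp [Prog.LoopFree]) fun hu₁ => ?_)
    simp only [Prog.eval] at hu₁ ⊢
    set s₁ := ((s'.setReg 28 (s'.arr 3 (s'.reg 27))).setReg 29 1).setReg 30 0 with hs₁
    have hb₁ : Base G s₁ := hb'.of_unch hu₁ (by simp [Prog.WritesReg]) (by simp [Prog.WritesArr])
    have hL' : HoldsList (s'.arr 3) L := by
      rw [hu.2 3 (by simp [countLoop, Prog.WritesArr])]; exact hL
    have hal₁ : s₁.reg al = A.length := by
      rw [hu₁.1 al (by simp [Prog.WritesReg]; omega),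
        hu.1 al (by simp [countLoop, Prog.WritesReg]; omega), hl]
    have hA₁ : HoldsList (s₁.arr aa) A := by
      rw [hu₁.2 aa (by simp [Prog.WritesArr]), hu.2 aa (by simp [countLoop, Prog.WritesArr])]
      exact hA
    have hx₁ : s₁.reg 28 = L.getD m 0 := by
      simp [hs₁, State.setReg_reg, h1, hL' m hm]
    have h27₁ : s₁.reg 27 = m := by simp [hs₁, State.setReg_reg, h1]
    have key := wp_newLoop hal hb₁ hA₁ hal₁ (L := L) (by simpa [hs₁] using hL') hLn
      (by rw [h27₁]; exact hm) (by rw [hx₁]; exact hLn _ (Search.getD_mem hm))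
      (by simp [hs₁, State.setReg_reg]) (by simp [hs₁, State.setReg_reg])
    rw [h27₁, hx₁] at key
    refine wp_seq (key.mono le_rfl fun s₂ hu₂ h29 _ => ?_)
    have h4 : s₂.reg 4 = 1 := by rw [hu₂.1 4 (by simp), hb₁.one]
    have h27' : s₂.reg 27 = m := by rw [hu₂.1 27 (by simp), h27₁]
    have h23' : s₂.reg 23 = L.length := by
      rw [hu₂.1 23 (by simp), hu₁.1 23 (by simp [Prog.WritesReg]), h2]
    have h26' : s₂.reg 26 = s'.reg 26 := by
      rw [hu₂.1 26 (by simp), hu₁.1 26 (by simp [Prog.WritesReg])]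
    refine wp.le (wp_eval (by simp [Prog.LoopFree]) ?_) (le_refl 4)
    simp only [Prog.eval, Test.holds_eq, h4, h29]
    rw [Search.take_succ_getD hm, List.map_append, List.toFinset_append]
    have hins : ((L.take m).map (G.trace A.toFinset)).toFinset ∪
        ([L.getD m 0].map (G.trace A.toFinset)).toFinset =
        insert (G.trace A.toFinset (L.getD m 0))
          ((L.take m).map (G.trace A.toFinset)).toFinset := by
      rw [Finset.union_comm]; simp
    rw [hins]
    by_cases he : G.trace A.toFinset (L.getD m 0) ∈ (L.take m).map (G.trace A.toFinset)
    · rw [if_neg (by rw [if_pos he]; norm_num)]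
      refine ⟨by simp [State.setReg_reg, h23', h27'], ?_⟩
      rw [Finset.insert_eq_of_mem (by simpa using he), ← h3, ← h26']
      simp [State.setReg_reg]
    · rw [if_pos (by rw [if_neg he])]
      refine ⟨by simp [State.setReg_reg, h23', h27'], ?_⟩
      rw [Finset.card_insert_of_notMem (by simpa using he), ← h3, ← h26']
      simp [State.setReg_reg]
  · exact ⟨⟨h27, h23⟩, by simpa using h26⟩

theorem wp_listLoop (haa : 40 ≤ aa) (hal : 40 ≤ al) (hb : Base G s)
    (hA : HoldsList (s.arr aa) A) (hl : s.reg al = A.length) (hAn : ∀ x ∈ A, x < G.n)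
    (h23 : s.reg 23 = 0) (h24 : s.reg 24 = 0) :
    wp (listLoop aa al) s (A.length * (5 * (G.d + 1) + 9) + 1)
      (fun s' => HoldsList (s'.arr 3) (A.flatMap G.cN) ∧
        s'.reg 23 = (A.flatMap G.cN).length) := by
  refine (wp_forLt (i := 24) (c := al) (s := s)
    (p := .load 25 aa 24 ;; forN 25 20 21 22 (.store 3 23 20 ;; .inc 23) ;; .inc 24) A.length
    (5 * (G.d + 1) + 8)
    (I := fun m s' => (s'.reg 24 = m ∧ s'.reg al = A.length) ∧
      HoldsList (s'.arr 3) ((A.take m).flatMap G.cN) ∧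
        s'.reg 23 = ((A.take m).flatMap G.cN).length)
    (fun m s' h => h.1) ?_ ?_).mono le_rfl fun s' _ h => by simpa using h.2
  · rintro m s' hu hm ⟨⟨h1, h2⟩, h3, h4⟩
    change Unch (listLoop aa al) s s' at hu
    have hb' : Base G s' := hb.of_unch hu (by simp [listLoop, Prog.WritesReg])
      (by simp [listLoop, Prog.WritesArr])
    have haa3 : aa ≠ 3 := by omega
    refine wp.le (T := 1 + (((G.d + 1) * (2 + 3) + 6) + 1)) ?_ (by omega)
    refine wp_seq ⟨1, _, .load 25 aa 24 s', le_rfl, fun hu₁ => ?_⟩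
    set s₁ := s'.setReg 25 (s'.arr aa (s'.reg 24)) with hs₁
    have hb₁ : Base G s₁ := hb'.of_unch hu₁ (by simp [Prog.WritesReg]) (by simp [Prog.WritesArr])
    have hc₁ : s₁.reg 25 = A.getD m 0 := by
      simp only [hs₁, State.setReg_reg, if_true]
      rw [h1, hu.2 aa (by simp [listLoop, Prog.WritesArr, haa3]), hA m hm]
    set L₀ := (A.take m).flatMap G.cN with hL₀
    have key := wp_forN G (v := 25) (w := 20) (e := 21) (f := 22) (s := s₁)
      (body := .store 3 23 20 ;; .inc 23) 2
      (I := fun pre s'' => HoldsList (s''.arr 3) (L₀ ++ pre) ∧ s''.reg 23 = (L₀ ++ pre).length)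
      (by rw [hc₁]; exact hAn _ (Search.getD_mem hm)) hb₁.stored (by omega)
      (by simp [Prog.WritesReg, Prog.WritesArr]) ?_ ?_ ?_
    · rw [hc₁] at key
      refine wp_seq (key.mono le_rfl fun s₂ hu₂ h _ => ?_)
      refine wp.le (wp_eval (by simp [Prog.LoopFree]) ?_) (le_refl 1)
      rw [Search.take_succ_getD hm, List.flatMap_append]
      have h24' : s₂.reg 24 = m := by
        rw [hu₂.1 24 (by simp [Prog.WritesReg]), hu₁.1 24 (by simp [Prog.WritesReg]), h1]
      have hal' : s₂.reg al = A.length := by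
        rw [hu₂.1 al (by simp [Prog.WritesReg]; omega),
          hu₁.1 al (by simp [Prog.WritesReg]; omega), h2]
      have hal24 : al ≠ 24 := by omega
      have hsing : [A.getD m 0].flatMap G.cN = G.cN (A.getD m 0) := by simp
      rw [hsing]
      simp only [Prog.eval]
      refine ⟨⟨by simp [State.setReg_reg, h24'], by simp [State.setReg_reg, hal24, hal']⟩, ?_, ?_⟩
      · simpa using h.1
      · rw [State.setReg_reg, if_neg (by norm_num)]; exact h.2
    · rintro pre s'' r y hr ⟨g1, g2⟩
      refine ⟨by simpa using g1, ?_⟩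
      rw [State.setReg_reg, if_neg (by omega)]; exact g2
    · rintro pre y _ s'' _ ⟨g1, g2⟩ hy
      refine wp.le (wp_eval (by simp [Prog.LoopFree]) ?_) (le_refl 2)
      simp only [Prog.eval]
      refine ⟨?_, ?_⟩
      · simp only [State.setReg_arr, State.setArr_arr, if_true, g2, hy]
        rw [← List.append_assoc]
        exact g1.snoc y
      · simp [State.setReg_reg, g2]; omega
    · simp only [List.append_nil]
      refine ⟨by simpa [hs₁] using h3, ?_⟩
      rw [hu₁.1 23 (by simp [Prog.WritesReg]), h4]
  · exact ⟨⟨h24, hl⟩, by simpa using HoldsList.nil, by simpa using h23⟩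

theorem wp_evalProg {k : ℕ} (haa : 40 ≤ aa) (hal : 40 ≤ al) (hb : Base G s)
    (hA : HoldsList (s.arr aa) A) (hl : s.reg al = A.length) (hAn : ∀ x ∈ A, x < G.n)
    (hk : A.length ≤ k) :
    wp (evalProg aa al) s (80 * ((k + 1) * (G.d + 1)) ^ 3)
      (fun s' => s'.reg 26 = G.val A.toFinset) := by
  set L := A.flatMap G.cN with hL
  have hLlen : L.length ≤ A.length * (G.d + 1) := by
    rw [hL, List.length_flatMap]
    refine (List.sum_le_card_nsmul _ (G.d + 1) ?_).trans (by simp)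
    intro x hx
    rw [List.mem_map] at hx
    obtain ⟨a, _, rfl⟩ := hx
    exact G.length_cN_le a
  have hLn : ∀ x ∈ L, x < G.n := by
    intro x hx
    rw [hL, List.mem_flatMap] at hx
    obtain ⟨a, ha, hx⟩ := hx
    exact G.cN_lt (hAn a ha) hx
  refine wp.le (T := 2 + ((A.length * (5 * (G.d + 1) + 9) + 1) + (2 +
    (L.length * (L.length * (A.length * (12 * (G.d + 1) + 20) + 9) + 9) + 1)))) ?_ ?_
  · refine wp_seq (wp_eval (by simp [Prog.LoopFree]) fun hu₁ => ?_)
    simp only [Prog.eval] at hu₁ ⊢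
    set s₁ := (s.setReg 23 0).setReg 24 0 with hs₁
    have hb₁ : Base G s₁ := hb.of_unch hu₁ (by simp [Prog.WritesReg]) (by simp [Prog.WritesArr])
    have hal₁ : s₁.reg al = A.length := by
      rw [hu₁.1 al (by simp [Prog.WritesReg]; omega), hl]
    refine wp_seq ((wp_listLoop haa hal hb₁ (by simpa [hs₁] using hA) hal₁ hAn
      (by simp [hs₁, State.setReg_reg]) (by simp [hs₁, State.setReg_reg])).mono le_rfl
      fun s₂ hu₂ h₂ _ => ?_)
    have hb₂ : Base G s₂ := hb₁.of_unch hu₂ (by simp [listLoop, Prog.WritesReg])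
      (by simp [listLoop, Prog.WritesArr])
    have hal₂ : s₂.reg al = A.length := by
      rw [hu₂.1 al (by simp [listLoop, Prog.WritesReg]; omega), hal₁]
    have hA₂ : HoldsList (s₂.arr aa) A := by
      rw [hu₂.2 aa (by simp [listLoop, Prog.WritesArr]; omega)]; simpa [hs₁] using hA
    refine wp_seq (wp_eval (by simp [Prog.LoopFree]) fun hu₃ => ?_)
    simp only [Prog.eval] at hu₃ ⊢
    set s₃ := (s₂.setReg 26 0).setReg 27 0 with hs₃
    have hb₃ : Base G s₃ := hb₂.of_unch hu₃ (by simp [Prog.WritesReg]) (by simp [Prog.WritesArr])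
    refine (wp_countLoop hal hb₃ (by simpa [hs₃] using hA₂)
      (by rw [hu₃.1 al (by simp [Prog.WritesReg]; omega), hal₂]) (L := L)
      (by simpa [hs₃] using h₂.1) hLn
      (by rw [hu₃.1 23 (by simp [Prog.WritesReg]), h₂.2])
      (by simp [hs₃, State.setReg_reg]) (by simp [hs₃, State.setReg_reg])).mono le_rfl
      fun s₄ _ h₄ => ?_
    rw [h₄, ListGraph.val, G.traces_toFinset hAn]
  -- The list of neighbors has at most `Y` entries. They are compared in pairs, and each comparison
  -- costs `O(Y)`; hence the cube.
  · set Y := (k + 1) * (G.d + 1) with hY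
    have hY1 : 1 ≤ Y := Nat.one_le_iff_ne_zero.2 (by positivity)
    have hAD : A.length * (G.d + 1) ≤ Y := Nat.mul_le_mul_right _ (by omega)
    have hAY : A.length ≤ A.length * (G.d + 1) := Nat.le_mul_of_pos_right _ (by omega)
    have h1 : A.length * (12 * (G.d + 1) + 20) + 9 ≤ 41 * Y := by
      have : A.length * (12 * (G.d + 1) + 20) = 12 * (A.length * (G.d + 1)) + 20 * A.length := by
        ring
      omega
    have h2 : A.length * (5 * (G.d + 1) + 9) ≤ 14 * Y := by
      have : A.length * (5 * (G.d + 1) + 9) = 5 * (A.length * (G.d + 1)) + 9 * A.length := by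
        ring
      omega
    have h3 : L.length * (A.length * (12 * (G.d + 1) + 20) + 9) ≤ Y * (41 * Y) :=
      Nat.mul_le_mul (by omega) h1
    have h4 : L.length * (L.length * (A.length * (12 * (G.d + 1) + 20) + 9) + 9) ≤
        Y * (Y * (41 * Y) + 9) := Nat.mul_le_mul (by omega) (by omega)
    have h5 : Y * (Y * (41 * Y) + 9) = 41 * Y ^ 3 + 9 * Y := by ring
    have h6 : Y ≤ Y ^ 3 := Nat.le_self_pow (by norm_num) Y
    omega

end

end RAM

/-! ## The backtracking search on the machine

A search uses the registers and arrays `o + 1`, `o + 2`, … for some base `o`. Registers: `o + 1`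
the length of the queue, `o + 2` the number of decided candidates, `o + 3` the number of chosen
vertices, `o + 4` and `o + 5` the entries `j` and `need` of the current node, `o + 6` the height
of the stack, `o + 7` the token of the current node, `o + 8` the number of vertices to be chosen,
`o + 9` and `o + 10` the best value and the size of the best set, `o + 11` to `o + 14` the answer
to a request for a root, `o + 15` auxiliary. Arrays: `o + 1` the queue, `o + 2` the chosen
vertices, `o + 3` the best set, `o + 4` to `o + 9` the stack. -/

namespace RAM

open PartialVC

/-- The stack in memory, its top first: every frame is a node with its token. -/
def FramesAt (o : ℕ) (s : State) : List (Node × ℕ) → Prop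
  | [] => True
  | (σ, t) :: fs => (s.arr (o + 4) (fs.length + 1) = σ.Q.length ∧
      s.arr (o + 5) (fs.length + 1) = σ.h ∧ s.arr (o + 6) (fs.length + 1) = σ.A.length ∧
      s.arr (o + 7) (fs.length + 1) = σ.j ∧ s.arr (o + 8) (fs.length + 1) = σ.need ∧
      s.arr (o + 9) (fs.length + 1) = t) ∧ FramesAt o s fs

theorem FramesAt.congr {o : ℕ} {s s' : State} {fs : List (Node × ℕ)} (h : FramesAt o s fs)
    (hs : ∀ a, o + 4 ≤ a → a ≤ o + 9 → ∀ i ≤ fs.length, s'.arr a i = s.arr a i) :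
    FramesAt o s' fs := by
  induction fs with
  | nil => trivial
  | cons f fs ih =>
    obtain ⟨h1, h2⟩ := h
    refine ⟨?_, ih h2 fun a ha ha' i hi => hs a ha ha' i (by simp; omega)⟩
    have hi : fs.length + 1 ≤ (f :: fs).length := by simp
    rw [hs _ (by omega) (by omega) _ hi, hs _ (by omega) (by omega) _ hi,
      hs _ (by omega) (by omega) _ hi, hs _ (by omega) (by omega) _ hi,
      hs _ (by omega) (by omega) _ hi, hs _ (by omega) (by omega) _ hi]
    exact h1

/-- Every frame extends the frames below it, and the queue `Q` and the choices `A` extend the top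
frame. -/
def Chain (S : Search) (Q A : List ℕ) : List (Node × ℕ) → Prop
  | [] => True
  | (σ, _) :: fs => S.Ok σ ∧ σ.Q <+: Q ∧ σ.A <+: A ∧ Chain S σ.Q σ.A fs

theorem Chain.mono {S : Search} {Q A Q' A' : List ℕ} {fs : List (Node × ℕ)} (h : Chain S Q A fs)
    (hQ : Q <+: Q') (hA : A <+: A') : Chain S Q' A' fs := by
  cases fs with
  | nil => trivial
  | cons f fs => exact ⟨h.1, h.2.1.trans hQ, h.2.2.1.trans hA, h.2.2.2⟩

/-- The parts of the memory of a search that do not depend on the current node. -/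
structure Outline (o : ℕ) (S : Search) (fs : List (Node × ℕ)) (b : ℕ × List ℕ) (s : State) :
    Prop where
  base : Base S.G s
  k : s.reg (o + 8) = S.k
  frames : FramesAt o s fs
  depth : s.reg (o + 6) = fs.length
  best : s.reg (o + 9) = b.1
  best_len : s.reg (o + 10) = b.2.length
  best_list : HoldsList (s.arr (o + 3)) b.2

theorem Outline.of_eq {o : ℕ} {S : Search} {fs : List (Node × ℕ)} {b : ℕ × List ℕ} {s s' : State}
    (h : Outline o S fs b s)
    (hr : ∀ r ∈ [0, 3, 4, o + 8, o + 6, o + 9, o + 10], s'.reg r = s.reg r)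
    (ha : ∀ a ∈ [0, 1, o + 3, o + 4, o + 5, o + 6, o + 7, o + 8, o + 9], s'.arr a = s.arr a) :
    Outline o S fs b s' := by
  simp only [List.mem_cons, List.not_mem_nil, or_false, forall_eq_or_imp, forall_eq] at hr ha
  obtain ⟨r1, r2, r3, r4, r5, r6, r7⟩ := hr
  obtain ⟨a1, a2, a3, a4, a5, a6, a7, a8, a9⟩ := ha
  refine ⟨⟨by rw [a1, a2]; exact h.base.stored, by rw [r1, h.base.n], by rw [r2, h.base.zero],
    by rw [r3, h.base.one]⟩, by rw [r4, h.k], h.frames.congr fun a ha ha' i hi => ?_,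
    by rw [r5, h.depth], by rw [r6, h.best], by rw [r7, h.best_len], by rw [a3]; exact h.best_list⟩
  obtain rfl | rfl | rfl | rfl | rfl | rfl :
    a = o + 4 ∨ a = o + 5 ∨ a = o + 6 ∨ a = o + 7 ∨ a = o + 8 ∨ a = o + 9 := by omega
  all_goals simp only [*]

theorem Outline.of_unch {o : ℕ} {S : Search} {fs : List (Node × ℕ)} {b : ℕ × List ℕ}
    {s s' : State} {p : Prog} (h : Outline o S fs b s) (hu : Unch p s s')
    (hr : ∀ r ∈ [0, 3, 4, o + 8, o + 6, o + 9, o + 10], ¬ p.WritesReg r)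
    (ha : ∀ a ∈ [0, 1, o + 3, o + 4, o + 5, o + 6, o + 7, o + 8, o + 9], ¬ p.WritesArr a) :
    Outline o S fs b s' :=
  h.of_eq (fun r h => hu.1 r (hr r h)) (fun a h => hu.2 a (ha a h))

/-- The registers hold the current node `σ`. -/
structure Live (o : ℕ) (S : Search) (σ : Node) (fs : List (Node × ℕ)) (b : ℕ × List ℕ)
    (s : State) : Prop where
  outline : Outline o S fs b s
  chain : Chain S σ.Q σ.A fs
  queue : QueueAt S.M σ.Q (o + 1) (o + 1) s
  chosen : HoldsList (s.arr (o + 2)) σ.A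
  h : s.reg (o + 2) = σ.h
  len : s.reg (o + 3) = σ.A.length
  j : s.reg (o + 4) = σ.j
  need : s.reg (o + 5) = σ.need

/-- The search is about to visit the top of the stack. -/
def Parked (o : ℕ) (S : Search) (fs : List (Node × ℕ)) (b : ℕ × List ℕ) (s : State) : Prop :=
  Outline o S fs b s ∧ ∃ τ, S.Ok τ ∧ Chain S τ.Q τ.A fs ∧ QueueAt S.M τ.Q (o + 1) (o + 1) s ∧
    HoldsList (s.arr (o + 2)) τ.A

/-- Return to the node on top of the stack and increase its token. -/
def restore (o : ℕ) : Prog :=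
  .load (o + 15) (o + 4) (o + 6) ;; trunc (o + 1) (o + 1) (o + 15) ;;
    (.load (o + 2) (o + 5) (o + 6) ;; .load (o + 3) (o + 6) (o + 6) ;;
    .load (o + 4) (o + 7) (o + 6) ;; .load (o + 5) (o + 8) (o + 6) ;;
    .load (o + 7) (o + 9) (o + 6) ;; .copy (o + 15) (o + 7) ;; .inc (o + 15) ;;
    .store (o + 9) (o + 6) (o + 15))

/-- Put the current node on the stack. -/
def pushFrame (o : ℕ) : Prog :=
  .inc (o + 6) ;; .store (o + 4) (o + 6) (o + 1) ;; .store (o + 5) (o + 6) (o + 2) ;;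
    .store (o + 6) (o + 6) (o + 3) ;; .store (o + 7) (o + 6) (o + 4) ;;
    .store (o + 8) (o + 6) (o + 5) ;; .store (o + 9) (o + 6) 3

/-- Choose the vertex in register `o + 14`. -/
def choose (o : ℕ) : Prog :=
  (.store (o + 2) (o + 3) (o + 14) ;; .inc (o + 3)) ;; pushN2 (o + 1) (o + 1) (o + 14)

section

variable {o : ℕ} {S : Search} {σ : Node} {t : ℕ} {fs : List (Node × ℕ)} {b : ℕ × List ℕ}
  {s : State}

/-- A frame stores lengths only. By `Chain`, the queue and the choices of the top frame are prefixes
of the present ones, so shortening recovers them; the queue is truncated with its marks, while for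
the choices resetting the length suffices. The old token is returned and its successor is stored. -/
theorem wp_restore (ho : 40 ≤ o) (h : Parked o S ((σ, t) :: fs) b s) :
    wp (restore o) s (4 * (S.k * (S.G.d ^ 2 + 1)) + 10)
      (fun s' => Live o S σ ((σ, t + 1) :: fs) b s' ∧ s'.reg (o + 7) = t) := by
  obtain ⟨hO, τ, hτ, hc, hq, hA⟩ := h
  have hd := hO.depth
  obtain ⟨⟨f1, f2, f3, f4, f5, f6⟩, hf⟩ := hO.frames
  rw [List.length_cons] at hd
  have hQk : τ.Q.length ≤ S.k * (S.G.d ^ 2 + 1) :=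
    hτ.Q_len.trans (Nat.mul_le_mul_right _ hτ.A_le)
  refine wp.le (T := 1 + ((4 * τ.Q.length + 1) + 8)) ?_ (by omega)
  refine wp_seq ⟨1, _, .load _ _ _ s, le_rfl, fun hu => ?_⟩
  rw [hd, f1] at hu ⊢
  set s₁ := s.setReg (o + 15) σ.Q.length with hs₁
  have hO₁ : Outline o S ((σ, t) :: fs) b s₁ :=
    hO.of_unch hu (by simp [Prog.WritesReg]) (by simp [Prog.WritesArr])
  have hq₁ : QueueAt S.M τ.Q (o + 1) (o + 1) s₁ :=
    hq.of_unch hu (by simp [Prog.WritesArr]) (by simp [Prog.WritesReg]) (by simp [Prog.WritesArr])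
  refine wp_seq ((wp_trunc (by omega) (by omega) (by omega) (by omega) hO₁.base.zero hq₁ hc.2.1
    hτ.nodup (fun x hx => (hτ.fresh x hx).2) (by simp [hs₁, State.setReg_reg])).mono le_rfl
    fun s₂ hu₂ hq₂ _ => ?_)
  have hO₂ : Outline o S ((σ, t) :: fs) b s₂ :=
    hO₁.of_unch hu₂ (by simp; omega) (by simp)
  have hA₂ : HoldsList (s₂.arr (o + 2)) τ.A := by
    rw [hu₂.2 _ (by simp; omega)]; simpa [hs₁] using hA
  clear_value s₁
  obtain ⟨⟨g1, g2, g3, g4, g5, g6⟩, hg⟩ := hO₂.frames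
  have hd₂ := hO₂.depth
  rw [List.length_cons] at hd₂
  refine wp.le (wp_eval (by simp [Prog.LoopFree]) ?_) (le_refl 8)
  have e3 : ∀ i, (3 = o + i) = False := fun i => by simp; omega
  have e0 : ∀ i, (0 = o + i) = False := fun i => by simp; omega
  have e4 : ∀ i, (4 = o + i) = False := fun i => by simp; omega
  have e1 : ∀ i, (1 = o + i) = False := fun i => by simp; omega
  have e2 : ∀ i, (2 = o + i) = False := fun i => by simp; omega
  simp only [Prog.eval, State.setReg_reg, State.setReg_arr, Nat.add_left_cancel_iff, hd₂, g2,
    g3, g4, g5, g6, if_true, reduceIte, Nat.reduceEqDiff, State.setArr_reg]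
  refine ⟨⟨⟨⟨?_, ?_, ?_, ?_⟩, ?_, ⟨?_, ?_⟩, ?_, ?_, ?_, ?_⟩, ⟨hc.1, List.prefix_rfl,
    List.prefix_rfl, hc.2.2.2⟩, ?_, ?_, ?_, ?_, ?_, ?_⟩, ?_⟩
  · simpa [State.setArr_arr, e0, e1] using hO₂.base.stored
  · simpa [State.setReg_reg, e0] using hO₂.base.n
  · simpa [State.setReg_reg, e3, show o ≠ 0 by omega] using hO₂.base.zero
  · simpa [State.setReg_reg, e4, show o ≠ 0 by omega] using hO₂.base.one
  · simpa [State.setReg_reg] using hO₂.k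
  · simp [State.setArr_arr, g1, g2, g3, g4, g5]
  · refine hg.congr fun a h1 h2 i hi => ?_
    simp only [State.setArr_arr, State.setReg_arr]
    split_ifs with ha
    · subst ha; rw [Function.update_of_ne (by omega)]
    · rfl
  · simpa [State.setReg_reg] using hd₂
  · simpa [State.setReg_reg] using hO₂.best
  · simpa [State.setReg_reg] using hO₂.best_len
  · simpa [State.setArr_arr] using hO₂.best_list
  · exact hq₂.of_eq (by simp [State.setArr_arr]) (by simp [State.setReg_reg])
      (by simp [State.setArr_arr])
  · simpa [State.setArr_arr] using hA₂.of_isPrefix hc.2.2.1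
  all_goals simp [State.setReg_reg]

theorem wp_pushFrame (ho : 40 ≤ o) (hσ : S.Ok σ) (h : Live o S σ fs b s) :
    wp (pushFrame o) s 7 (Parked o S ((σ, 0) :: fs) b) := by
  refine wp.le (wp_eval (by simp [pushFrame, Prog.LoopFree]) ?_) (le_refl 7)
  have hO := h.outline
  have e3 : ∀ i, (3 = o + i) = False := fun i => by simp; omega
  have e0 : ∀ i, (0 = o + i) = False := fun i => by simp; omega
  have e4 : ∀ i, (4 = o + i) = False := fun i => by simp; omega
  have e1 : ∀ i, (1 = o + i) = False := fun i => by simp; omega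
  have e2 : ∀ i, (2 = o + i) = False := fun i => by simp; omega
  simp only [pushFrame, Prog.eval, State.setReg_reg, Nat.add_left_cancel_iff,
    hO.depth, reduceIte, Nat.reduceEqDiff, State.setArr_reg, e3, h.queue.len, h.h, h.len, h.j,
    h.need, hO.base.zero]
  refine ⟨⟨⟨?_, ?_, ?_, ?_⟩, ?_, ⟨?_, ?_⟩, ?_, ?_, ?_, ?_⟩, σ, hσ, ⟨hσ, List.prefix_rfl,
    List.prefix_rfl, h.chain⟩, ?_, ?_⟩
  · simpa [State.setArr_arr, e0, e1] using hO.base.stored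
  · simpa [State.setReg_reg, e0] using hO.base.n
  · simpa [State.setReg_reg, e3] using hO.base.zero
  · simpa [State.setReg_reg, e4] using hO.base.one
  · simpa [State.setReg_reg] using hO.k
  · simp [State.setArr_arr]
  · refine hO.frames.congr fun a h1 h2 i hi => ?_
    have hi' : i ≠ fs.length + 1 := by omega
    simp only [State.setArr_arr, State.setReg_arr, Nat.add_left_cancel_iff, reduceIte,
      Nat.reduceEqDiff]
    split_ifs with ha ha ha ha ha ha
    all_goals first | rfl | (subst ha; rw [Function.update_of_ne hi'])
  · simp [State.setReg_reg]
  · simpa [State.setReg_reg] using hO.best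
  · simpa [State.setReg_reg] using hO.best_len
  · simpa [State.setArr_arr] using hO.best_list
  · exact h.queue.of_eq (by simp [State.setArr_arr]) (by simp [State.setReg_reg])
      (by simp [State.setArr_arr])
  · simpa [State.setArr_arr] using h.chosen

theorem wp_pop (ho : 40 ≤ o) (hσ : S.Ok σ) (h : Live o S σ ((σ, t) :: fs) b s) :
    wp (.dec (o + 6)) s 1 (Parked o S fs b) := by
  have hO := h.outline
  refine ⟨1, _, .dec _ s, le_rfl, ?_⟩
  have e3 : ∀ i, (3 = o + i) = False := fun i => by simp; omega
  have e0 : ∀ i, (0 = o + i) = False := fun i => by simp; omega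
  have e4 : ∀ i, (4 = o + i) = False := fun i => by simp; omega
  refine ⟨⟨⟨?_, ?_, ?_, ?_⟩, ?_, ?_, ?_, ?_, ?_, ?_⟩, σ, hσ, h.chain.2.2.2.mono ?_ ?_, ?_, ?_⟩
  · exact hO.base.stored
  · simpa [State.setReg_reg, e0] using hO.base.n
  · simpa [State.setReg_reg, e3] using hO.base.zero
  · simpa [State.setReg_reg, e4] using hO.base.one
  · simpa [State.setReg_reg] using hO.k
  · exact hO.frames.2.congr fun a _ _ i _ => rfl
  · simp [State.setReg_reg, hO.depth]
  · simpa [State.setReg_reg] using hO.best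
  · simpa [State.setReg_reg] using hO.best_len
  · exact hO.best_list
  · exact List.prefix_rfl
  · exact List.prefix_rfl
  · exact h.queue.of_eq rfl (by simp [State.setReg_reg]) rfl
  · exact h.chosen

theorem wp_choose (ho : 40 ≤ o) (hu : s.reg (o + 14) < S.G.n) (h : Live o S σ fs b s) :
    wp (choose o) s (24 * (S.G.d + 1) ^ 2 + 2)
      (Live o S ⟨pushL S.M σ.Q (S.G.N2 (s.reg (o + 14))), σ.h, σ.A ++ [s.reg (o + 14)], σ.j,
        σ.need⟩ fs b) := by
  have hO := h.outline
  have e2 : ∀ i, (2 = o + i) = False := fun i => by simp; omega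
  refine wp.le (T := 2 + 24 * (S.G.d + 1) ^ 2) ?_ (by omega)
  refine wp_seq (wp_eval (by simp [Prog.LoopFree]) fun hu₁ => ?_)
  simp only [Prog.eval, State.setArr_reg] at hu₁ ⊢
  set u := s.reg (o + 14) with hud
  set s₁ := (s.setArr (o + 2) (s.reg (o + 3)) u).setReg (o + 3) (s.reg (o + 3) + 1) with hs₁
  have hu14 : s₁.reg (o + 14) = u := by rw [hu₁.1 _ (by simp [Prog.WritesReg])]
  have hO₁ : Outline o S fs b s₁ :=
    hO.of_unch hu₁ (by simp [Prog.WritesReg]; omega) (by simp [Prog.WritesArr])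
  have hq₁ : QueueAt S.M σ.Q (o + 1) (o + 1) s₁ :=
    h.queue.of_unch hu₁ (by simp [Prog.WritesArr]) (by simp [Prog.WritesReg])
      (by simp [Prog.WritesArr]; omega)
  have hA₁ : HoldsList (s₁.arr (o + 2)) (σ.A ++ [u]) := by
    simp only [hs₁, State.setReg_arr, State.setArr_arr, reduceIte, h.len]
    exact h.chosen.snoc u
  have hl₁ : s₁.reg (o + 3) = σ.A.length + 1 := by
    simp [hs₁, State.setReg_reg, h.len]
  have key := wp_pushN2 (v := o + 14) (by omega : 40 ≤ o + 1) (by omega : 40 ≤ o + 1) (by omega)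
    (by omega) hO₁.base (by rw [hu14]; exact hu) hq₁
  rw [hu14] at key
  refine key.mono le_rfl fun s₂ hu₂ hq₂ => ?_
  have hr : ∀ i, i = 2 ∨ i = 3 ∨ i = 4 ∨ i = 5 → s₂.reg (o + i) = s₁.reg (o + i) :=
    fun i hi => hu₂.1 _ (by simp; omega)
  have hr' : ∀ i, i = 2 ∨ i = 4 ∨ i = 5 → s₁.reg (o + i) = s.reg (o + i) :=
    fun i hi => hu₁.1 _ (by simp [Prog.WritesReg]; omega)
  refine ⟨hO₁.of_unch hu₂ (by simp; omega) (by simp; omega),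
    h.chain.mono prefix_pushL (List.prefix_append _ _), hq₂, ?_, ?_, ?_, ?_, ?_⟩
  · rw [hu₂.2 _ (by simp; omega)]; exact hA₁
  · rw [hr _ (by omega), hr' _ (by omega), h.h]
  · rw [hr _ (by omega), hl₁]; simp
  · rw [hr _ (by omega), hr' _ (by omega), h.j]
  · rw [hr _ (by omega), hr' _ (by omega), h.need]

end

end RAM

/-! ### Visiting the nodes of the search tree -/

namespace RAM

open PartialVC

/-- Evaluate the chosen set and keep it if it is better than the best one so far. -/
def recordBest (o : ℕ) : Prog :=
  evalProg (o + 2) (o + 3) ;; .ite (.lt (o + 9) 26)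
    ((.copy (o + 9) 26 ;; .const (o + 10) 0) ;; .while (.lt (o + 10) (o + 3))
      (.load (o + 15) (o + 2) (o + 10) ;; .store (o + 3) (o + 10) (o + 15) ;; .inc (o + 10)))
    .skip

/-- Visit the node on top of the stack; `fetch` answers requests for roots. -/
def visit (o : ℕ) (fetch : Prog) : Prog :=
  restore o ;; .ite (.lt (o + 3) (o + 8))
    (.ite (.lt (o + 2) (o + 1))
      (.ite (.eq (o + 7) 3)
        ((.load (o + 14) (o + 1) (o + 2) ;; .inc (o + 2)) ;; choose o ;; pushFrame o)
        (.ite (.eq (o + 7) 4) (.inc (o + 2) ;; pushFrame o) (.dec (o + 6))))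
      (.ite (.lt (o + 3) (o + 5)) (.dec (o + 6))
        (fetch ;; .ite (.eq (o + 11) 3) (.dec (o + 6))
          (.ite (.eq (o + 11) 4)
            ((.copy (o + 2) (o + 1) ;; .inc (o + 2) ;; .copy (o + 4) (o + 12) ;;
              .copy (o + 5) (o + 13)) ;; choose o ;; pushFrame o) .skip))))
    (recordBest o ;; .dec (o + 6))

/-- The search: the number of vertices to be chosen is in register `o + 8`. -/
def search (o : ℕ) (fetch : Prog) : Prog :=
  (.const (o + 1) 0 ;; .const (o + 2) 0 ;; .const (o + 3) 0 ;; .const (o + 4) 1 ;;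
    .const (o + 5) 0 ;; .const (o + 6) 0 ;; .const (o + 9) 0 ;; .const (o + 10) 0) ;;
    pushFrame o ;; .while (.lt 3 (o + 6)) (visit o fetch) ;; trunc (o + 1) (o + 1) 3

theorem writesReg_search {o r : ℕ} {fetch : Prog} (h : (search o fetch).WritesReg r) :
    (10 ≤ r ∧ r ≤ 34) ∨ (o < r ∧ r ≤ o + 15) ∨ fetch.WritesReg r := by
  simp [search, visit, recordBest, restore, pushFrame, choose, Prog.WritesReg] at h
  by_cases hf : fetch.WritesReg r
  · exact Or.inr (Or.inr hf)
  · simp only [hf, false_or] at h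
    omega

theorem writesArr_search {o a : ℕ} {fetch : Prog} (h : (search o fetch).WritesArr a) :
    a = 2 ∨ a = 3 ∨ (o < a ∧ a ≤ o + 9) ∨ fetch.WritesArr a := by
  simp [search, visit, recordBest, restore, pushFrame, choose, Prog.WritesArr] at h
  by_cases hf : fetch.WritesArr a
  · exact Or.inr (Or.inr (Or.inr hf))
  · simp only [hf, false_or] at h
    omega

/-- The answer to a request for a root: `0` in register `o + 11` if there are no more roots, `2` for
an entry without a root. -/
def RootAt (o : ℕ) (x : Option (Option (ℕ × ℕ × ℕ))) (s : State) : Prop :=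
  match x with
  | none => s.reg (o + 11) = 0
  | some none => s.reg (o + 11) = 2
  | some (some r) => s.reg (o + 11) = 1 ∧ s.reg (o + 12) = r.1 ∧ s.reg (o + 13) = r.2.1 ∧
      s.reg (o + 14) = r.2.2

/-- The program `fetch` answers requests for roots of `σ` within `R σ` steps. -/
def Fetches (o : ℕ) (S : Search) (fetch : Prog) (R : Node → ℕ) : Prop :=
  ∀ σ fs b s, S.Ok σ → 1 ≤ σ.j ∧ σ.j ≤ S.k → σ.A.length < S.k → Live o S σ fs b s →
    wp fetch s (R σ) (fun s' => Live o S σ fs b s' ∧ RootAt o ((S.roots σ)[s.reg (o + 7)]?) s')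

/-- A bound for the number of steps of one visit apart from the request for a root. -/
def visitTime (G : ListGraph) (k : ℕ) : ℕ := 140 * ((k + 1) * (G.d + 1)) ^ 3

section

variable {o : ℕ} {S : Search} {σ : Node} {t : ℕ} {fs : List (Node × ℕ)} {b : ℕ × List ℕ}
  {s : State} {fetch : Prog} {R : Node → ℕ}

theorem Live.parked (hσ : S.Ok σ) (h : Live o S σ fs b s) : Parked o S fs b s :=
  ⟨h.outline, σ, hσ, h.chain, h.queue, h.chosen⟩

theorem Live.of_unch_best {s' : State} {p : Prog} {b' : ℕ × List ℕ} (h : Live o S σ fs b s)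
    (hu : Unch p s s')
    (hr : ∀ r, p.WritesReg r → r ≠ 0 ∧ r ≠ 3 ∧ r ≠ 4 ∧ ¬ (o < r ∧ r ≤ o + 8 ∧ r ≠ o + 7))
    (ha : ∀ a, p.WritesArr a → 2 < a ∧ ¬ (o < a ∧ a ≤ o + 9 ∧ a ≠ o + 3))
    (h1 : s'.reg (o + 9) = b'.1) (h2 : s'.reg (o + 10) = b'.2.length)
    (h3 : HoldsList (s'.arr (o + 3)) b'.2) : Live o S σ fs b' s' := by
  have hr' : ∀ r, (r = 0 ∨ r = 3 ∨ r = 4 ∨ (o < r ∧ r ≤ o + 8 ∧ r ≠ o + 7)) →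
      s'.reg r = s.reg r := fun r h => hu.1 r fun h' => by have := hr r h'; omega
  have ha' : ∀ a, (a ≤ 2 ∨ (o < a ∧ a ≤ o + 9 ∧ a ≠ o + 3)) → s'.arr a = s.arr a :=
    fun a h => hu.2 a fun h' => by have := ha a h'; omega
  have hO := h.outline
  refine ⟨⟨⟨?_, ?_, ?_, ?_⟩, ?_, hO.frames.congr fun a h1 h2 i hi => ?_, ?_, h1, h2, h3⟩,
    h.chain, h.queue.of_eq (ha' _ (by omega)) (hr' _ (by omega)) (ha' _ (by omega)),
    ?_, ?_, ?_, ?_, ?_⟩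
  · rw [ha' 0 (by omega), ha' 1 (by omega)]; exact hO.base.stored
  · rw [hr' _ (by omega), hO.base.n]
  · rw [hr' _ (by omega), hO.base.zero]
  · rw [hr' _ (by omega), hO.base.one]
  · rw [hr' _ (by omega), hO.k]
  · rw [ha' _ (by omega)]
  · rw [hr' _ (by omega), hO.depth]
  · rw [ha' _ (by omega)]; exact h.chosen
  · rw [hr' _ (by omega), h.h]
  · rw [hr' _ (by omega), h.len]
  · rw [hr' _ (by omega), h.j]
  · rw [hr' _ (by omega), h.need]

theorem Live.of_unch {s' : State} {p : Prog} (h : Live o S σ fs b s) (hu : Unch p s s')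
    (hr : ∀ r, p.WritesReg r → r ≠ 0 ∧ r ≠ 3 ∧ r ≠ 4 ∧ ¬ (o < r ∧ r ≤ o + 10 ∧ r ≠ o + 7))
    (ha : ∀ a, p.WritesArr a → 2 < a ∧ ¬ (o < a ∧ a ≤ o + 9)) : Live o S σ fs b s' := by
  refine h.of_unch_best hu (fun r h => ?_) (fun a h => ?_) ?_ ?_ ?_
  · have := hr r h; omega
  · have := ha a h; omega
  · rw [hu.1 _ fun h => by have := hr _ h; omega, h.outline.best]
  · rw [hu.1 _ fun h => by have := hr _ h; omega, h.outline.best_len]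
  · rw [hu.2 _ fun h => by have := ha _ h; omega]; exact h.outline.best_list

theorem wp_recordBest (ho : 40 ≤ o) (hσ : S.Ok σ) (h : Live o S σ fs b s) :
    wp (recordBest o) s (80 * ((S.k + 1) * (S.G.d + 1)) ^ 3 + (4 * S.k + 4))
      (Live o S σ fs (updBest S.G b σ.A)) := by
  have hAk := hσ.A_le
  refine wp_seq ((wp_evalProg (by omega) (by omega) h.outline.base h.chosen h.len
    (fun x hx => (hσ.fresh x (List.mem_of_mem_take (hσ.A_sub x hx))).1) hAk).mono le_rfl
    fun s₁ hu₁ hv _ => ?_)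
  have h₁ : Live o S σ fs b s₁ := h.of_unch hu₁ (by simp; omega) (by simp; omega)
  refine wp.le (T := (2 + (σ.A.length * 4 + 1)) + 1) (wp_ite (fun hb => ?_) fun hb => ?_)
    (by omega)
  · rw [Test.holds_lt, hv, h₁.outline.best] at hb
    rw [updBest, if_pos hb]
    refine wp_seq (wp_eval (by simp [Prog.LoopFree]) fun hu₂ => ?_)
    simp only [Prog.eval] at hu₂ ⊢
    set s₂ := (s₁.setReg (o + 9) (s₁.reg 26)).setReg (o + 10) 0 with hs₂
    have h₂ : Live o S σ fs (S.G.val σ.A.toFinset, σ.A.take 0) s₂ := by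
      refine h₁.of_unch_best hu₂ ?_ ?_ ?_ ?_ ?_
      · simp [Prog.WritesReg]
      · simp [Prog.WritesArr]
      · simp [hs₂, State.setReg_reg, hv]
      · simp [hs₂, State.setReg_reg]
      · simpa using HoldsList.nil
    refine (wp_forLt (i := o + 10) (c := o + 3) σ.A.length 3
      (I := fun m s' => m ≤ σ.A.length ∧ Live o S σ fs (S.G.val σ.A.toFinset, σ.A.take m) s')
      (fun m s' h => ⟨?_, h.2.len⟩) ?_ ⟨by omega, h₂⟩).mono le_rfl fun s' _ h => ?_
    · rw [h.2.outline.best_len]; simpa using h.1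
    · rintro m s' - hm ⟨-, h'⟩
      refine ⟨3, _, .seq (.load _ _ _ _) (.seq (.store _ _ _ _) (.inc _ _)), le_rfl, by omega, ?_⟩
      have hbl := h'.outline.best_len
      simp only [List.length_take, Nat.min_eq_left hm.le] at hbl
      refine h'.of_unch_best (Exec.unch (.seq (.load (o + 15) (o + 2) (o + 10) s')
        (.seq (.store (o + 3) (o + 10) (o + 15) _) (.inc (o + 10) _)))) ?_ ?_ ?_ ?_ ?_
      · simp [Prog.WritesReg]
      · simp [Prog.WritesArr]
      · simpa [State.setReg_reg] using h'.outline.best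
      · simp [State.setReg_reg, hbl]; omega
      · have h5 : s'.arr (o + 2) m = σ.A.getD m 0 := h'.chosen m hm
        rw [Search.take_succ_getD hm]
        have := h'.outline.best_list.snoc (σ.A.getD m 0)
        simp only [List.length_take, Nat.min_eq_left hm.le] at this
        simpa [State.setArr_arr, State.setReg_reg, hbl, h5] using this
    · simpa using h.2
  · rw [Test.holds_lt, hv, h₁.outline.best] at hb
    rw [updBest, if_neg hb]
    exact (wp_eval (by simp [Prog.LoopFree]) h₁).le (by simp [Prog.time]; omega)

theorem visit_le (k d : ℕ) :
    4 * (k * (d ^ 2 + 1)) + 4 * k + 24 * (d + 1) ^ 2 + 28 + 80 * ((k + 1) * (d + 1)) ^ 3 ≤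
      140 * ((k + 1) * (d + 1)) ^ 3 := by
  have h1 : (k + 1) * (d + 1) ^ 2 ≤ ((k + 1) * (d + 1)) ^ 3 := by
    rw [mul_pow]
    exact Nat.mul_le_mul (Nat.le_self_pow (by norm_num) _)
      (Nat.pow_le_pow_right (by omega) (by omega))
  have h2 : 4 * (k * (d ^ 2 + 1)) + 4 * k + 24 * (d + 1) ^ 2 + 28 ≤
      60 * ((k + 1) * (d + 1) ^ 2) := by
    ring_nf; omega
  omega

theorem wp_visit_leaf (ho : 40 ≤ o) (hσ : S.Ok σ) (hk : S.k ≤ σ.A.length)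
    (h : Parked o S ((σ, t) :: fs) b s) :
    wp (visit o fetch) s (visitTime S.G S.k) (Parked o S fs (updBest S.G b σ.A)) := by
  have hv := visit_le S.k S.G.d
  refine wp.le (T := (4 * (S.k * (S.G.d ^ 2 + 1)) + 10) +
    (((80 * ((S.k + 1) * (S.G.d + 1)) ^ 3 + (4 * S.k + 4)) + 1) + 1)) ?_
    (by rw [visitTime]; omega)
  refine wp_seq ((wp_restore ho h).mono le_rfl fun s₁ _ h₁ _ => ?_)
  have hl : ¬ (Test.lt (o + 3) (o + 8)).Holds s₁ := by
    rw [Test.holds_lt, h₁.1.len, h₁.1.outline.k]; omega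
  refine wp_ite (fun h => absurd h hl) fun _ => ?_
  exact wp_seq ((wp_recordBest ho hσ h₁.1).mono le_rfl fun s₂ _ h₂ _ => wp_pop ho hσ h₂)

/-- Such a node is visited three times: token `0` enters the branch that takes the candidate, token
`1` the one that rejects it, and token `2` removes the node. These visits are the `3 * E` in `cost`.
-/
theorem wp_visit_item (ho : 40 ≤ o) (hσ : S.Ok σ) (hk : σ.A.length < S.k) (hQ : σ.h < σ.Q.length)
    (h : Parked o S ((σ, t) :: fs) b s) :
    wp (visit o fetch) s (visitTime S.G S.k) (Parked o S
      (if t = 0 then (S.inC σ, 0) :: (σ, 1) :: fs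
        else if t = 1 then (σ.outC, 0) :: (σ, 2) :: fs else fs) b) := by
  have hv := visit_le S.k S.G.d
  refine wp.le (T := (4 * (S.k * (S.G.d ^ 2 + 1)) + 10) +
    (((2 + ((24 * (S.G.d + 1) ^ 2 + 2) + 7)) + 1 + 1) + 1)) ?_ (by rw [visitTime]; omega)
  refine wp_seq ((wp_restore ho h).mono le_rfl fun s₁ _ h₁ _ => ?_)
  obtain ⟨h₁, ht⟩ := h₁
  have hl : (Test.lt (o + 3) (o + 8)).Holds s₁ := by
    rw [Test.holds_lt, h₁.len, h₁.outline.k]; omega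
  have hl' : (Test.lt (o + 2) (o + 1)).Holds s₁ := by
    rw [Test.holds_lt, h₁.h, h₁.queue.len]; omega
  have h0 := h₁.outline.base.zero
  have h4 := h₁.outline.base.one
  refine wp_ite (fun _ => ?_) fun h => absurd hl h
  refine wp_ite (fun _ => ?_) fun h => absurd hl' h
  refine wp_ite (fun htz => ?_) fun htz => ?_
  · rw [Test.holds_eq, ht, h0] at htz
    rw [if_pos htz]
    subst htz
    have hx : s₁.arr (o + 1) σ.h = σ.Q.getD σ.h 0 := h₁.queue.list _ hQ
    refine wp_seq (wp_eval (by simp [Prog.LoopFree]) fun hu₂ => ?_)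
    simp only [Prog.eval, State.setReg_reg, Nat.add_left_cancel_iff, Nat.reduceEqDiff, reduceIte,
      hx, h₁.h] at hu₂ ⊢
    set s₂ := (s₁.setReg (o + 14) (σ.Q.getD σ.h 0)).setReg (o + 2) (σ.h + 1) with hs₂
    have hr : ∀ i, i ≠ 14 → i ≠ 2 → s₂.reg (o + i) = s₁.reg (o + i) :=
      fun i h h' => hu₂.1 _ (by simp [Prog.WritesReg]; omega)
    have h₂ : Live o S ⟨σ.Q, σ.h + 1, σ.A, σ.j, σ.need⟩ ((σ, 1) :: fs) b s₂ :=
      ⟨h₁.outline.of_unch hu₂ (by simp [Prog.WritesReg]; omega) (by simp [Prog.WritesArr]),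
        h₁.chain, h₁.queue.of_unch hu₂ (by simp [Prog.WritesArr]) (by simp [Prog.WritesReg])
        (by simp [Prog.WritesArr]), h₁.chosen, by simp [hs₂, State.setReg_reg],
        by rw [hr _ (by omega) (by omega), h₁.len], by rw [hr _ (by omega) (by omega), h₁.j],
        by rw [hr _ (by omega) (by omega), h₁.need]⟩
    have h14 : s₂.reg (o + 14) = σ.Q.getD σ.h 0 := by simp [hs₂, State.setReg_reg]
    have key := wp_choose ho (by rw [h14]; exact (hσ.fresh _ (Search.getD_mem hQ)).1) h₂
    rw [h14] at key
    exact wp_seq (key.mono le_rfl fun s₃ _ h₃ _ => wp_pushFrame ho (hσ.inC hk hQ) h₃)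
  · rw [Test.holds_eq, ht, h0] at htz
    rw [if_neg htz]
    refine wp.le (T := 8 + 1) (wp_ite (fun ht1 => ?_) fun ht1 => ?_) (by omega)
    · rw [Test.holds_eq, ht, h4] at ht1
      rw [if_pos ht1]
      subst ht1
      refine wp_seq (T₁ := 1) (T₂ := 7) ⟨1, _, .inc _ _, le_rfl, fun hu₂ => ?_⟩
      set s₂ := s₁.setReg (o + 2) (s₁.reg (o + 2) + 1) with hs₂
      have hr : ∀ i, i ≠ 2 → s₂.reg (o + i) = s₁.reg (o + i) :=
        fun i h => hu₂.1 _ (by simp [Prog.WritesReg]; omega)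
      refine wp_pushFrame ho (hσ.outC hQ) ?_
      exact ⟨h₁.outline.of_unch hu₂ (by simp [Prog.WritesReg]; omega) (by simp [Prog.WritesArr]),
        h₁.chain, h₁.queue.of_unch hu₂ (by simp [Prog.WritesArr]) (by simp [Prog.WritesReg])
        (by simp [Prog.WritesArr]), h₁.chosen, by simp [hs₂, State.setReg_reg, h₁.h, Node.outC],
        by rw [hr _ (by omega), h₁.len]; rfl, by rw [hr _ (by omega), h₁.j]; rfl,
        by rw [hr _ (by omega), h₁.need]; rfl⟩
    · rw [Test.holds_eq, ht, h4] at ht1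
      rw [if_neg ht1]
      exact (wp_pop ho hσ h₁).le (by omega)

theorem wp_visit_fail (ho : 40 ≤ o) (hσ : S.Ok σ) (hk : σ.A.length < S.k)
    (hQ : ¬ σ.h < σ.Q.length) (hn : σ.A.length < σ.need) (h : Parked o S ((σ, t) :: fs) b s) :
    wp (visit o fetch) s (visitTime S.G S.k) (Parked o S fs b) := by
  have hv := visit_le S.k S.G.d
  refine wp.le (T := (4 * (S.k * (S.G.d ^ 2 + 1)) + 10) + (((1 + 1) + 1) + 1)) ?_
    (by rw [visitTime]; omega)
  refine wp_seq ((wp_restore ho h).mono le_rfl fun s₁ _ h₁ _ => ?_)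
  obtain ⟨h₁, ht⟩ := h₁
  have hl : (Test.lt (o + 3) (o + 8)).Holds s₁ := by
    rw [Test.holds_lt, h₁.len, h₁.outline.k]; omega
  have hl' : ¬ (Test.lt (o + 2) (o + 1)).Holds s₁ := by
    rw [Test.holds_lt, h₁.h, h₁.queue.len]; omega
  have hl'' : (Test.lt (o + 3) (o + 5)).Holds s₁ := by
    rw [Test.holds_lt, h₁.len, h₁.need]; omega
  refine wp_ite (fun _ => ?_) fun h => absurd hl h
  refine wp_ite (fun h => absurd h hl') fun _ => ?_
  exact wp_ite (fun _ => wp_pop ho hσ h₁) fun h => absurd hl'' h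

/-- The token is the position in the list of roots. An empty entry only advances it, and the visit
past the end of the list removes the node; hence `length + 1` visits in `cost`. -/
theorem wp_visit_root (ho : 40 ≤ o) (hS : S.RootsOk) (hf : Fetches o S fetch R) (hσ : S.Ok σ)
    (hj : 1 ≤ σ.j ∧ σ.j ≤ S.k) (hk : σ.A.length < S.k) (hQ : ¬ σ.h < σ.Q.length)
    (hn : ¬ σ.A.length < σ.need) (h : Parked o S ((σ, t) :: fs) b s) :
    wp (visit o fetch) s (visitTime S.G S.k + R σ) (Parked o S
      (match (S.roots σ)[t]? with
        | none => fs
        | some none => (σ, t + 1) :: fs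
        | some (some r) => (S.rootC σ r, 0) :: (σ, t + 1) :: fs) b) := by
  have hv := visit_le S.k S.G.d
  refine wp.le (T := (4 * (S.k * (S.G.d ^ 2 + 1)) + 10) + ((((R σ +
    (((4 + ((24 * (S.G.d + 1) ^ 2 + 2) + 7)) + 1) + 1)) + 1) + 1) + 1)) ?_
    (by rw [visitTime]; omega)
  refine wp_seq ((wp_restore ho h).mono le_rfl fun s₁ _ h₁ _ => ?_)
  obtain ⟨h₁, ht⟩ := h₁
  have hl : (Test.lt (o + 3) (o + 8)).Holds s₁ := by
    rw [Test.holds_lt, h₁.len, h₁.outline.k]; omega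
  have hl' : ¬ (Test.lt (o + 2) (o + 1)).Holds s₁ := by
    rw [Test.holds_lt, h₁.h, h₁.queue.len]; omega
  have hl'' : ¬ (Test.lt (o + 3) (o + 5)).Holds s₁ := by
    rw [Test.holds_lt, h₁.len, h₁.need]; omega
  refine wp_ite (fun _ => ?_) fun h => absurd hl h
  refine wp_ite (fun h => absurd h hl') fun _ => ?_
  refine wp_ite (fun h => absurd h hl'') fun _ => ?_
  refine wp_seq ((hf σ _ b s₁ hσ hj hk h₁).mono le_rfl fun s₂ _ h₂ _ => ?_)
  obtain ⟨h₂, hroot⟩ := h₂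
  rw [ht] at hroot
  have h0 := h₂.outline.base.zero
  have h4 := h₂.outline.base.one
  rcases hx : (S.roots σ)[t]? with _ | _ | r
  · rw [hx, RootAt] at hroot
    exact wp_ite (fun _ => (wp_pop ho hσ h₂).le (by omega)) fun h =>
      absurd (hroot.trans h0.symm) h
  · rw [hx, RootAt] at hroot
    refine wp_ite (fun h => ?_) fun _ => wp_ite (fun h => ?_) fun _ => ?_
    · rw [Test.holds_eq] at h; omega
    · rw [Test.holds_eq] at h; omega
    · exact (wp_eval (by simp [Prog.LoopFree]) (h₂.parked hσ)).le (by simp [Prog.time]; omega)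
  · rw [hx, RootAt] at hroot
    obtain ⟨r1, r2, r3, r4⟩ := hroot
    have hr := hS σ hσ r (List.mem_of_getElem? hx)
    refine wp_ite (fun h => ?_) fun _ => wp_ite (fun _ => ?_) fun h => ?_
    · rw [Test.holds_eq] at h; omega
    swap
    · rw [Test.holds_eq] at h; omega
    refine wp_seq (wp_eval (by simp [Prog.LoopFree]) fun hu₃ => ?_)
    simp only [Prog.eval, State.setReg_reg, Nat.add_left_cancel_iff, Nat.reduceEqDiff, reduceIte,
      h₂.queue.len, r2, r3] at hu₃ ⊢
    set s₃ := (((s₂.setReg (o + 2) σ.Q.length).setReg (o + 2) (σ.Q.length + 1)).setReg (o + 4)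
      r.1).setReg (o + 5) r.2.1 with hs₃
    have h₃ : Live o S ⟨σ.Q, σ.Q.length + 1, σ.A, r.1, r.2.1⟩ ((σ, t + 1) :: fs) b s₃ :=
      ⟨h₂.outline.of_unch hu₃ (by simp [Prog.WritesReg]; omega) (by simp [Prog.WritesArr]),
        h₂.chain, h₂.queue.of_unch hu₃ (by simp [Prog.WritesArr]) (by simp [Prog.WritesReg])
        (by simp [Prog.WritesArr]), h₂.chosen, by simp [hs₃, State.setReg_reg],
        by simp [hs₃, State.setReg_reg, h₂.len], by simp [hs₃, State.setReg_reg],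
        by simp [hs₃, State.setReg_reg]⟩
    have h14 : s₃.reg (o + 14) = r.2.2 := by simp [hs₃, State.setReg_reg, r4]
    have key := wp_choose ho (by rw [h14]; exact hr.1) h₃
    rw [h14] at key
    exact wp_seq (key.mono le_rfl fun s₄ _ h₄ _ => wp_pushFrame ho (hσ.rootC hk hr) h₄)

theorem holds_of_parked {f : Node × ℕ} (h : Parked o S (f :: fs) b s) :
    (Test.lt 3 (o + 6)).Holds s := by
  rw [Test.holds_lt, h.1.base.zero, h.1.depth]; simp

/-- Searching below the node on top of the stack takes its cost and removes it from the stack. -/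
theorem wp_search_loop (ho : 40 ≤ o) (hS : S.RootsOk) (hf : Fetches o S fetch R)
    (hroots : ∀ σ, 1 ≤ σ.j → ∀ r, some r ∈ S.roots σ → 1 ≤ r.1 ∧ r.1 ≤ S.k) {E : ℕ}
    (hE : visitTime S.G S.k + 1 ≤ E) (σ : Node) (hσ : S.Ok σ) (hj : 1 ≤ σ.j ∧ σ.j ≤ S.k)
    {T : ℕ} {P : State → Prop} (h : Parked o S ((σ, 0) :: fs) b s)
    (hrest : ∀ s', Parked o S fs ((S.leaves σ).foldl (updBest S.G) b) s' →
      wp (.while (.lt 3 (o + 6)) (visit o fetch)) s' T P) :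
    wp (.while (.lt 3 (o + 6)) (visit o fetch)) s (S.cost E R σ + T) P := by
  induction σ using S.node_induction generalizing fs b s T with
  | h σ ih₁ ih₂ ih₃ =>
    rw [Search.leaves] at hrest
    rw [Search.cost]
    split_ifs at hrest ⊢ with hk hQ hn
    · refine (wp_while_true (holds_of_parked h) ((wp_visit_leaf ho hσ hk h).mono le_rfl
        fun s₁ _ h₁ _ => hrest s₁ h₁)).le (by omega)
    · have hk' : σ.A.length < S.k := by omega
      rw [List.foldl_append] at hrest
      -- The visits are treated in reverse order, since each serves as the continuation of the
      -- subtree searched before it.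
      have h3 : ∀ s', Parked o S ((σ, 2) :: fs) ((S.leaves σ.outC).foldl (updBest S.G)
          ((S.leaves (S.inC σ)).foldl (updBest S.G) b)) s' →
          wp (.while (.lt 3 (o + 6)) (visit o fetch)) s' (E + T) P := fun s' h' =>
        (wp_while_true (holds_of_parked h') ((wp_visit_item ho hσ hk' hQ h').mono le_rfl
          fun s₁ _ h₁ _ => hrest s₁ h₁)).le (by omega)
      have h2 : ∀ s', Parked o S ((σ, 1) :: fs) ((S.leaves (S.inC σ)).foldl (updBest S.G) b) s' →
          wp (.while (.lt 3 (o + 6)) (visit o fetch)) s'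
            (E + (S.cost E R σ.outC + (E + T))) P := fun s' h' =>
        (wp_while_true (holds_of_parked h') ((wp_visit_item ho hσ hk' hQ h').mono le_rfl
          fun s₁ _ h₁ _ => ih₂ hQ (hσ.outC hQ) hj h₁ h3)).le (by omega)
      refine (wp_while_true (holds_of_parked h) ((wp_visit_item ho hσ hk' hQ h).mono le_rfl
        fun s₁ _ h₁ _ => ih₁ hk' (hσ.inC hk' hQ) hj h₁ h2)).le (by omega)
    · refine (wp_while_true (holds_of_parked h) ((wp_visit_fail ho hσ (by omega) hQ hn h).mono
        le_rfl fun s₁ _ h₁ _ => hrest s₁ h₁)).le (by omega)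
    · have hk' : σ.A.length < S.k := by omega
      set c : Option (ℕ × ℕ × ℕ) → ℕ := fun o => match o with
        | none => 0
        | some r => S.cost E R (S.rootC σ r) with hc
      set lv : Option (ℕ × ℕ × ℕ) → List (List ℕ) := fun o => match o with
        | none => []
        | some r => S.leaves (S.rootC σ r) with hlv
      -- The inner induction runs over the number `m` of roots not yet requested, while `t` is the
      -- current token.
      suffices H : ∀ m t b s, t + m = (S.roots σ).length → Parked o S ((σ, t) :: fs) b s →
          (∀ s', Parked o S fs ((((S.roots σ).drop t).flatMap lv).foldl (updBest S.G) b) s' →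
            wp (.while (.lt 3 (o + 6)) (visit o fetch)) s' T P) →
          wp (.while (.lt 3 (o + 6)) (visit o fetch)) s
            ((m + 1) * (E + R σ) + (((S.roots σ).drop t).map c).sum + T) P by
        exact H _ 0 b s (zero_add _) h hrest
      intro m
      induction m with
      | zero =>
        intro t b s ht h hrest
        have hnone : (S.roots σ)[t]? = none := List.getElem?_eq_none (by omega)
        have hdrop : (S.roots σ).drop t = [] := List.drop_eq_nil_of_le (by omega)
        have key := wp_visit_root ho hS hf hσ hj hk' hQ hn h
        rw [hnone] at key
        rw [hdrop] at hrest ⊢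
        exact (wp_while_true (holds_of_parked h) (key.mono le_rfl
          fun s₁ _ h₁ _ => hrest s₁ h₁)).le (by simp; omega)
      | succ m ihm =>
        intro t b s ht h hrest
        have htl : t < (S.roots σ).length := by omega
        have hdrop := List.drop_eq_getElem_cons htl
        have hsome : (S.roots σ)[t]? = some (S.roots σ)[t] := List.getElem?_eq_getElem htl
        have key := wp_visit_root ho hS hf hσ hj hk' hQ hn h
        have hmem : (S.roots σ)[t] ∈ S.roots σ := List.getElem_mem htl
        rw [hdrop, List.flatMap_cons, List.foldl_append] at hrest
        rw [hdrop, List.map_cons, List.sum_cons]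
        rw [hsome] at key
        have hmul : (m + 1 + 1) * (E + R σ) = (m + 1) * (E + R σ) + (E + R σ) := by ring
        rcases hr : (S.roots σ)[t] with _ | r
        · rw [hr] at key hrest
          exact (wp_while_true (holds_of_parked h) (key.mono le_rfl
            fun s₁ _ h₁ _ => ihm (t + 1) b s₁ (by omega) h₁ hrest)).le (by simp [hc]; omega)
        · rw [hr] at key hrest hmem
          have hrok := hS σ hσ r hmem
          exact (wp_while_true (holds_of_parked h) (key.mono le_rfl
            fun s₁ _ h₁ _ => ih₃ hk' r (hσ.rootC hk' hrok) (hroots σ hj.1 r hmem) h₁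
              fun s₂ h₂ => ihm (t + 1) _ s₂ (by omega) h₂ hrest)).le (by simp [hc]; omega)

theorem wp_search (ho : 40 ≤ o) (hS : S.RootsOk) (hf : Fetches o S fetch R)
    (hroots : ∀ σ, 1 ≤ σ.j → ∀ r, some r ∈ S.roots σ → 1 ≤ r.1 ∧ r.1 ≤ S.k) {E : ℕ}
    (hE : visitTime S.G S.k + 1 ≤ E) (hk1 : 1 ≤ S.k) (hb : Base S.G s)
    (hk : s.reg (o + 8) = S.k)
    (hM : ∀ x, s.arr 2 x = if x ∈ S.M then 1 else 0) :
    wp (search o fetch) s (S.cost E R Node.start + E + 20) (fun s' =>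
      s'.reg (o + 9) = (bestOf S.G (S.leaves Node.start)).1 ∧
      s'.reg (o + 10) = (bestOf S.G (S.leaves Node.start)).2.length ∧
      HoldsList (s'.arr (o + 3)) (bestOf S.G (S.leaves Node.start)).2 ∧
      ∀ x, s'.arr 2 x = if x ∈ S.M then 1 else 0) := by
  have hv := visit_le S.k S.G.d
  refine wp.le (T := 8 + (7 + ((S.cost E R Node.start + 1) +
    (4 * (S.k * (S.G.d ^ 2 + 1)) + 1)))) ?_ (by rw [visitTime] at hE; omega)
  refine wp_seq (wp_eval (by simp [Prog.LoopFree]) fun hu₁ => ?_)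
  simp only [Prog.eval] at hu₁ ⊢
  set s₁ := ((((((((s.setReg (o + 1) 0).setReg (o + 2) 0).setReg (o + 3) 0).setReg (o + 4)
    1).setReg (o + 5) 0).setReg (o + 6) 0).setReg (o + 9) 0).setReg (o + 10) 0) with hs₁
  have h₁ : Live o S Node.start [] (0, []) s₁ := by
    refine ⟨⟨hb.of_unch hu₁ (by simp [Prog.WritesReg]; omega) (by simp [Prog.WritesArr]), ?_,
      trivial, ?_, ?_, ?_, HoldsList.nil⟩, trivial, ⟨HoldsList.nil, ?_, ?_⟩, HoldsList.nil,
      ?_, ?_, ?_, ?_⟩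
    · rw [hu₁.1 _ (by simp [Prog.WritesReg]), hk]
    all_goals simp [hs₁, State.setReg_reg, Node.start, hM]
  refine wp_seq ((wp_pushFrame ho Search.Ok.start h₁).mono le_rfl fun s₂ _ h₂ _ => ?_)
  refine wp_seq (wp_search_loop ho hS hf hroots hE Node.start Search.Ok.start ⟨le_rfl, hk1⟩ h₂
    fun s₃ h₃ => ?_)
  refine wp_while_false (by rw [Test.holds_lt, h₃.1.depth]; simp) fun _ => ?_
  obtain ⟨hO, τ, hτ, -, hq, -⟩ := h₃
  have hQk : τ.Q.length ≤ S.k * (S.G.d ^ 2 + 1) :=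
    hτ.Q_len.trans (Nat.mul_le_mul_right _ hτ.A_le)
  -- Register `3` holds zero, so the final truncation empties the queue and leaves only `M` marked.
  -- This is what allows the search to be nested in another one that uses the same marks.
  refine (wp_trunc (Q := []) (t := 3) (by omega) (by omega) (by omega) (by omega) hO.base.zero hq
    List.nil_prefix hτ.nodup (fun x hx => (hτ.fresh x hx).2)
    (by simp [hO.base.zero])).mono (by omega) fun s₄ hu₄ hq₄ => ?_
  have hO₄ : Outline o S [] (bestOf S.G (S.leaves Node.start)) s₄ :=
    hO.of_unch hu₄ (by simp; omega) (by simp)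
  exact ⟨hO₄.best, hO₄.best_len, hO₄.best_list, fun x => by simpa using hq₄.mark x⟩

end

end RAM

/-! ## The two searches -/

namespace RAM

open PartialVC

/-- Answer requests for roots of the search for connected sets. -/
def innerFetch : Prog :=
  .ite (.lt 67 0)
    (.load 75 2 67 ;; .ite (.eq 75 3)
      (.const 71 1 ;; .copy 72 68 ;; .copy 73 68 ;; .copy 74 67) (.const 71 2))
    (.const 71 0)

theorem innerFetch_writesReg (r : ℕ) :
    innerFetch.WritesReg r ↔ r = 75 ∨ r = 71 ∨ r = 72 ∨ r = 73 ∨ r = 74 := by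
  simp [innerFetch, Prog.WritesReg]; omega

theorem innerFetch_writesArr (a : ℕ) : ¬ innerFetch.WritesArr a := by
  simp [innerFetch, Prog.WritesArr]

/-- Roots are listed by vertex, so the token is itself the vertex to be tried and a request takes
constant time; marked vertices give the empty entries. -/
theorem fetches_innerFetch (G : ListGraph) (M : Finset ℕ) (j : ℕ) :
    Fetches 60 (innerSearch G M j) innerFetch (fun _ => 9) := by
  intro σ fs b s hσ _ _ h
  have hn : s.reg 0 = G.n := h.outline.base.n
  have h3 := h.outline.base.zero
  have hk : s.reg 68 = j := h.outline.k
  have hm : ∀ x, s.arr 2 x = if x ∈ M ∨ x ∈ σ.Q then 1 else 0 := h.queue.mark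
  have key : wp innerFetch s 9 (RootAt 60 (((innerSearch G M j).roots σ)[s.reg 67]?)) := by
    refine wp.le (wp_eval (by simp [innerFetch, Prog.LoopFree]) ?_) (le_refl 9)
    simp only [innerFetch, Prog.eval, Test.holds_lt, Test.holds_eq, hn, State.setReg_reg, hm, h3]
    by_cases ht : s.reg 67 < G.n
    · have hget : ((innerSearch G M j).roots σ)[s.reg 67]? =
          some (if s.reg 67 ∈ M ∨ s.reg 67 ∈ σ.Q then none else some (j, j, s.reg 67)) := by
        simp [innerSearch, ht]
      rw [if_pos ht, hget]
      by_cases hx : s.reg 67 ∈ M ∨ s.reg 67 ∈ σ.Q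
      · simp only [if_pos hx]
        norm_num [RootAt, State.setReg_reg]
      · simp only [if_neg hx]
        norm_num [RootAt, State.setReg_reg, hk]
    · have hget : ((innerSearch G M j).roots σ)[s.reg 67]? = none := by
        simp [innerSearch]; omega
      rw [if_neg ht, hget]
      norm_num [RootAt, State.setReg_reg]
  refine key.mono le_rfl fun s' hu h' => ⟨h.of_unch hu (fun r hr => ?_) (fun a ha => ?_), h'⟩
  · rw [innerFetch_writesReg] at hr; omega
  · exact absurd ha (innerFetch_writesArr a)

/-- Lets the queue vary while the rest of the node stays: candidates for roots are appended to it
temporarily and removed again. -/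
theorem Live.of_queue {o : ℕ} {S : Search} {σ : Node} {fs : List (Node × ℕ)} {b : ℕ × List ℕ}
    {s s' : State} {p : Prog} {Q' : List ℕ} (h : Live o S σ fs b s) (hu : Unch p s s')
    (hr : ∀ r, p.WritesReg r → r ≠ 0 ∧ r ≠ 3 ∧ r ≠ 4 ∧ ¬ (o + 1 < r ∧ r ≤ o + 10 ∧ r ≠ o + 7))
    (ha : ∀ a, p.WritesArr a → 2 ≤ a ∧ ¬ (o + 1 < a ∧ a ≤ o + 9))
    (hq : QueueAt S.M Q' (o + 1) (o + 1) s') (hc : Chain S Q' σ.A fs) :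
    Live o S ⟨Q', σ.h, σ.A, σ.j, σ.need⟩ fs b s' := by
  have hr' : ∀ r, (r = 0 ∨ r = 3 ∨ r = 4 ∨ (o + 1 < r ∧ r ≤ o + 10 ∧ r ≠ o + 7)) →
      ¬ p.WritesReg r := fun r h h' => by have := hr r h'; omega
  have ha' : ∀ a, (a ≤ 1 ∨ (o + 1 < a ∧ a ≤ o + 9)) → ¬ p.WritesArr a :=
    fun a h h' => by have := ha a h'; omega
  refine ⟨h.outline.of_unch hu ?_ ?_, hc, hq, ?_, ?_, ?_, ?_, ?_⟩
  · simp only [List.mem_cons, List.not_mem_nil, or_false]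
    exact fun r h => hr' r (by omega)
  · simp only [List.mem_cons, List.not_mem_nil, or_false]
    exact fun r h => ha' r (by omega)
  · rw [hu.2 _ (ha' _ (by omega))]; exact h.chosen
  · rw [hu.1 _ (hr' _ (by omega)), h.h]
  · rw [hu.1 _ (hr' _ (by omega)), h.len]
  · rw [hu.1 _ (hr' _ (by omega)), h.j]
  · rw [hu.1 _ (hr' _ (by omega)), h.need]

/-- Append to the queue the unmarked vertices close to the best connected set. -/
def pushBest : Prog :=
  .while (.lt 85 70) (.load 86 63 85 ;; pushN2 41 41 86 ;; .inc 85)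

/-- Go through the new vertices of the queue and pick the one whose number is the token. -/
def scan : Prog :=
  .while (.lt 85 41) (.ite (.eq 82 47)
    (.const 51 1 ;; .copy 52 80 ;; .copy 53 81 ;; .load 54 41 85) .skip ;; .inc 82 ;; .inc 85)

/-- Answer requests for roots of the search for an optimal set. -/
def outerFetch : Prog :=
  (.copy 80 44 ;; .const 82 0 ;; .copy 83 48 ;; .inc 83 ;; .const 51 0 ;; .copy 84 41 ;;
    .copy 81 43 ;; .const 85 0) ;; .while (.lt 85 44) (.inc 81 ;; .inc 85) ;;
    .while (.lt 81 83) (.copy 68 80 ;; search 60 innerFetch ;; .const 85 0 ;; pushBest ;;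
      .copy 85 84 ;; scan ;; trunc 41 41 84 ;; (.inc 80 ;; .inc 81))

@[simp] theorem pushBest_writesReg (r : ℕ) : pushBest.WritesReg r ↔
    r = 86 ∨ r = 85 ∨ r = 10 ∨ r = 11 ∨ r = 12 ∨ r = 13 ∨ r = 14 ∨ r = 15 ∨ r = 16 ∨ r = 41 := by
  simp [pushBest, Prog.WritesReg]; omega

@[simp] theorem pushBest_writesArr (a : ℕ) : pushBest.WritesArr a ↔ a = 41 ∨ a = 2 := by
  simp [pushBest, Prog.WritesArr]

@[simp] theorem scan_writesReg (r : ℕ) : scan.WritesReg r ↔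
    r = 51 ∨ r = 52 ∨ r = 53 ∨ r = 54 ∨ r = 82 ∨ r = 85 := by
  simp [scan, Prog.WritesReg]; omega

@[simp] theorem scan_writesArr (a : ℕ) : ¬ scan.WritesArr a := by
  simp [scan, Prog.WritesArr]

theorem writesReg_innerSearch {r : ℕ} (h : (search 60 innerFetch).WritesReg r) :
    (10 ≤ r ∧ r ≤ 34) ∨ (60 < r ∧ r ≤ 75) := by
  have := writesReg_search h
  rw [innerFetch_writesReg] at this
  omega

theorem writesArr_innerSearch {a : ℕ} (h : (search 60 innerFetch).WritesArr a) :
    a = 2 ∨ a = 3 ∨ (60 < a ∧ a ≤ 69) := by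
  have := writesArr_search h
  have h' := innerFetch_writesArr a
  tauto

section

variable {G : ListGraph} {M : Finset ℕ} {k : ℕ} {σ : Node} {fs : List (Node × ℕ)}
  {b : ℕ × List ℕ} {s : State}

theorem wp_pushBest {P : List ℕ} (h : Live 40 (outerSearch G M k) σ fs b s)
    (hP : HoldsList (s.arr 63) P) (hPl : s.reg 70 = P.length) (hPn : ∀ x ∈ P, x < G.n)
    (h85 : s.reg 85 = 0) :
    wp pushBest s (P.length * (24 * (G.d + 1) ^ 2 + 3) + 1)
      (Live 40 (outerSearch G M k) ⟨pushL M σ.Q (P.flatMap G.N2), σ.h, σ.A, σ.j, σ.need⟩ fs b) := by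
  refine (wp_forLt (i := 85) (c := 70) P.length (24 * (G.d + 1) ^ 2 + 2)
    (I := fun m s' => (s'.reg 85 = m ∧ s'.reg 70 = P.length) ∧ Live 40 (outerSearch G M k)
      ⟨pushL M σ.Q ((P.take m).flatMap G.N2), σ.h, σ.A, σ.j, σ.need⟩ fs b s')
    (fun m s' h => h.1) ?_ ?_).mono le_rfl fun s' _ h => by simpa using h.2
  · rintro m s' hu hm ⟨⟨h1, h2⟩, h3⟩
    change Unch pushBest s s' at hu
    refine wp.le (T := 1 + ((24 * (G.d + 1) ^ 2) + 1)) ?_ (by omega)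
    refine wp_seq ⟨1, _, .load 86 63 85 s', le_rfl, fun hu₁ => ?_⟩
    have hx : s'.arr 63 (s'.reg 85) = P.getD m 0 := by
      rw [h1, hu.2 63 (by simp), hP m hm]
    rw [hx] at hu₁ ⊢
    set s₁ := s'.setReg 86 (P.getD m 0) with hs₁
    have h₁ := h3.of_unch hu₁ (by simp [Prog.WritesReg]) (by simp [Prog.WritesArr])
    have h86 : s₁.reg 86 = P.getD m 0 := by simp [hs₁, State.setReg_reg]
    have key := wp_pushN2 (v := 86) (by omega : 40 ≤ 41) (by omega : 40 ≤ 41) (by omega) (by omega)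
      h₁.outline.base (by rw [h86]; exact hPn _ (Search.getD_mem hm)) h₁.queue
    rw [h86] at key
    refine wp_seq (key.mono le_rfl fun s₂ hu₂ hq₂ _ => ?_)
    refine ⟨1, _, .inc 85 s₂, le_rfl, ⟨?_, ?_⟩, ?_⟩
    · have : s₂.reg 85 = m := by
        rw [hu₂.1 _ (by simp), hu₁.1 _ (by simp [Prog.WritesReg]), h1]
      simp [State.setReg_reg, this]
    · have : s₂.reg 70 = P.length := by
        rw [hu₂.1 _ (by simp), hu₁.1 _ (by simp [Prog.WritesReg]), h2]
      simp [State.setReg_reg, this]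
    · have h₂ := h₁.of_queue hu₂ (by simp) (by simp) hq₂
        (h₁.chain.mono prefix_pushL List.prefix_rfl)
      have h₃ := h₂.of_unch (Exec.inc 85 s₂).unch (by simp [Prog.WritesReg])
        (by simp [Prog.WritesArr])
      rw [Search.take_succ_getD hm, List.flatMap_append, pushL_append,
        show [P.getD m 0].flatMap G.N2 = G.N2 (P.getD m 0) by simp]
      exact h₃
  · exact ⟨⟨h85, hPl⟩, by simpa using h⟩

/-- The roots for all piece sizes form one list, numbered consecutively in register `82`; `L` is its
part for smaller sizes. The answer is written when the count equals the token, and later entries do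
not disturb it. -/
theorem wp_scan {Q' D : List ℕ} {L : List (Option (ℕ × ℕ × ℕ))} (hQ' : Q' = σ.Q ++ D)
    (h : Live 40 (outerSearch G M k) ⟨Q', σ.h, σ.A, σ.j, σ.need⟩ fs b s)
    (h85 : s.reg 85 = σ.Q.length) (h82 : s.reg 82 = L.length)
    (hroot : RootAt 40 (L[s.reg 47]?) s) :
    wp scan s (D.length * 9 + 1) (fun s' => s'.reg 82 = L.length + D.length ∧
      RootAt 40 ((L ++ D.map fun u => some (s.reg 80, s.reg 81, u))[s.reg 47]?) s') := by
  set t := s.reg 47 with ht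
  set f : ℕ → Option (ℕ × ℕ × ℕ) := fun u => some (s.reg 80, s.reg 81, u) with hf
  have key := wp_while (b := .lt 85 41) (s := s) (p := .ite (.eq 82 47)
    (.const 51 1 ;; .copy 52 80 ;; .copy 53 81 ;; .load 54 41 85) .skip ;; .inc 82 ;; .inc 85)
    (Inv := fun m s' => m ≤ D.length ∧ s'.reg 85 = σ.Q.length + (D.length - m) ∧
      s'.reg 41 = Q'.length ∧ s'.reg 82 = L.length + (D.length - m) ∧
      RootAt 40 ((L ++ (D.take (D.length - m)).map f)[t]?) s') 8 ?_ ?_ D.length ?_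
  · refine key.mono (by omega) ?_
    rintro s' - ⟨-, -, -, h1, h2⟩
    exact ⟨by simpa using h1, by simpa using h2⟩
  · rintro m s' hu ⟨hm, h1, h2, h3, h4⟩
    change Unch scan s s' at hu
    have hQl : Q'.length = σ.Q.length + D.length := by rw [hQ', List.length_append]
    refine ⟨by rw [Test.holds_lt]; omega, wp_eval (by simp [Prog.LoopFree]) ?_⟩
    set i := D.length - (m + 1) with hi
    have hi' : D.length - m = i + 1 := by omega
    have hiD : i < D.length := by omega
    have h47 : s'.reg 47 = t := hu.1 _ (by simp)
    have h80 : s'.reg 80 = s.reg 80 := hu.1 _ (by simp)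
    have h81 : s'.reg 81 = s.reg 81 := hu.1 _ (by simp)
    have hx : s'.arr 41 (σ.Q.length + i) = D.getD i 0 := by
      rw [hu.2 _ (by simp), h.queue.list _ (by rw [hQ', List.length_append]; omega)]
      simp only [hQ']
      rw [List.getD_append_right _ _ _ _ (by omega), Nat.add_sub_cancel_left]
    rw [hi', Search.take_succ_getD hiD, List.map_append, ← List.append_assoc]
    set L' := L ++ (D.take i).map f with hL'
    have hL'len : L'.length = L.length + i := by
      simp [hL', List.length_take, Nat.min_eq_left hiD.le]
    simp only [Prog.eval, Test.holds_eq, h3, h47]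
    by_cases he : L.length + i = t
    · have hget : (L' ++ [D.getD i 0].map f)[t]? = some (f (D.getD i 0)) := by
        rw [← he, ← hL'len]; simp
      rw [if_pos he, hget]
      rw [← h1] at hx
      generalize D.getD i 0 = x at hx
      refine ⟨by omega, ?_, ?_, ?_, ?_⟩
      · simp [State.setReg_reg, h1]; omega
      · simp [State.setReg_reg, h2]
      · simp [State.setReg_reg, h3]; omega
      · simp [RootAt, hf, State.setReg_reg, h80, h81, hx]
    · have hget : (L' ++ [D.getD i 0].map f)[t]? = L'[t]? := by
        by_cases hlt : t < L'.length
        · rw [List.getElem?_append_left hlt]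
        · rw [List.getElem?_append_right (by omega), List.getElem?_eq_none (l := L') (by omega),
            List.getElem?_eq_none]
          simp only [List.map_cons, List.map_nil, List.length_singleton]
          omega
      rw [if_neg he, hget]
      refine ⟨by omega, ?_, ?_, ?_, ?_⟩
      · simp [State.setReg_reg, h1]; omega
      · simp [State.setReg_reg, h2]
      · simp [State.setReg_reg, h3]; omega
      · rcases hx : L'[t]? with _ | _ | r <;> rw [hx] at h4 <;>
          simpa [RootAt, State.setReg_reg] using h4
  · rintro s' ⟨-, h1, h2, -, -⟩
    rw [hQ', List.length_append] at h2
    rw [Test.holds_lt]; omega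
  · exact ⟨le_rfl, by simpa using h85, h.queue.len, by simpa using h82, by simpa using hroot⟩

/-- A bound for the number of steps of a request for a root. -/
def outerFetchTime (G : ListGraph) (k E : ℕ) (σ : Node) : ℕ :=
  12 * ((k + 1) * (G.n + 1) * E * (2 ^ (G.d ^ 2 - G.d)) ^ (k - σ.A.length))

/-- The roots of `σ` for the sizes `σ.j, …, σ.j + m - 1` of the next piece. -/
def rootsUpTo (G : ListGraph) (M : Finset ℕ) (σ : Node) (m : ℕ) : List (Option (ℕ × ℕ × ℕ)) :=
  (List.range' σ.j m).flatMap fun j =>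
    ((pushL M σ.Q ((innerBest G (M ∪ σ.Q.toFinset) j).flatMap G.N2)).drop σ.Q.length).map
      fun u => some (j, σ.A.length + j, u)

theorem rootsUpTo_succ (m : ℕ) : rootsUpTo G M σ (m + 1) = rootsUpTo G M σ m ++
    ((pushL M σ.Q ((innerBest G (M ∪ σ.Q.toFinset) (σ.j + m)).flatMap G.N2)).drop
      σ.Q.length).map fun u => some (σ.j + m, σ.A.length + (σ.j + m), u) := by
  simp [rootsUpTo, List.range'_concat]

/-- The loop invariant of `outerFetch`: the pieces of size `σ.j, …, σ.j + m - 1` are done. -/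
structure FetchState (G : ListGraph) (M : Finset ℕ) (k : ℕ) (σ : Node) (fs : List (Node × ℕ))
    (b : ℕ × List ℕ) (t m : ℕ) (s : State) : Prop where
  live : Live 40 (outerSearch G M k) σ fs b s
  tok : s.reg 47 = t
  size : s.reg 80 = σ.j + m
  need : s.reg 81 = σ.A.length + (σ.j + m)
  bound : s.reg 83 = k + 1
  start : s.reg 84 = σ.Q.length
  count : s.reg 82 = (rootsUpTo G M σ m).length
  root : RootAt 40 ((rootsUpTo G M σ m)[t]?) s

theorem wp_outerFetch_step (hd : 2 ≤ G.d) {t m E : ℕ} (hE : visitTime G k + 1 ≤ E)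
    (hσ : (outerSearch G M k).Ok σ) (hj : 1 ≤ σ.j) (hm : σ.A.length + (σ.j + m) ≤ k)
    (h : FetchState G M k σ fs b t m s) :
    wp (.copy 68 80 ;; search 60 innerFetch ;; .const 85 0 ;; pushBest ;;
      .copy 85 84 ;; scan ;; trunc 41 41 84 ;; (.inc 80 ;; .inc 81)) s
      (10 * ((G.n + 1) * E * (2 ^ (G.d ^ 2 - G.d)) ^ (k - σ.A.length)))
      (FetchState G M k σ fs b t (m + 1)) := by
  set j := σ.j + m with hjm
  set M' := M ∪ σ.Q.toFinset with hM'
  set P := innerBest G M' j with hP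
  set Q' := pushL M σ.Q (P.flatMap G.N2) with hQ'
  set D := Q'.drop σ.Q.length with hD
  set X := (2 ^ (G.d ^ 2 - G.d)) ^ (k - σ.A.length) with hX
  have hQD : Q' = σ.Q ++ D := pushL_eq_append
  have hDlen : D.length ≤ k * (G.d ^ 2 + 1) :=
    (card_candidates_le σ hσ.nodup j).trans (Nat.mul_le_mul_right _ (by omega))
  have hPlen : P.length ≤ k := length_innerBest_le.trans (by omega)
  have hQlen : σ.Q.length ≤ k * (G.d ^ 2 + 1) :=
    hσ.Q_len.trans (Nat.mul_le_mul_right _ hσ.A_le)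
  have hQ'len : Q'.length = σ.Q.length + D.length := by rw [hQD, List.length_append]
  have hcost := inner_cost_le hd M' (show 0 < j by omega) E 9
  refine wp.le (T := 1 + ((((innerSearch G M' j).cost E (fun _ => 9) Node.start + E + 20)) +
    (1 + ((P.length * (24 * (G.d + 1) ^ 2 + 3) + 1) + (1 + ((D.length * 9 + 1) +
      ((4 * Q'.length + 1) + 2))))))) ?_ ?_
  · refine wp_seq ⟨1, _, .copy 68 80 s, le_rfl, fun hu₁ => ?_⟩
    have h68 : (s.setReg 68 (s.reg 80)).reg 68 = j := by simp [State.setReg_reg, h.size, hjm]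
    set s₁ := s.setReg 68 (s.reg 80) with hs₁
    have h₁ := h.live.of_unch hu₁ (by simp [Prog.WritesReg]) (by simp [Prog.WritesArr])
    have hvis : visitTime (innerSearch G M' j).G (innerSearch G M' j).k + 1 ≤ E := by
      refine le_trans (Nat.add_le_add_right ?_ 1) hE
      simp only [visitTime, innerSearch]
      gcongr
      omega
    refine wp_seq ((wp_search (o := 60) (S := innerSearch G M' j) (by omega) innerSearch_rootsOk
      (fetches_innerFetch G M' j) (fun τ _ r hr => ?_) hvis
      (show 1 ≤ j by omega) h₁.outline.base h68
      (fun x => ?_)).mono le_rfl fun s₂ hu₂ h₂ _ => ?_)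
    · obtain ⟨v, -, -, -, rfl⟩ := mem_innerSearch_roots.1 hr
      exact ⟨by change 1 ≤ j; omega, le_rfl⟩
    -- The marks present, namely `M` and the outer queue, are exactly the forbidden set of the inner
    -- search, so nothing has to be copied.
    · rw [h₁.queue.mark]
      simp [innerSearch, hM', outerSearch]
    obtain ⟨-, hbl, hbest, hmark⟩ := h₂
    have hw₂ : ∀ r, (35 ≤ r ∧ r ≤ 60) ∨ 76 ≤ r → s₂.reg r = s₁.reg r := fun r hr =>
      hu₂.1 r fun h => by have := writesReg_innerSearch h; omega
    have hq₂ : QueueAt (outerSearch G M k).M σ.Q (40 + 1) (40 + 1) s₂ := by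
      refine ⟨?_, ?_, fun x => ?_⟩
      · rw [hu₂.2 _ fun h => by have := writesArr_innerSearch h; omega]; exact h₁.queue.list
      · rw [hw₂ _ (by omega), h₁.queue.len]
      · rw [hmark x]; simp [innerSearch, hM', outerSearch]
    have h₂ : Live 40 (outerSearch G M k) σ fs b s₂ :=
      h₁.of_queue hu₂ (fun r hr => by have := writesReg_innerSearch hr; omega)
        (fun a ha => by have := writesArr_innerSearch ha; omega) hq₂ h₁.chain
    refine wp_seq ⟨1, _, .const 85 0 s₂, le_rfl, fun hu₃ => ?_⟩
    have h85 : (s₂.setReg 85 0).reg 85 = 0 := by simp [State.setReg_reg]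
    have hbest₃ : HoldsList ((s₂.setReg 85 0).arr 63) P := hbest
    have hbl₃ : (s₂.setReg 85 0).reg 70 = P.length := by
      rw [hu₃.1 _ (by simp [Prog.WritesReg])]; exact hbl
    set s₃ := s₂.setReg 85 0 with hs₃
    have h₃ := h₂.of_unch hu₃ (by simp [Prog.WritesReg]) (by simp [Prog.WritesArr])
    refine wp_seq ((wp_pushBest h₃ hbest₃ hbl₃ (fun x hx => (innerBest_sub hx).1) h85).mono
      le_rfl fun s₄ hu₄ h₄ _ => ?_)
    have h84₄ : s₄.reg 84 = σ.Q.length := by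
      rw [hu₄.1 _ (by simp), hu₃.1 _ (by simp [Prog.WritesReg]), hw₂ _ (by omega),
        hu₁.1 _ (by simp [Prog.WritesReg]), h.start]
    refine wp_seq ⟨1, _, .copy 85 84 s₄, le_rfl, fun hu₅ => ?_⟩
    have h85₅ : (s₄.setReg 85 (s₄.reg 84)).reg 85 = σ.Q.length := by
      simp [State.setReg_reg, h84₄]
    set s₅ := s₄.setReg 85 (s₄.reg 84) with hs₅
    have h₅ := h₄.of_unch hu₅ (by simp [Prog.WritesReg]) (by simp [Prog.WritesArr])
    have hreg₅ : ∀ r, r = 47 ∨ (51 ≤ r ∧ r ≤ 54) ∨ (80 ≤ r ∧ r ≤ 84) → s₅.reg r = s.reg r := by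
      intro r hr
      rw [hu₅.1 _ (by simp [Prog.WritesReg]; omega), hu₄.1 _ (by simp; omega),
        hu₃.1 _ (by simp [Prog.WritesReg]; omega), hw₂ _ (by omega),
        hu₁.1 _ (by simp [Prog.WritesReg]; omega)]
    have hroot₅ : RootAt 40 ((rootsUpTo G M σ m)[s₅.reg 47]?) s₅ := by
      have hr := h.root
      rw [hreg₅ 47 (by omega), h.tok]
      rcases hx : (rootsUpTo G M σ m)[t]? with _ | _ | r <;> rw [hx] at hr <;>
        simp only [RootAt] at hr ⊢
      · rw [hreg₅ _ (by omega), hr]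
      · rw [hreg₅ _ (by omega), hr]
      · rw [hreg₅ _ (by omega), hreg₅ _ (by omega), hreg₅ _ (by omega), hreg₅ _ (by omega)]
        exact hr
    have key := wp_scan hQD h₅ h85₅ (by rw [hreg₅ _ (by omega), h.count]) hroot₅
    rw [hreg₅ 80 (by omega), hreg₅ 81 (by omega), hreg₅ 47 (by omega), h.size, h.need, h.tok,
      ← hjm] at key
    refine wp_seq (key.mono le_rfl fun s₆ hu₆ h₆ _ => ?_)
    obtain ⟨h82, hroot₆⟩ := h₆
    have hl₆ := h₅.of_unch hu₆ (by simp) (by simp)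
    have hreg₆ : ∀ r, r = 47 ∨ (80 ≤ r ∧ r ≤ 84 ∧ r ≠ 82) → s₆.reg r = s.reg r := by
      intro r hr
      rw [hu₆.1 _ (by simp; omega), hreg₅ _ (by omega)]
    refine wp_seq ((wp_trunc (Q := σ.Q) (by omega) (by omega) (by omega) (by omega)
      hl₆.outline.base.zero hl₆.queue prefix_pushL (nodup_pushL hσ.nodup) (fun x hx => ?_)
      (by rw [hreg₆ _ (by omega), h.start])).mono le_rfl fun s₇ hu₇ hq₇ _ => ?_)
    · rw [mem_pushL] at hx
      exact hx.elim (fun h => (hσ.fresh x h).2) fun h => h.2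
    have h₇ : Live 40 (outerSearch G M k) σ fs b s₇ :=
      hl₆.of_queue hu₇ (by simp) (by simp) hq₇ h.live.chain
    refine wp.le (wp_eval (by simp [Prog.LoopFree]) ?_) (le_refl 2)
    have hu₈ := (Exec.seq (.inc 80 s₇) (.inc 81 _)).unch
    simp only [Prog.eval]
    set s₈ := (s₇.setReg 80 (s₇.reg 80 + 1)).setReg 81 ((s₇.setReg 80 (s₇.reg 80 + 1)).reg 81 + 1)
      with hs₈
    have hreg₈ : ∀ r, r = 47 ∨ (51 ≤ r ∧ r ≤ 54) ∨ (82 ≤ r ∧ r ≤ 84) → s₈.reg r = s₆.reg r := by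
      intro r hr
      rw [hu₈.1 _ (by simp [Prog.WritesReg]; omega), hu₇.1 _ (by simp; omega)]
    have hreg₇ : ∀ r, r = 80 ∨ r = 81 → s₇.reg r = s.reg r := by
      intro r hr
      rw [hu₇.1 _ (by simp; omega), hreg₆ _ (by omega)]
    refine ⟨h₇.of_unch hu₈ (by simp [Prog.WritesReg]) (by simp [Prog.WritesArr]), ?_, ?_, ?_, ?_,
      ?_, ?_, ?_⟩
    · rw [hreg₈ _ (by omega), hreg₆ _ (by omega), h.tok]
    · simp [hs₈, State.setReg_reg, hreg₇ 80 (by omega), h.size]; omega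
    · simp [hs₈, State.setReg_reg, hreg₇ 81 (by omega), h.need]; omega
    · rw [hreg₈ _ (by omega), hreg₆ _ (by omega), h.bound]
    · rw [hreg₈ _ (by omega), hreg₆ _ (by omega), h.start]
    · rw [hreg₈ _ (by omega), h82, rootsUpTo_succ]; simp [← hjm, ← hM', ← hP, ← hQ', ← hD]
    · rw [rootsUpTo_succ]
      simp only [← hjm, ← hM', ← hP, ← hQ', ← hD]
      rcases hx : (rootsUpTo G M σ m ++ D.map fun u =>
        some (j, σ.A.length + j, u))[t]? with _ | _ | r <;> rw [hx] at hroot₆ <;>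
        simp only [RootAt] at hroot₆ ⊢
      · rw [hreg₈ _ (by omega), hroot₆]
      · rw [hreg₈ _ (by omega), hroot₆]
      · rw [hreg₈ _ (by omega), hreg₈ _ (by omega), hreg₈ _ (by omega), hreg₈ _ (by omega)]
        exact hroot₆
  -- The piece fits into the missing vertices, so `j ≤ k - |A|`; the inner search dominates, and all
  -- other contributions are bounded by multiples of `E`.
  · have hqj : (2 ^ (G.d ^ 2 - G.d)) ^ j ≤ X := Nat.pow_le_pow_right (by positivity) (by omega)
    have hX1 : 1 ≤ X := Nat.one_le_pow _ _ (by positivity)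
    set Z := (k + 1) * (G.d + 1) ^ 2 with hZ
    have hZE : 140 * Z ≤ E := by
      refine le_trans (Nat.mul_le_mul_left _ ?_) ((Nat.le_succ _).trans hE)
      rw [hZ, mul_pow]
      exact Nat.mul_le_mul (Nat.le_self_pow (by norm_num) _)
        (Nat.pow_le_pow_right (by omega) (by omega))
    have hZ1 : k * (G.d ^ 2 + 1) + 1 ≤ Z := by rw [hZ]; ring_nf; omega
    have hZ2 : P.length * (24 * (G.d + 1) ^ 2 + 3) ≤ 27 * Z := by
      calc P.length * (24 * (G.d + 1) ^ 2 + 3) ≤ (k + 1) * (27 * (G.d + 1) ^ 2) := by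
            refine Nat.mul_le_mul (by omega) ?_
            have : 1 ≤ (G.d + 1) ^ 2 := Nat.one_le_pow _ _ (by omega)
            omega
        _ = 27 * Z := by rw [hZ]; ring
    have h1 : G.n * (4 * E * (2 ^ (G.d ^ 2 - G.d)) ^ j) ≤ 4 * ((G.n + 1) * E * X) := by
      calc G.n * (4 * E * (2 ^ (G.d ^ 2 - G.d)) ^ j) ≤ (G.n + 1) * (4 * E * X) := by gcongr; omega
        _ = _ := by ring
    have h2 : (G.n + 1) * (E + 9) ≤ 2 * ((G.n + 1) * E * X) := by
      calc (G.n + 1) * (E + 9) ≤ (G.n + 1) * (2 * E * X) := by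
            refine Nat.mul_le_mul_left _ ?_
            have : 2 * E ≤ 2 * E * X := Nat.le_mul_of_pos_right _ hX1
            omega
        _ = _ := by ring
    have h3 : E ≤ (G.n + 1) * E * X := by
      calc E = 1 * E * 1 := by ring
        _ ≤ _ := by gcongr; omega
    omega

/-- Every request recomputes the list of roots and picks the entry numbered by the token. Nothing
has to be kept between requests, and the repetition costs only a factor polynomial in `k` and `d`.
-/
theorem fetches_outerFetch (hd : 2 ≤ G.d) {E : ℕ} (hE : visitTime G k + 1 ≤ E) :
    Fetches 40 (outerSearch G M k) outerFetch (outerFetchTime G k E) := by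
  intro σ fs b s hσ hj hk h
  change wp outerFetch s _ fun s' => _ ∧ RootAt 40 (((outerSearch G M k).roots σ)[s.reg 47]?) s'
  have hAk : σ.A.length < k := hk
  have hjk : σ.j ≤ k := hj.2
  set t := s.reg 47 with ht
  set X := (2 ^ (G.d ^ 2 - G.d)) ^ (k - σ.A.length) with hX
  set N := k + 1 - (σ.A.length + σ.j) with hN
  have hroots : (outerSearch G M k).roots σ = rootsUpTo G M σ N := rfl
  refine wp.le (T := 8 + ((σ.j * 3 + 1) + (N * (10 * ((G.n + 1) * E * X) + 1) + 1))) ?_ ?_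
  · refine wp_seq (wp_eval (by simp [Prog.LoopFree]) fun hu₁ => ?_)
    set s₁ := (Prog.eval (.copy 80 44 ;; .const 82 0 ;; .copy 83 48 ;; .inc 83 ;; .const 51 0 ;;
      .copy 84 41 ;; .copy 81 43 ;; .const 85 0) s) with hs₁
    have h₁ := h.of_unch hu₁ (by simp [Prog.WritesReg]) (by simp [Prog.WritesArr])
    have r80 : s₁.reg 80 = σ.j := by
      have := h.j
      simpa [hs₁, Prog.eval, State.setReg_reg] using this
    have r82 : s₁.reg 82 = 0 := by simp [hs₁, Prog.eval, State.setReg_reg]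
    have r83 : s₁.reg 83 = k + 1 := by
      have : s.reg 48 = k := h.outline.k
      simpa [hs₁, Prog.eval, State.setReg_reg] using this
    have r51 : s₁.reg 51 = 0 := by simp [hs₁, Prog.eval, State.setReg_reg]
    have r84 : s₁.reg 84 = σ.Q.length := by
      have := h.queue.len
      simpa [hs₁, Prog.eval, State.setReg_reg] using this
    have r81 : s₁.reg 81 = σ.A.length := by
      have := h.len
      simpa [hs₁, Prog.eval, State.setReg_reg] using this
    have r85 : s₁.reg 85 = 0 := by simp [hs₁, Prog.eval, State.setReg_reg]
    have r47 : s₁.reg 47 = t := hu₁.1 _ (by simp [Prog.WritesReg])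
    clear_value s₁
    refine wp_seq ((wp_forLt (s := s₁) (i := 85) (c := 44) (p := .inc 81 ;; .inc 85) σ.j 2
      (I := fun m s' => (s'.reg 85 = m ∧ s'.reg 44 = σ.j) ∧ s'.reg 81 = σ.A.length + m)
      (fun m s' h => h.1) (fun m s' _ _ h => ?_) ⟨⟨r85, h₁.j⟩, r81⟩).mono le_rfl
      fun s₂ hu₂ h₂ _ => ?_)
    · refine wp.le (wp_eval (by simp [Prog.LoopFree]) ?_) (le_refl 2)
      simp [Prog.eval, State.setReg_reg, h.1.1, h.1.2, h.2]
      omega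
    have hw₂ : ∀ r, r ≠ 81 → r ≠ 85 → s₂.reg r = s₁.reg r :=
      fun r h h' => hu₂.1 r (by simp [Prog.WritesReg]; omega)
    have hF : FetchState G M k σ fs b t 0 s₂ := by
      refine ⟨h₁.of_unch hu₂ (by simp [Prog.WritesReg]) (by simp [Prog.WritesArr]), ?_, ?_, ?_,
        ?_, ?_, ?_, ?_⟩
      · rw [hw₂ _ (by omega) (by omega), r47]
      · rw [hw₂ _ (by omega) (by omega), r80, add_zero]
      · rw [h₂.2, add_zero]
      · rw [hw₂ _ (by omega) (by omega), r83]
      · rw [hw₂ _ (by omega) (by omega), r84]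
      · rw [hw₂ _ (by omega) (by omega), r82]; simp [rootsUpTo]
      · simp only [rootsUpTo, List.range'_zero, List.flatMap_nil, List.getElem?_nil, RootAt]
        rw [hw₂ _ (by omega) (by omega), r51]
    refine (wp_while (Inv := fun m s' => m ≤ N ∧ FetchState G M k σ fs b t (N - m) s')
      (10 * ((G.n + 1) * E * X)) ?_ ?_ N ⟨le_rfl, by simpa using hF⟩).mono le_rfl ?_
    · rintro m s' - ⟨hm, hF⟩
      refine ⟨by rw [Test.holds_lt, hF.need, hF.bound]; omega,
        (wp_outerFetch_step hd hE hσ hj.1 (by omega) hF).mono le_rfl fun s'' _ h'' => ?_⟩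
      exact ⟨by omega, by rwa [show N - (m + 1) + 1 = N - m by omega] at h''⟩
    · rintro s' ⟨-, hF⟩
      rw [Test.holds_lt, hF.need, hF.bound]; omega
    · rintro s' - ⟨-, hF⟩
      rw [hroots]
      exact ⟨hF.live, by simpa using hF.root⟩
  · have hX1 : 1 ≤ X := Nat.one_le_pow _ _ (by positivity)
    have hE1 : 140 ≤ E := by
      refine le_trans ?_ ((Nat.le_succ _).trans hE)
      rw [visitTime]
      exact Nat.le_mul_of_pos_right _ (by positivity)
    set Y := (G.n + 1) * E * X with hY
    have hY1 : 140 ≤ Y := by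
      calc 140 ≤ 1 * E * 1 := by omega
        _ ≤ Y := by rw [hY]; gcongr; omega
    have h1 : N * (10 * Y + 1) ≤ (k + 1) * (10 * Y + 1) := Nat.mul_le_mul_right _ (by omega)
    have h2 : (k + 1) * 140 ≤ (k + 1) * Y := Nat.mul_le_mul_left _ hY1
    have h3 : outerFetchTime G k E σ = 12 * ((k + 1) * Y) := by rw [outerFetchTime, hY]; ring
    have h4 : (k + 1) * (10 * Y + 1) = 10 * ((k + 1) * Y) + (k + 1) := by ring
    rw [h3]
    omega

theorem outerSearch_roots_size {r : ℕ × ℕ × ℕ} (hσ : 1 ≤ σ.j)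
    (hr : some r ∈ (outerSearch G M k).roots σ) : 1 ≤ r.1 ∧ r.1 ≤ k := by
  simp only [outerSearch, List.mem_flatMap, List.mem_map, List.mem_range'_1,
    Option.some.injEq] at hr
  obtain ⟨j, hj, u, -, rfl⟩ := hr
  dsimp only
  omega

/-- A bound for the number of steps of the search for an optimal set. -/
def optTime (G : ListGraph) (M : Finset ℕ) (k : ℕ) : ℕ :=
  (outerSearch G M k).cost (visitTime G k + 1) (outerFetchTime G k (visitTime G k + 1)) Node.start +
    visitTime G k + 21

/-- Register `49` becomes the largest value of a set of `k` unmarked vertices, where `k` is in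
register `48`. -/
def optProg : Prog := search 40 outerFetch

theorem writesReg_optProg {r : ℕ} (h : optProg.WritesReg r) : 10 ≤ r ∧ r ≤ 86 := by
  by_contra hr
  have h' := writesReg_search h
  have h1 : ¬ (search 60 innerFetch).WritesReg r := fun h => by
    have := writesReg_innerSearch h; omega
  simp [outerFetch, Prog.WritesReg, h1] at h'
  omega

theorem writesArr_optProg {a : ℕ} (h : optProg.WritesArr a) : 2 ≤ a := by
  by_contra hr
  have h' := writesArr_search h
  have h1 : ¬ (search 60 innerFetch).WritesArr a := fun h => by
    have := writesArr_innerSearch h; omega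
  simp [outerFetch, Prog.WritesArr, h1] at h'
  omega

theorem wp_optProg (hd : 2 ≤ G.d) (hk1 : 1 ≤ k) (hb : Base G s) (hk : s.reg 48 = k)
    (hM : ∀ x, s.arr 2 x = if x ∈ M then 1 else 0) :
    wp optProg s (optTime G M k) (fun s' =>
      s'.reg 49 = outerBest G M k ∧ ∀ x, s'.arr 2 x = if x ∈ M then 1 else 0) := by
  refine (wp_search (o := 40) (S := outerSearch G M k) (by omega) outerSearch_rootsOk
    (fetches_outerFetch hd le_rfl) (fun σ hσ r hr => outerSearch_roots_size hσ hr) le_rfl hk1 hb hk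
    hM).mono ?_ fun s' _ h => ⟨h.1, h.2.2.2⟩
  rw [optTime]
  simp only [outerSearch]
  omega

end

end RAM

/-! ## The question in terms of traces -/

namespace PartialVC

namespace ListGraph

variable (G : ListGraph)

/-- The number of traces on `C`. -/
def numTraces (C : Finset ℕ) : ℕ := ((Finset.range G.n).image (G.trace C)).card

/-- Some set of `k` vertices has at least `l` traces. -/
def Answer (k l : ℕ) : Prop :=
  ∃ C : Finset ℕ, (∀ x ∈ C, x < G.n) ∧ C.card = k ∧ l ≤ G.numTraces C

variable {G}

theorem val_le_numTraces (C : Finset ℕ) : G.val C ≤ G.numTraces C :=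
  Finset.card_le_card (Finset.erase_subset _ _)

theorem numTraces_le (C : Finset ℕ) : G.numTraces C ≤ G.val C + 1 := by
  have := Finset.pred_card_le_card_erase (s := (Finset.range G.n).image (G.trace C)) (a := ∅)
  rw [numTraces, val, traces]
  omega

theorem numTraces_eq_val_add_one {C : Finset ℕ} {v : ℕ} (hv : v < G.n) (h : G.trace C v = ∅) :
    G.numTraces C = G.val C + 1 := by
  have hmem : ∅ ∈ (Finset.range G.n).image (G.trace C) :=
    Finset.mem_image.2 ⟨v, Finset.mem_range.2 hv, h⟩
  rw [val, traces, Finset.card_erase_of_mem hmem, numTraces]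
  have := Finset.card_pos.2 ⟨_, hmem⟩
  omega

theorem numTraces_eq_val {C : Finset ℕ} (h : ∀ v < G.n, G.trace C v ≠ ∅) :
    G.numTraces C = G.val C := by
  rw [val, traces, Finset.erase_eq_of_notMem, numTraces]
  simpa using fun v hv => h v hv

theorem exists_subset_card {k : ℕ} (hk : k ≤ G.n) :
    ∃ C : Finset ℕ, (∀ x ∈ C, x < G.n) ∧ C.card = k :=
  ⟨Finset.range k, fun _ hx => (Finset.mem_range.1 hx).trans_le hk, Finset.card_range k⟩

theorem not_answer {k l : ℕ} (h : G.n < k) : ¬ G.Answer k l := by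
  rintro ⟨C, hC, hk, -⟩
  have : C ⊆ Finset.range G.n := fun x hx => Finset.mem_range.2 (hC x hx)
  have := Finset.card_le_card this
  rw [Finset.card_range] at this
  omega

theorem answer_zero {l : ℕ} : G.Answer 0 l ↔ l ≤ 1 ∧ l ≤ G.n := by
  have h0 : G.numTraces ∅ = min 1 G.n := by
    rw [numTraces]
    have : G.trace ∅ = fun _ => ∅ := by funext v; simp [trace]
    rw [this]
    rcases Nat.eq_zero_or_pos G.n with h | h
    · simp [h]
    · rw [Finset.image_const (by simpa using h.ne'), Finset.card_singleton]; omega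
  constructor
  · rintro ⟨C, -, hC, hl⟩
    rw [Finset.card_eq_zero.1 hC, h0] at hl
    omega
  · intro h
    exact ⟨∅, by simp, rfl, by rw [h0]; omega⟩

/-- The second alternative stands for sets with an empty trace: avoiding `N[v]` gives `v` the empty
trace, which adds one class. Positivity there guarantees that a `k`-set avoiding `N[v]` exists at
all, since a failed search also returns zero. -/
theorem answer_iff {k l : ℕ} (hk : 1 ≤ k) (hkn : k ≤ G.n) :
    G.Answer k l ↔ l ≤ outerBest G ∅ k ∨ ∃ v < k * (G.d + 1) + 1, v < G.n ∧
      0 < outerBest G (G.cN v).toFinset k ∧ l ≤ outerBest G (G.cN v).toFinset k + 1 := by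
  constructor
  · rintro ⟨C, hC, hCk, hl⟩
    by_cases h : ∀ v < G.n, G.trace C v ≠ ∅
    · left
      rw [numTraces_eq_val h] at hl
      exact hl.trans (le_outerBest (fun x hx => ⟨hC x hx, by simp⟩) hCk)
    right
    push Not at h
    obtain ⟨v, hv, hvC⟩ := h
    -- Pigeonhole: `C` meets at most `k * (d + 1)` closed neighborhoods, so a missed one occurs
    -- among the first `k * (d + 1) + 1` vertices.
    obtain ⟨w, hw, hwn, hwC⟩ : ∃ w < k * (G.d + 1) + 1, w < G.n ∧ G.trace C w = ∅ := by
      by_cases hvk : v < k * (G.d + 1) + 1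
      · exact ⟨v, hvk, hv, hvC⟩
      have hcard : (C.biUnion fun c => (G.cN c).toFinset).card < (Finset.range
          (k * (G.d + 1) + 1)).card := by
        rw [Finset.card_range, Nat.lt_succ_iff, ← hCk]
        exact Finset.card_biUnion_le_card_mul _ _ _ fun c _ =>
          ((G.cN c).toFinset_card_le).trans (G.length_cN_le c)
      obtain ⟨w, hw, hwC⟩ := Finset.exists_mem_notMem_of_card_lt_card hcard
      rw [Finset.mem_range] at hw
      refine ⟨w, hw, by omega, Finset.eq_empty_of_forall_notMem fun c hc => hwC ?_⟩
      rw [mem_trace] at hc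
      exact Finset.mem_biUnion.2 ⟨c, hc.1, by simpa using G.cN_symm hc.2⟩
    have hle : G.val C ≤ outerBest G (G.cN w).toFinset k := by
      refine le_outerBest (fun x hx => ⟨hC x hx, fun h => ?_⟩) hCk
      have : x ∈ G.trace C w := G.mem_trace.2 ⟨hx, by simpa using h⟩
      rw [hwC] at this
      simp at this
    obtain ⟨c, hc⟩ : C.Nonempty := Finset.card_pos.1 (by omega)
    have hpos := G.val_pos hc (hC c hc)
    have := numTraces_le (G := G) C
    exact ⟨w, hw, hwn, by omega, by omega⟩
  · rintro (h | ⟨v, -, hv, h1, h2⟩)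
    -- If the maximum is zero then `l = 0`, and any `k`-set will do.
    · rcases Nat.eq_zero_or_pos (outerBest G ∅ k) with h0 | h0
      · obtain ⟨C, hC, hCk⟩ := exists_subset_card hkn
        exact ⟨C, hC, hCk, by omega⟩
      · obtain ⟨C, hC, hCk, hval⟩ := exists_of_outerBest_pos h0
        exact ⟨C, fun x hx => (hC x hx).1, hCk, (h.trans hval.ge).trans (val_le_numTraces C)⟩
    · obtain ⟨C, hC, hCk, hval⟩ := exists_of_outerBest_pos h1
      refine ⟨C, fun x hx => (hC x hx).1, hCk, ?_⟩
      rw [numTraces_eq_val_add_one hv, hval]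
      · exact h2
      · refine Finset.eq_empty_of_forall_notMem fun c hc => ?_
        rw [mem_trace] at hc
        exact (hC c hc.1).2 (by simpa using hc.2)

variable (G) in
/-- The vertices that are the least elements of their closed neighborhoods. -/
def reps : Finset ℕ := (Finset.range G.n).filter fun v => ∀ w ∈ G.cN v, v ≤ w

/-- The edges form a matching, so the closed neighborhoods partition the vertices and are shared by
all their elements. -/
theorem mem_cN_congr (hd : G.d ≤ 1) {v w : ℕ} (h : w ∈ G.cN v) (x : ℕ) :
    x ∈ G.cN v ↔ x ∈ G.cN w := by
  have key : ∀ a b, b ∈ G.nb a → G.nb a = [b] := by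
    intro a b hb
    have := G.length_le a
    obtain ⟨c, hc⟩ : ∃ c, G.nb a = [c] := by
      rw [← List.length_eq_one_iff]
      have := List.length_pos_of_mem hb
      omega
    rw [hc] at hb ⊢
    rw [List.mem_singleton] at hb
    rw [hb]
  rcases G.mem_cN.1 h with rfl | h
  · rfl
  · rw [mem_cN, mem_cN, key v w h, key w v (G.symm _ _ h)]
    simp [or_comm]

theorem trace_congr (hd : G.d ≤ 1) {v w : ℕ} (h : w ∈ G.cN v) (C : Finset ℕ) :
    G.trace C v = G.trace C w := by
  ext x
  rw [mem_trace, mem_trace, mem_cN_congr hd h]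

theorem eq_of_mem_reps {v w : ℕ} (hv : v ∈ G.reps) (hw : w ∈ G.reps)
    (h : w ∈ G.cN v) : v = w := by
  simp only [reps, Finset.mem_filter] at hv hw
  exact le_antisymm (hv.2 w h) (hw.2 v (G.cN_symm h))

/-- The closed neighborhoods are blocks of a partition, with `reps` as representatives. There are no
more traces than blocks, and no more than `k` nonempty ones. Conversely `l` blocks are separated by
representatives of `l - 1` of them, which can be completed to `k` vertices. -/
theorem answer_iff_of_d_le_one (hd : G.d ≤ 1) {k l : ℕ} (hkn : k ≤ G.n) :
    G.Answer k l ↔ l ≤ k + 1 ∧ l ≤ G.reps.card := by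
  constructor
  · rintro ⟨C, hC, hCk, hl⟩
    constructor
    · have h1 := numTraces_le (G := G) C
      have h2 : G.traces C ⊆ C.image (G.trace C) := by
        intro t ht
        obtain ⟨hne, v, hv, rfl⟩ := G.mem_traces.1 ht
        obtain ⟨c, hc⟩ := Finset.nonempty_iff_ne_empty.2 hne
        rw [mem_trace] at hc
        exact Finset.mem_image.2 ⟨c, hc.1, (trace_congr hd hc.2 C).symm⟩
      have h3 : G.val C ≤ k := hCk ▸ (Finset.card_le_card h2).trans Finset.card_image_le
      omega
    · refine hl.trans (le_trans (Finset.card_le_card ?_)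
        (Finset.card_image_le (s := G.reps) (f := G.trace C)))
      intro t ht
      obtain ⟨v, hv, rfl⟩ := Finset.mem_image.1 ht
      rw [Finset.mem_range] at hv
      obtain ⟨w, hw, hmin⟩ := Finset.exists_min_image (G.cN v).toFinset id
        ⟨v, by simpa using G.self_mem_cN v⟩
      rw [List.mem_toFinset] at hw
      refine Finset.mem_image.2 ⟨w, ?_, (trace_congr hd hw C).symm⟩
      simp only [reps, Finset.mem_filter, Finset.mem_range]
      refine ⟨G.cN_lt hv hw, fun x hx => hmin x ?_⟩
      rw [List.mem_toFinset, mem_cN_congr hd hw]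
      exact hx
  · rintro ⟨h1, h2⟩
    obtain ⟨T, hT, hTl⟩ := Finset.exists_subset_card_eq h2
    have hreps : ∀ x ∈ G.reps, x < G.n := fun x hx => by
      simp only [reps, Finset.mem_filter, Finset.mem_range] at hx; exact hx.1
    rcases T.eq_empty_or_nonempty with rfl | ⟨t₀, ht₀⟩
    · obtain ⟨C, hC, hCk⟩ := exists_subset_card hkn
      exact ⟨C, hC, hCk, by rw [← hTl]; simp⟩
    -- One representative, `t₀`, need not be chosen: the traces of all others contain their own
    -- representatives, which already distinguishes them from each other and from that of `t₀`.
    have hsub : T.erase t₀ ⊆ Finset.range G.n := fun x hx =>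
      Finset.mem_range.2 (hreps x (hT (Finset.mem_of_mem_erase hx)))
    obtain ⟨C, hC1, hC2, hCk⟩ := Finset.exists_subsuperset_card_eq hsub
      (n := k) (by rw [Finset.card_erase_of_mem ht₀]; omega) (by simpa using hkn)
    refine ⟨C, fun x hx => Finset.mem_range.1 (hC2 hx), hCk, ?_⟩
    have hinj : Set.InjOn (G.trace C) T := by
      have key : ∀ x ∈ T, ∀ y ∈ T, x ≠ t₀ → G.trace C x = G.trace C y → x = y := by
        intro x hx y hy hne h
        have hxt : x ∈ G.trace C x :=
          G.mem_trace.2 ⟨hC1 (Finset.mem_erase.2 ⟨hne, hx⟩), G.self_mem_cN x⟩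
        rw [h, mem_trace] at hxt
        exact (eq_of_mem_reps (hT hy) (hT hx) hxt.2).symm
      intro x hx y hy h
      by_cases hx0 : x = t₀
      · by_cases hy0 : y = t₀
        · rw [hx0, hy0]
        · exact (key y hy x hx hy0 h.symm).symm
      · exact key x hx y hy hx0 h
    rw [← hTl, ← Finset.card_image_of_injOn hinj]
    refine Finset.card_le_card fun t ht => ?_
    obtain ⟨x, hx, rfl⟩ := Finset.mem_image.1 ht
    exact Finset.mem_image.2 ⟨x, Finset.mem_range.2 (hreps x (hT hx)), rfl⟩

end ListGraph

/-! ## Instances as lists -/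

theorem getD_flatten_ofFn {n : ℕ} (f : Fin n → List ℕ) (v : Fin n) {i : ℕ}
    (hi : i < (f v).length) :
    (List.ofFn f).flatten.getD ((∑ w : Fin n, if (w : ℕ) < v then (f w).length else 0) + i) 0 =
      (f v).getD i 0 := by
  induction n with
  | zero => exact v.elim0
  | succ n ih =>
    rw [List.ofFn_succ, List.flatten_cons, Fin.sum_univ_succ]
    cases v using Fin.cases with
    | zero =>
      simp only [Fin.val_zero, lt_irrefl, if_false, Nat.not_lt_zero, Finset.sum_const_zero,
        zero_add]
      rw [List.getD_append _ _ _ _ hi]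
    | succ v =>
      have h := ih (fun w => f w.succ) v hi
      simp only [Fin.val_zero, Fin.val_succ, Nat.succ_pos, if_true, Nat.add_lt_add_iff_right]
      rw [List.getD_append_right _ _ _ _ (by omega), ← h]
      congr 1
      omega

namespace GraphInstance

variable (I : GraphInstance)

theorem length_adj (v : Fin I.n) :
    (I.adj v).length = (open Classical in I.G.degree v) := by
  classical
  rw [← List.toFinset_card_of_nodup (I.nodup_adj v), ← SimpleGraph.card_neighborFinset_eq_degree]
  congr 1
  · ext w
    simp [I.mem_adj]

/-- The graph of the instance. -/
noncomputable def listGraph : ListGraph where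
  n := I.n
  d := I.Δ
  nb v := if h : v < I.n then (I.adj ⟨v, h⟩).map Fin.val else []
  nb_lt v w hw := by
    split_ifs at hw with h
    · obtain ⟨x, -, rfl⟩ := List.mem_map.1 hw
      exact x.2
    · simp at hw
  symm v w hw := by
    split_ifs at hw with h
    · obtain ⟨x, hx, rfl⟩ := List.mem_map.1 hw
      rw [dif_pos x.2]
      rw [I.mem_adj] at hx
      exact List.mem_map.2 ⟨⟨v, h⟩, (I.mem_adj _ _).2 hx.symm, rfl⟩
    · simp at hw
  irrefl v hv := by
    split_ifs at hv with h
    · obtain ⟨x, hx, hxv⟩ := List.mem_map.1 hv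
      rw [I.mem_adj] at hx
      exact hx.ne (Fin.ext hxv.symm)
    · simp at hv
  nodup v := by
    split_ifs with h
    · exact (I.nodup_adj _).map Fin.val_injective
    · simp
  length_le v := by
    split_ifs with h
    · rw [List.length_map, length_adj]
      classical
      exact I.G.degree_le_maxDegree _
    · simp

theorem listGraph_nb (v : Fin I.n) : I.listGraph.nb v = (I.adj v).map Fin.val := by
  simp [listGraph]

theorem mem_cN_listGraph {v w : Fin I.n} :
    (w : ℕ) ∈ I.listGraph.cN v ↔ w ∈ closedNbhd I.G v := by
  rw [ListGraph.mem_cN, listGraph_nb]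
  simp only [closedNbhd, Set.mem_insert_iff, SimpleGraph.mem_neighborSet, Fin.ext_iff,
    List.mem_map, I.mem_adj]
  exact or_congr_right ⟨fun ⟨a, ha, h⟩ => Fin.ext h ▸ ha, fun h => ⟨w, h, rfl⟩⟩

/-- The maximum degree is not part of the input; as it is attained, the machine can find it as the
largest length of a list. -/
theorem exists_length_nb (h : 0 < I.n) : ∃ v < I.n, (I.listGraph.nb v).length = I.listGraph.d := by
  classical
  have : Nonempty (Fin I.n) := ⟨⟨0, h⟩⟩
  obtain ⟨v, hv⟩ := I.G.exists_maximal_degree_vertex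
  refine ⟨v, v.2, ?_⟩
  rw [listGraph_nb, List.length_map, length_adj]
  change _ = I.Δ
  rw [Δ]
  convert hv.symm

theorem storedIn_init : I.listGraph.StoredIn (I.init.arr 0) (I.init.arr 1) := by
  intro v hv
  have hv' : v < I.n := hv
  have hnb : I.listGraph.nb v = (I.adj ⟨v, hv'⟩).map Fin.val := I.listGraph_nb ⟨v, hv'⟩
  constructor
  · simp only [init, if_true, if_pos (show v + 1 ≤ I.n from hv'), if_pos hv'.le]
    rw [hnb, List.length_map, offset, offset]
    have : (I.adj ⟨v, hv'⟩).length =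
        ∑ w : Fin I.n, if w = ⟨v, hv'⟩ then (I.adj w).length else 0 := by simp
    rw [this, ← Finset.sum_add_distrib]
    refine Finset.sum_congr rfl fun w _ => ?_
    have hw : w = ⟨v, hv'⟩ ↔ (w : ℕ) = v := Fin.ext_iff
    simp only [hw]
    split_ifs <;> omega
  · intro i hi
    simp only [init, if_true, if_pos hv'.le, one_ne_zero, if_false]
    rw [hnb] at hi ⊢
    have := getD_flatten_ofFn (fun w => (I.adj w).map Fin.val) ⟨v, hv'⟩ hi
    simp only [List.length_map] at this
    exact this

/-- The classes are the fibres of `e ↦ e ∩ C`, so they correspond to distinct intersections.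
Counting over vertices instead of hyperedges changes nothing, even when several vertices share a
closed neighborhood. -/
theorem numClasses_eq (C : Finset (Fin I.n)) :
    numClasses (nbhdHypergraph I.G) (C : Set (Fin I.n)) =
      I.listGraph.numTraces (C.map Fin.valEmbedding) := by
  set f : (nbhdHypergraph I.G).edgeSet → Set (Fin I.n) := fun e => (e : Set (Fin I.n)) ∩ C with hf
  have h1 : numClasses (nbhdHypergraph I.G) (C : Set (Fin I.n)) = (Set.range f).ncard := by
    rw [numClasses]
    exact Nat.card_congr (Setoid.quotientKerEquivRange f)
  have h2 : Set.range f = Set.range fun v => closedNbhd I.G v ∩ C := by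
    ext t
    constructor
    · rintro ⟨⟨e, v, rfl⟩, rfl⟩
      exact ⟨v, rfl⟩
    · rintro ⟨v, rfl⟩
      exact ⟨⟨_, v, rfl⟩, rfl⟩
  have h3 : ∀ v : Fin I.n, (I.listGraph.trace (C.map Fin.valEmbedding) v : Set ℕ) =
      Fin.val '' (closedNbhd I.G v ∩ C) := by
    intro v
    ext x
    simp only [Finset.mem_coe, ListGraph.mem_trace, Finset.mem_map, Fin.valEmbedding_apply,
      Set.mem_image, Set.mem_inter_iff]
    constructor
    · rintro ⟨⟨w, hw, rfl⟩, hx⟩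
      exact ⟨w, ⟨I.mem_cN_listGraph.1 hx, hw⟩, rfl⟩
    · rintro ⟨w, ⟨hw, hwC⟩, rfl⟩
      exact ⟨⟨w, hwC, rfl⟩, I.mem_cN_listGraph.2 hw⟩
  rw [h1, h2, ← Set.ncard_image_of_injective _ (Set.image_injective.2 Fin.val_injective),
    ListGraph.numTraces, ← Set.ncard_coe_finset,
    ← Set.ncard_image_of_injective _ Finset.coe_injective]
  congr 1
  ext t
  constructor
  · rintro ⟨_, ⟨v, rfl⟩, rfl⟩
    exact ⟨_, Finset.mem_coe.2 (Finset.mem_image.2 ⟨v, Finset.mem_range.2 v.2, rfl⟩), h3 v⟩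
  · rintro ⟨_, ht, rfl⟩
    obtain ⟨v, hv, rfl⟩ := Finset.mem_image.1 (Finset.mem_coe.1 ht)
    exact ⟨_, ⟨⟨v, Finset.mem_range.1 hv⟩, rfl⟩, (h3 ⟨v, Finset.mem_range.1 hv⟩).symm⟩

theorem yes_iff : I.Yes ↔ I.listGraph.Answer I.k I.l := by
  constructor
  · rintro ⟨C, -, hk, hl⟩
    refine ⟨C.map Fin.valEmbedding, fun x hx => ?_, by simpa using hk, ?_⟩
    · obtain ⟨y, -, rfl⟩ := Finset.mem_map.1 hx
      exact y.2
    · rwa [← numClasses_eq]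
  · rintro ⟨C, hC', hk, hl⟩
    have hC : ∀ x ∈ C, x < I.n := hC'
    have hmap : (C.attachFin hC).map Fin.valEmbedding = C := Finset.map_valEmbedding_attachFin hC
    refine ⟨C.attachFin hC, Set.subset_univ _, by simpa using hk, ?_⟩
    rw [numClasses_eq, hmap]
    exact hl

end GraphInstance

end PartialVC

/-! ## The whole program -/

namespace RAM

open PartialVC

/-- Register `6` becomes one more than the maximum degree. -/
def degProg : Prog :=
  (.const 6 0 ;; .const 7 0) ;; .while (.lt 7 0) (.const 8 0 ;; forN 7 10 11 12 (.inc 8) ;;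
    (.ite (.lt 6 8) (.copy 6 8) .skip ;; .inc 7))

/-- Register `9` becomes the number of vertices that are least in their closed neighborhoods. -/
def countReps : Prog :=
  (.const 7 0 ;; .const 9 0) ;; .while (.lt 7 0) (.const 8 1 ;;
    forN 7 10 11 12 (.ite (.lt 10 7) (.const 8 0) .skip) ;;
    (.ite (.eq 8 4) (.inc 9) .skip ;; .inc 7))

/-- The answer if the maximum degree is at most one. -/
def smallProg : Prog :=
  countReps ;; (.copy 8 1 ;; .inc 8 ;; .ite (.lt 8 2) .skip (.ite (.lt 9 2) .skip (.const 5 1)))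

/-- Increase register `8` by the product of the registers `1` and `6`. -/
def addProduct : Prog :=
  .const 87 0 ;; .while (.lt 87 1) (.const 88 0 ;; .while (.lt 88 6) (.inc 8 ;; .inc 88) ;; .inc 87)

/-- Search for sets that do not meet the closed neighborhood of the vertex in register `9`. -/
def tryVertex : Prog :=
  forN 9 10 11 12 (.store 2 10 4) ;; .copy 48 1 ;; optProg ;;
    .ite (.eq 49 3) .skip (.inc 49 ;; .ite (.lt 49 2) .skip (.const 5 1)) ;;
    forN 9 10 11 12 (.store 2 10 3)

/-- The answer if the maximum degree is at least two. -/
def largeProg : Prog :=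
  .copy 48 1 ;; optProg ;; .ite (.lt 49 2)
    (.const 8 1 ;; addProduct ;; .const 9 0 ;;
      .while (.lt 9 8) (.ite (.lt 9 0) tryVertex .skip ;; .inc 9))
    (.const 5 1)

/-- The program for Partial VC Dimension. -/
def mainProg : Prog :=
  (.const 4 1 ;; .const 5 0) ;; .ite (.lt 0 1) .skip (.ite (.eq 1 3)
    (.ite (.lt 4 2) .skip (.ite (.lt 0 2) .skip (.const 5 1)))
    (degProg ;; .const 7 2 ;; .ite (.lt 7 6) largeProg smallProg)) ;; .copy 0 5

theorem degProg_writesReg (r : ℕ) : degProg.WritesReg r ↔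
    r = 6 ∨ r = 7 ∨ r = 8 ∨ r = 10 ∨ r = 11 ∨ r = 12 := by
  simp [degProg, Prog.WritesReg]; omega

theorem degProg_writesArr (a : ℕ) : ¬ degProg.WritesArr a := by
  simp [degProg, Prog.WritesArr]

theorem countReps_writesReg (r : ℕ) : countReps.WritesReg r ↔
    r = 7 ∨ r = 8 ∨ r = 9 ∨ r = 10 ∨ r = 11 ∨ r = 12 := by
  simp [countReps, Prog.WritesReg]; omega

theorem addProduct_writesReg (r : ℕ) : addProduct.WritesReg r ↔ r = 8 ∨ r = 87 ∨ r = 88 := by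
  simp [addProduct, Prog.WritesReg]; omega

theorem addProduct_writesArr (a : ℕ) : ¬ addProduct.WritesArr a := by
  simp [addProduct, Prog.WritesArr]

section

variable {G : ListGraph} {s : State}

theorem wp_degProg (hb : Base G s) (hmax : ∃ v < G.n, (G.nb v).length = G.d) :
    wp degProg s (20 * ((G.n + 1) * (G.d + 1))) (fun s' => s'.reg 6 = G.d + 1) := by
  refine wp.le (T := 2 + (G.n * ((1 + (((G.d + 1) * (1 + 3) + 6) + 4)) + 1) + 1)) ?_
    (by ring_nf; omega)
  refine wp_seq (wp_eval (by simp [Prog.LoopFree]) fun hu₁ => ?_)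
  simp only [Prog.eval] at hu₁ ⊢
  set s₁ := (s.setReg 6 0).setReg 7 0 with hs₁
  have hb₁ : Base G s₁ := hb.of_unch hu₁ (by simp [Prog.WritesReg]) (by simp [Prog.WritesArr])
  refine (wp_forLt (i := 7) (c := 0) G.n _ (I := fun m s' => (s'.reg 7 = m ∧ s'.reg 0 = G.n) ∧
    s'.reg 6 = (Finset.range m).sup fun v => (G.cN v).length) (fun m s' h => h.1) ?_ ?_).mono
    le_rfl fun s' _ h => ?_
  · rintro m s' hu hm ⟨⟨h1, h2⟩, h3⟩
    have hb' : Base G s' := hb₁.of_unch hu (by simp [Prog.WritesReg]) (by simp [Prog.WritesArr])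
    refine wp_seq ⟨1, _, .const 8 0 s', le_rfl, fun hu₂ => ?_⟩
    have h8 : (s'.setReg 8 0).reg 8 = 0 := by simp [State.setReg_reg]
    set s₂ := s'.setReg 8 0 with hs₂
    have hb₂ : Base G s₂ := hb'.of_unch hu₂ (by simp [Prog.WritesReg]) (by simp [Prog.WritesArr])
    have h7 : s₂.reg 7 = m := by rw [hu₂.1 _ (by simp [Prog.WritesReg]), h1]
    have key := wp_forN G (v := 7) (w := 10) (e := 11) (f := 12) (body := .inc 8) (s := s₂) 1
      (I := fun pre s'' => s''.reg 8 = pre.length) (by rw [h7]; exact hm) hb₂.stored (by omega)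
      (by simp [Prog.WritesReg, Prog.WritesArr]) (fun pre s'' r x hr h => by
        rw [State.setReg_reg, if_neg (by omega)]; exact h)
      (fun pre x _ s'' _ h _ => ⟨1, _, .inc 8 s'', le_rfl, by simp [State.setReg_reg, h]⟩) h8
    rw [h7] at key
    refine wp_seq (key.mono le_rfl fun s₃ hu₃ h₃ _ => ?_)
    have h6 : s₃.reg 6 = (Finset.range m).sup fun v => (G.cN v).length := by
      rw [hu₃.1 _ (by simp [Prog.WritesReg]), hu₂.1 _ (by simp [Prog.WritesReg]), h3]
    have h7' : s₃.reg 7 = m := by rw [hu₃.1 _ (by simp [Prog.WritesReg]), h7]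
    have h0 : s₃.reg 0 = G.n := by
      rw [hu₃.1 _ (by simp [Prog.WritesReg]), hu₂.1 _ (by simp [Prog.WritesReg]), h2]
    refine wp.le (wp_eval (by simp [Prog.LoopFree]) ?_) (le_refl 4)
    simp only [Prog.eval, Test.holds_lt, h₃, h6]
    rw [Finset.range_add_one, Finset.sup_insert]
    split_ifs with hlt
    · refine ⟨by simp [State.setReg_reg, h7', h0], ?_⟩
      rw [sup_eq_left.2 hlt.le]
      simp [State.setReg_reg]
    · refine ⟨by simp [State.setReg_reg, h7', h0], ?_⟩
      rw [sup_eq_right.2 (not_lt.1 hlt)]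
      simp [State.setReg_reg, h6]
  · exact ⟨⟨by simp [hs₁, State.setReg_reg], hb₁.n⟩, by simp [hs₁, State.setReg_reg]⟩
  · rw [h.2]
    obtain ⟨v, hv, hvd⟩ := hmax
    refine le_antisymm (Finset.sup_le fun w _ => G.length_cN_le w) ?_
    refine le_trans ?_ (Finset.le_sup (Finset.mem_range.2 hv))
    simp [ListGraph.cN, hvd]

theorem wp_countReps (hb : Base G s) :
    wp countReps s (20 * ((G.n + 1) * (G.d + 1))) (fun s' => s'.reg 9 = G.reps.card) := by
  refine wp.le (T := 2 + (G.n * ((1 + (((G.d + 1) * (3 + 3) + 6) + 4)) + 1) + 1)) ?_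
    (by ring_nf; omega)
  refine wp_seq (wp_eval (by simp [Prog.LoopFree]) fun hu₁ => ?_)
  simp only [Prog.eval] at hu₁ ⊢
  set s₁ := (s.setReg 7 0).setReg 9 0 with hs₁
  have hb₁ : Base G s₁ := hb.of_unch hu₁ (by simp [Prog.WritesReg]) (by simp [Prog.WritesArr])
  refine (wp_forLt (i := 7) (c := 0) G.n _ (I := fun m s' => (s'.reg 7 = m ∧ s'.reg 0 = G.n) ∧
    s'.reg 9 = ((Finset.range m).filter fun v => ∀ w ∈ G.cN v, v ≤ w).card)
    (fun m s' h => h.1) ?_ ?_).mono le_rfl fun s' _ h => h.2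
  · rintro m s' hu hm ⟨⟨h1, h2⟩, h3⟩
    have hb' : Base G s' := hb₁.of_unch hu (by simp [Prog.WritesReg]) (by simp [Prog.WritesArr])
    refine wp_seq ⟨1, _, .const 8 1 s', le_rfl, fun hu₂ => ?_⟩
    have h8 : (s'.setReg 8 1).reg 8 = 1 := by simp [State.setReg_reg]
    set s₂ := s'.setReg 8 1 with hs₂
    have hb₂ : Base G s₂ := hb'.of_unch hu₂ (by simp [Prog.WritesReg]) (by simp [Prog.WritesArr])
    have h7 : s₂.reg 7 = m := by rw [hu₂.1 _ (by simp [Prog.WritesReg]), h1]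
    have key := wp_forN G (v := 7) (w := 10) (e := 11) (f := 12)
      (body := .ite (.lt 10 7) (.const 8 0) .skip) (s := s₂) 3
      (I := fun pre s'' => s''.reg 8 = if ∀ w ∈ pre, m ≤ w then 1 else 0)
      (by rw [h7]; exact hm) hb₂.stored (by omega)
      (by simp [Prog.WritesReg, Prog.WritesArr]) (fun pre s'' r x hr h => by
        rw [State.setReg_reg, if_neg (by omega)]; exact h)
      (fun pre x _ s'' hu'' h hx => ?_) (by simpa using h8)
    swap
    · refine wp.le (wp_eval (by simp [Prog.LoopFree]) ?_) (le_refl 3)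
      have h7'' : s''.reg 7 = m := by rw [hu''.1 _ (by simp [Prog.WritesReg]), h7]
      simp only [Prog.eval, Test.holds_lt, hx, h7'']
      by_cases hlt : x < m
      · rw [if_pos hlt, if_neg fun h => absurd (h x (by simp)) (by omega)]
        simp [State.setReg_reg]
      · rw [if_neg hlt, h]
        congr 1
        simp only [List.mem_append, List.mem_singleton, eq_iff_iff]
        exact ⟨fun h w hw => hw.elim (h w) fun hw => by omega, fun h w hw => h w (Or.inl hw)⟩
    rw [h7] at key
    refine wp_seq (key.mono le_rfl fun s₃ hu₃ h₃ _ => ?_)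
    have h9 : s₃.reg 9 = s'.reg 9 := by
      rw [hu₃.1 _ (by simp [Prog.WritesReg]), hu₂.1 _ (by simp [Prog.WritesReg])]
    have h7' : s₃.reg 7 = m := by rw [hu₃.1 _ (by simp [Prog.WritesReg]), h7]
    have h0 : s₃.reg 0 = G.n := by
      rw [hu₃.1 _ (by simp [Prog.WritesReg]), hu₂.1 _ (by simp [Prog.WritesReg]), h2]
    have h4 : s₃.reg 4 = 1 := by rw [hu₃.1 _ (by simp [Prog.WritesReg]), hb₂.one]
    refine wp.le (wp_eval (by simp [Prog.LoopFree]) ?_) (le_refl 4)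
    simp only [Prog.eval, Test.holds_eq, h₃, h4]
    rw [Finset.range_add_one, Finset.filter_insert]
    by_cases hm' : ∀ w ∈ G.cN m, m ≤ w
    · rw [if_pos (by rw [if_pos hm']), if_pos hm', Finset.card_insert_of_notMem (by simp), ← h3]
      simp [State.setReg_reg, h7', h0, h9]
    · rw [if_neg (by rw [if_neg hm']; norm_num), if_neg hm', ← h3]
      simp [State.setReg_reg, h7', h0, h9]
  · exact ⟨⟨by simp [hs₁, State.setReg_reg], by simpa [hs₁, State.setReg_reg] using hb₁.n⟩,
      by simp [hs₁, State.setReg_reg]⟩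

open Classical in
theorem wp_smallProg {k l : ℕ} (hb : Base G s) (hd : G.d ≤ 1) (hkn : k ≤ G.n) (hk : s.reg 1 = k)
    (hl : s.reg 2 = l) (h5 : s.reg 5 = 0) :
    wp smallProg s (20 * ((G.n + 1) * (G.d + 1)) + 7)
      (fun s' => s'.reg 5 = if G.Answer k l then 1 else 0) := by
  refine wp_seq ((wp_countReps hb).mono le_rfl fun s₁ hu₁ h9 _ => ?_)
  have h1 : s₁.reg 1 = k := by rw [hu₁.1 _ (by simp [countReps_writesReg]), hk]
  have h2 : s₁.reg 2 = l := by rw [hu₁.1 _ (by simp [countReps_writesReg]), hl]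
  have h5' : s₁.reg 5 = 0 := by rw [hu₁.1 _ (by simp [countReps_writesReg]), h5]
  refine wp.le (wp_eval (by simp [Prog.LoopFree]) ?_) (le_refl 7)
  simp only [G.answer_iff_of_d_le_one hd hkn]
  simp only [Prog.eval, Test.holds_lt, State.setReg_reg]
  norm_num
  rw [h1, h2, h9]
  split_ifs <;> first | omega | (simp [State.setReg_reg, h5'])

/-- The machine cannot multiply; the number of vertices to be tried is produced by nested
increments. -/
theorem wp_addProduct {k d c : ℕ} (h1 : s.reg 1 = k) (h6 : s.reg 6 = d) (h8 : s.reg 8 = c) :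
    wp addProduct s (k * (3 * d + 4) + 2) (fun s' => s'.reg 8 = c + k * d) := by
  refine wp.le (T := 1 + (k * ((1 + ((d * (2 + 1) + 1) + 1)) + 1) + 1)) ?_ (by ring_nf; omega)
  refine wp_seq ⟨1, _, .const 87 0 s, le_rfl, fun hu₁ => ?_⟩
  refine (wp_forLt (i := 87) (c := 1) k _ (I := fun m s' => (s'.reg 87 = m ∧ s'.reg 1 = k) ∧
    s'.reg 6 = d ∧ s'.reg 8 = c + m * d) (fun m s' h => h.1) ?_ ?_).mono le_rfl fun s' _ h => h.2.2
  · rintro m s' - hm ⟨⟨g1, g2⟩, g3, g4⟩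
    refine wp_seq ⟨1, _, .const 88 0 s', le_rfl, fun _ => ?_⟩
    refine wp_seq ((wp_forLt (i := 88) (c := 6) d 2 (I := fun i s'' =>
      (s''.reg 88 = i ∧ s''.reg 6 = d) ∧ s''.reg 87 = m ∧ s''.reg 1 = k ∧
      s''.reg 8 = c + m * d + i) (fun i s'' h => h.1) (fun i s'' _ _ h => ?_) ?_).mono le_rfl
      fun s₂ _ h₂ _ => ?_)
    · obtain ⟨⟨e1, e2⟩, e3, e4, e5⟩ := h
      refine wp.le (wp_eval (by simp [Prog.LoopFree]) ?_) (le_refl 2)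
      simp [Prog.eval, State.setReg_reg, e1, e2, e3, e4, e5, add_assoc]
    · simp [State.setReg_reg, g1, g2, g3, g4]
    · obtain ⟨⟨e1, e2⟩, e3, e4, e5⟩ := h₂
      refine ⟨1, _, .inc 87 s₂, le_rfl, ?_⟩
      simp [State.setReg_reg, e2, e3, e4, e5, add_mul, add_assoc]
  · simp [State.setReg_reg, h1, h6, h8]

theorem wp_mark (hb : Base G s) (hv : s.reg 9 < G.n) (hM : ∀ x, s.arr 2 x = 0) :
    wp (forN 9 10 11 12 (.store 2 10 4)) s (10 * (G.d + 1))
      (fun s' => ∀ x, s'.arr 2 x = if x ∈ (G.cN (s.reg 9)).toFinset then 1 else 0) := by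
  refine (wp_forN G 1 (I := fun pre s' => ∀ x, s'.arr 2 x = if x ∈ pre then 1 else 0) hv hb.stored
    (by omega) (by simp [Prog.WritesReg, Prog.WritesArr]) (fun pre s' r x _ h => h)
    (fun pre y _ s' hu h hy => ?_) (by simpa using hM)).mono (by omega)
    fun s' _ h => by simpa using h
  have h4 : s'.reg 4 = 1 := by rw [hu.1 _ (by simp [Prog.WritesReg]), hb.one]
  refine ⟨1, _, .store 2 10 4 s', le_rfl, fun x => ?_⟩
  rw [State.setArr_arr, if_pos rfl, Function.update_apply, hy, h4, h]
  by_cases hx : x = y <;> simp [hx]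

theorem wp_unmark (hb : Base G s) (hv : s.reg 9 < G.n)
    (hM : ∀ x, s.arr 2 x = if x ∈ (G.cN (s.reg 9)).toFinset then 1 else 0) :
    wp (forN 9 10 11 12 (.store 2 10 3)) s (10 * (G.d + 1)) (fun s' => ∀ x, s'.arr 2 x = 0) := by
  refine (wp_forN G 1 (I := fun pre s' => ∀ x, s'.arr 2 x =
    if x ∈ G.cN (s.reg 9) ∧ x ∉ pre then 1 else 0) hv hb.stored
    (by omega) (by simp [Prog.WritesReg, Prog.WritesArr]) (fun pre s' r x _ h => h)
    (fun pre y _ s' hu h hy => ?_) (by simpa using hM)).mono (by omega)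
    fun s' _ h => by simpa using h
  have h3 : s'.reg 3 = 0 := by rw [hu.1 _ (by simp [Prog.WritesReg]), hb.zero]
  refine ⟨1, _, .store 2 10 3 s', le_rfl, fun x => ?_⟩
  rw [State.setArr_arr, if_pos rfl, Function.update_apply, hy, h3, h]
  by_cases hx : x = y <;> simp [hx]

theorem writesReg_tryVertex {r : ℕ} (h : tryVertex.WritesReg r) : r = 5 ∨ (10 ≤ r ∧ r ≤ 86) := by
  by_cases h' : optProg.WritesReg r
  · exact Or.inr (writesReg_optProg h')
  · simp [tryVertex, Prog.WritesReg, h'] at h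
    omega

theorem writesArr_tryVertex {a : ℕ} (h : tryVertex.WritesArr a) : 2 ≤ a := by
  by_cases h' : optProg.WritesArr a
  · exact writesArr_optProg h'
  · simp [tryVertex, Prog.WritesArr, h'] at h
    omega

/-- Some set of `k` vertices that does not meet the closed neighborhood of `v` has at least `l`
traces. -/
def Avoids (G : ListGraph) (k l v : ℕ) : Prop :=
  0 < outerBest G (G.cN v).toFinset k ∧ l ≤ outerBest G (G.cN v).toFinset k + 1

open Classical in
theorem wp_tryVertex {k l v a B : ℕ} (hd : 2 ≤ G.d) (hk1 : 1 ≤ k) (hB : ∀ M, optTime G M k ≤ B)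
    (hb : Base G s) (hk : s.reg 1 = k) (hl : s.reg 2 = l) (h9 : s.reg 9 = v) (hv : v < G.n)
    (h5 : s.reg 5 = a) (hM : ∀ x, s.arr 2 x = 0) :
    wp tryVertex s (B + 20 * (G.d + 1) + 8) (fun s' => (∀ x, s'.arr 2 x = 0) ∧
      s'.reg 5 = if Avoids G k l v then 1 else a) := by
  refine wp.le (T := 10 * (G.d + 1) + (1 + (optTime G (G.cN v).toFinset k + (6 +
    10 * (G.d + 1))))) ?_ (by have := hB (G.cN v).toFinset; omega)
  refine wp_seq ((wp_mark hb (by rw [h9]; exact hv) hM).mono le_rfl fun s₁ hu₁ hm₁ _ => ?_)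
  have hb₁ : Base G s₁ := hb.of_unch hu₁ (by simp [Prog.WritesReg]) (by simp [Prog.WritesArr])
  have hw₁ : ∀ r, r ≤ 9 → s₁.reg r = s.reg r := fun r hr =>
    hu₁.1 r (by simp [Prog.WritesReg]; omega)
  rw [h9] at hm₁
  refine wp_seq ⟨1, _, .copy 48 1 s₁, le_rfl, fun hu₂ => ?_⟩
  have h48 : (s₁.setReg 48 (s₁.reg 1)).reg 48 = k := by
    simp [State.setReg_reg, hw₁, hk]
  have hm₂ : ∀ x, (s₁.setReg 48 (s₁.reg 1)).arr 2 x = if x ∈ (G.cN v).toFinset then 1 else 0 :=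
    hm₁
  set s₂ := s₁.setReg 48 (s₁.reg 1) with hs₂
  have hb₂ : Base G s₂ := hb₁.of_unch hu₂ (by simp [Prog.WritesReg]) (by simp [Prog.WritesArr])
  refine wp_seq ((wp_optProg hd hk1 hb₂ h48 hm₂).mono le_rfl fun s₃ hu₃ h₃ _ => ?_)
  have hw₃ : ∀ r, r ≤ 9 → s₃.reg r = s.reg r := fun r hr => by
    rw [hu₃.1 r fun h => by have := writesReg_optProg h; omega,
      hu₂.1 r (by simp [Prog.WritesReg]; omega), hw₁ r hr]
  have hb₃ : Base G s₃ := hb₂.of_unch hu₃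
    ⟨fun h => by have := writesReg_optProg h; omega, fun h => by have := writesReg_optProg h; omega,
      fun h => by have := writesReg_optProg h; omega⟩
    ⟨fun h => by have := writesArr_optProg h; omega, fun h => by have := writesArr_optProg h; omega⟩
  obtain ⟨h49, hm₃⟩ := h₃
  have hmid : wp (.ite (.eq 49 3) .skip (.inc 49 ;; .ite (.lt 49 2) .skip (.const 5 1))) s₃ 6
      (fun s' => s'.reg 5 = if Avoids G k l v then 1 else a) := by
    refine wp.le (wp_eval (by simp [Prog.LoopFree]) ?_) (le_refl 6)
    simp only [Prog.eval, Test.holds_eq, Test.holds_lt, State.setReg_reg]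
    norm_num
    rw [h49, hb₃.zero, hw₃ 2 (by omega), hl]
    by_cases hav : Avoids G k l v
    · rw [if_pos hav, if_neg hav.1.ne', if_neg (not_lt.2 hav.2)]
      simp [State.setReg_reg]
    · rw [if_neg hav]
      rw [Avoids] at hav
      split_ifs
      · rw [hw₃ 5 (by omega), h5]
      · rw [State.setReg_reg, if_neg (by omega), hw₃ 5 (by omega), h5]
      · omega
  refine wp_seq (hmid.mono le_rfl fun s₄ hu₄ h₄ _ => ?_)
  have hb₄ : Base G s₄ := hb₃.of_unch hu₄ (by simp [Prog.WritesReg]) (by simp [Prog.WritesArr])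
  have h9₄ : s₄.reg 9 = v := by rw [hu₄.1 _ (by simp [Prog.WritesReg]), hw₃ _ (by omega), h9]
  refine (wp_unmark hb₄ (by rw [h9₄]; exact hv) (fun x => ?_)).mono le_rfl fun s₅ hu₅ h₅ =>
    ⟨h₅, ?_⟩
  · rw [hu₄.2 _ (by simp [Prog.WritesArr]), h9₄, hm₃]
  · rw [hu₅.1 _ (by simp [Prog.WritesReg]), h₄]

open Classical in
theorem wp_largeProg {k l B : ℕ} (hd : 2 ≤ G.d) (hk1 : 1 ≤ k) (hkn : k ≤ G.n)
    (hB : ∀ M, optTime G M k ≤ B) (hb : Base G s) (hk : s.reg 1 = k) (hl : s.reg 2 = l)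
    (h5 : s.reg 5 = 0) (h6 : s.reg 6 = G.d + 1) (hM : ∀ x, s.arr 2 x = 0) :
    wp largeProg s ((k * (G.d + 1) + 2) * (B + 20 * (G.d + 1) + 40))
      (fun s' => s'.reg 5 = if G.Answer k l then 1 else 0) := by
  set N := k * (G.d + 1) + 1 with hN
  refine wp.le (T := 1 + (optTime G ∅ k + ((1 + ((k * (3 * (G.d + 1) + 4) + 2) + (1 +
    (N * (((B + 20 * (G.d + 1) + 8) + 1 + 1) + 1) + 1)))) + 1))) ?_ ?_
  swap
  · have h1 := hB ∅
    have h2 : k * (3 * (G.d + 1) + 4) ≤ 7 * N := by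
      have : k ≤ k * (G.d + 1) := Nat.le_mul_of_pos_right _ (by omega)
      rw [hN]
      calc k * (3 * (G.d + 1) + 4) = 3 * (k * (G.d + 1)) + 4 * k := by ring
        _ ≤ _ := by omega
    have h3 : k * (G.d + 1) + 2 = N + 1 := by omega
    have h4 : (N + 1) * (B + 20 * (G.d + 1) + 40) =
        N * (((B + 20 * (G.d + 1) + 8) + 1 + 1) + 1) + 29 * N + (B + 20 * (G.d + 1) + 40) := by ring
    rw [h3, h4]
    omega
  refine wp_seq ⟨1, _, .copy 48 1 s, le_rfl, fun hu₁ => ?_⟩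
  have h48 : (s.setReg 48 (s.reg 1)).reg 48 = k := by simp [State.setReg_reg, hk]
  have hM₁ : ∀ x, (s.setReg 48 (s.reg 1)).arr 2 x = if x ∈ (∅ : Finset ℕ) then 1 else 0 := by
    simpa using hM
  set s₁ := s.setReg 48 (s.reg 1) with hs₁
  have hb₁ : Base G s₁ := hb.of_unch hu₁ (by simp [Prog.WritesReg]) (by simp [Prog.WritesArr])
  refine wp_seq ((wp_optProg hd hk1 hb₁ h48 hM₁).mono le_rfl fun s₂ hu₂ h₂ _ => ?_)
  have hw₂ : ∀ r, r ≤ 9 → s₂.reg r = s.reg r := fun r hr => by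
    rw [hu₂.1 r fun h => by have := writesReg_optProg h; omega,
      hu₁.1 r (by simp [Prog.WritesReg]; omega)]
  have hb₂ : Base G s₂ := hb₁.of_unch hu₂
    ⟨fun h => by have := writesReg_optProg h; omega, fun h => by have := writesReg_optProg h; omega,
      fun h => by have := writesReg_optProg h; omega⟩
    ⟨fun h => by have := writesArr_optProg h; omega, fun h => by have := writesArr_optProg h; omega⟩
  obtain ⟨h49, hm₂⟩ := h₂
  refine wp_ite (fun hlt => ?_) fun hlt => ?_
  · rw [Test.holds_lt, h49, hw₂ _ (by omega), hl] at hlt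
    refine wp_seq ⟨1, _, .const 8 1 s₂, le_rfl, fun hu₃ => ?_⟩
    set s₃ := s₂.setReg 8 1 with hs₃
    have hw₃ : ∀ r, r ≤ 7 → s₃.reg r = s.reg r := fun r hr => by
      rw [hu₃.1 r (by simp [Prog.WritesReg]; omega), hw₂ r (by omega)]
    refine wp_seq ((wp_addProduct (k := k) (d := G.d + 1) (c := 1) (by rw [hw₃ _ (by omega), hk])
      (by rw [hw₃ _ (by omega), h6]) (by simp [hs₃, State.setReg_reg])).mono le_rfl
      fun s₄ hu₄ h8₄ _ => ?_)
    refine wp_seq ⟨1, _, .const 9 0 s₄, le_rfl, fun hu₅ => ?_⟩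
    set s₅ := s₄.setReg 9 0 with hs₅
    have hw₅ : ∀ r, r ≤ 7 → s₅.reg r = s.reg r := fun r hr => by
      rw [hu₅.1 r (by simp [Prog.WritesReg]; omega),
        hu₄.1 r (by rw [addProduct_writesReg]; omega), hw₃ r hr]
    have ha₅ : s₅.arr = s₂.arr := by
      funext a
      rw [hu₅.2 a (by simp [Prog.WritesArr]), hu₄.2 a (addProduct_writesArr a)]
      rfl
    have hb₅ : Base G s₅ := ⟨by rw [ha₅]; exact hb₂.stored, by rw [hw₅ _ (by omega), hb.n],
      by rw [hw₅ _ (by omega), hb.zero], by rw [hw₅ _ (by omega), hb.one]⟩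
    have hb5 : s₅.reg 8 = N := by
      rw [hu₅.1 _ (by simp [Prog.WritesReg]), h8₄, hN, add_comm]
    refine (wp_forLt (i := 9) (c := 8) N _ (I := fun m s' => (s'.reg 9 = m ∧ s'.reg 8 = N) ∧
      (∀ x, s'.arr 2 x = 0) ∧ s'.reg 5 = if ∃ v < m, v < G.n ∧ Avoids G k l v then 1 else 0)
      (fun m s' h => h.1) ?_ ?_).mono le_rfl fun s' _ h => ?_
    · rintro m s' hu hm ⟨⟨g1, g2⟩, g3, g4⟩
      have hwr : ∀ r, r ≤ 4 → s'.reg r = s.reg r := fun r hr => by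
        rw [hu.1 r, hw₅ r (by omega)]
        simp only [Prog.WritesReg]
        rintro ((h | h) | h)
        · have := writesReg_tryVertex h; omega
        · exact h
        · omega
      have hwa : ∀ a, a ≤ 1 → s'.arr a = s₅.arr a := fun a ha => hu.2 a (by
        simp only [Prog.WritesArr]
        rintro ((h | h) | h)
        · have := writesArr_tryVertex h; omega
        · exact h
        · exact h)
      have hb' : Base G s' := ⟨by rw [hwa 0 (by omega), hwa 1 (by omega)]; exact hb₅.stored,
        by rw [hwr _ (by omega), hb.n], by rw [hwr _ (by omega), hb.zero],
        by rw [hwr _ (by omega), hb.one]⟩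
      have hstep : ∀ s'', s''.reg 9 = m → s''.reg 8 = N → (∀ x, s''.arr 2 x = 0) →
          (s''.reg 5 = if ∃ v < m + 1, v < G.n ∧ Avoids G k l v then 1 else 0) →
          wp (.inc 9) s'' 1 (fun s' => (s'.reg 9 = m + 1 ∧ s'.reg 8 = N) ∧
            (∀ x, s'.arr 2 x = 0) ∧
            s'.reg 5 = if ∃ v < m + 1, v < G.n ∧ Avoids G k l v then 1 else 0) := by
        intro s'' e1 e2 e3 e4
        exact ⟨1, _, .inc 9 s'', le_rfl, by simp [State.setReg_reg, e1, e2], e3,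
          by simpa [State.setReg_reg] using e4⟩
      refine wp_seq (T₁ := B + 20 * (G.d + 1) + 8 + 1) (T₂ := 1)
        (wp_ite (fun hlt => ?_) fun hlt => ?_)
      · rw [Test.holds_lt, g1, hb'.n] at hlt
        refine (wp_tryVertex hd hk1 hB hb' (by rw [hwr _ (by omega), hk])
          (by rw [hwr _ (by omega), hl]) g1 hlt g4 g3).mono le_rfl fun s'' hu'' h'' _ => ?_
        have hwt : ∀ r, r = 8 ∨ r = 9 → s''.reg r = s'.reg r := fun r hr =>
          hu''.1 r fun h => by have := writesReg_tryVertex h; omega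
        refine hstep s'' (by rw [hwt _ (by omega), g1]) (by rw [hwt _ (by omega), g2]) h''.1 ?_
        rw [h''.2]
        by_cases hav : Avoids G k l m
        · rw [if_pos hav, if_pos ⟨m, by omega, hlt, hav⟩]
        · rw [if_neg hav]
          congr 1
          rw [eq_iff_iff]
          refine ⟨fun ⟨v, h1, h2⟩ => ⟨v, by omega, h2⟩, fun ⟨v, h1, h2⟩ => ⟨v, ?_, h2⟩⟩
          have : v ≠ m := by rintro rfl; exact hav h2.2
          omega
      · rw [Test.holds_lt, g1, hb'.n] at hlt
        refine wp.le (wp_eval (by simp [Prog.LoopFree]) fun _ => ?_) (by simp [Prog.time])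
        refine hstep _ g1 g2 g3 ?_
        rw [Prog.eval, g4]
        congr 1
        rw [eq_iff_iff]
        exact ⟨fun ⟨v, h1, h2⟩ => ⟨v, by omega, h2⟩, fun ⟨v, h1, h2⟩ => ⟨v, by omega, h2⟩⟩
    · refine ⟨⟨by simp [hs₅, State.setReg_reg], hb5⟩, fun x => ?_, ?_⟩
      · rw [ha₅, hm₂]; simp
      · rw [hw₅ _ (by omega), h5]; simp
    · rw [h.2.2]
      congr 1
      rw [eq_iff_iff, G.answer_iff hk1 hkn]
      exact ⟨fun ⟨v, h1, h2⟩ => Or.inr ⟨v, h1, h2⟩, fun h => h.resolve_left (by omega)⟩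
  · rw [Test.holds_lt, h49, hw₂ _ (by omega), hl, not_lt] at hlt
    refine ⟨1, _, .const 5 1 s₂, by omega, ?_⟩
    rw [if_pos ((G.answer_iff hk1 hkn).2 (Or.inl hlt))]
    simp [State.setReg_reg]

/-- The memory before the start: the graph, `n`, `k`, `l` and nothing else. -/
structure Start (G : ListGraph) (k l : ℕ) (s : State) : Prop where
  stored : G.StoredIn (s.arr 0) (s.arr 1)
  n : s.reg 0 = G.n
  k : s.reg 1 = k
  l : s.reg 2 = l
  zero : s.reg 3 = 0
  mark : ∀ x, s.arr 2 x = 0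

section

variable {k l : ℕ}

open Classical in
theorem wp_mainProg {T : ℕ} (h : Start G k l s)
    (hbody : ∀ s', Base G s' → s'.reg 1 = k → s'.reg 2 = l → s'.reg 5 = 0 →
      (∀ x, s'.arr 2 x = 0) → wp (.ite (.lt 0 1) .skip (.ite (.eq 1 3)
    (.ite (.lt 4 2) .skip (.ite (.lt 0 2) .skip (.const 5 1)))
    (degProg ;; .const 7 2 ;; .ite (.lt 7 6) largeProg smallProg))) s' T
        (fun s' => s'.reg 5 = if G.Answer k l then 1 else 0)) :
    wp mainProg s (T + 3) (fun s' => s'.reg 0 = if G.Answer k l then 1 else 0) := by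
  refine wp.le (T := 2 + (T + 1)) ?_ (by omega)
  refine wp_seq (wp_eval (by simp [Prog.LoopFree]) fun hu => ?_)
  simp only [Prog.eval] at hu ⊢
  refine wp_seq ((hbody ((s.setReg 4 1).setReg 5 0) ⟨h.stored, ?_, ?_, ?_⟩ ?_ ?_ ?_
    h.mark).mono le_rfl fun s₁ _ h₁ _ =>
    ⟨1, _, .copy 0 5 s₁, le_rfl, by simp [State.setReg_reg, h₁]⟩)
  all_goals simp [State.setReg_reg, h.n, h.k, h.l, h.zero]

open Classical in
theorem wp_mainProg_of_lt (h : Start G k l s) (hk : G.n < k) :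
    wp mainProg s 20 (fun s' => s'.reg 0 = if G.Answer k l then 1 else 0) := by
  refine (wp_mainProg (T := 1 + 1) h fun s' hb h1 _ h5 _ => ?_).le (by omega)
  refine wp_ite (fun _ => ⟨1, _, .skip _, le_rfl, ?_⟩) fun h => ?_
  · change s'.reg 5 = _
    rw [if_neg (G.not_answer hk), h5]
  · rw [Test.holds_lt, hb.n, h1] at h; omega

open Classical in
theorem wp_mainProg_zero (h : Start G 0 l s) :
    wp mainProg s 20 (fun s' => s'.reg 0 = if G.Answer 0 l then 1 else 0) := by
  refine (wp_mainProg (T := 5 + 1 + 1) h fun s' hb h1 h2 h5 _ => ?_).le (by omega)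
  refine wp_ite (fun h => ?_) fun _ => wp_ite (fun _ => ?_) fun h => ?_
  · rw [Test.holds_lt, h1] at h; omega
  · refine wp.le (wp_eval (by simp [Prog.LoopFree]) ?_) (le_refl 5)
    simp only [G.answer_zero]
    simp only [Prog.eval, Test.holds_lt, hb.one, h2, hb.n]
    split_ifs <;> first | omega | simp [State.setReg_reg]
  · rw [Test.holds_eq, h1, hb.zero] at h; exact absurd rfl h

open Classical in
theorem wp_mainProg_small (h : Start G k l s) (hmax : ∃ v < G.n, (G.nb v).length = G.d)
    (hk1 : 1 ≤ k) (hkn : k ≤ G.n) (hd : G.d ≤ 1) :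
    wp mainProg s (60 * ((G.n + 1) * (G.d + 1)))
      (fun s' => s'.reg 0 = if G.Answer k l then 1 else 0) := by
  have hpos : 1 ≤ (G.n + 1) * (G.d + 1) := Nat.one_le_iff_ne_zero.2 (by positivity)
  refine (wp_mainProg (T := ((20 * ((G.n + 1) * (G.d + 1))) + (1 +
    ((20 * ((G.n + 1) * (G.d + 1)) + 7) + 1))) + 1 + 1) h fun s' hb h1 h2 h5 _ => ?_).le (by omega)
  refine wp_ite (fun h => ?_) fun _ => wp_ite (fun h => ?_) fun _ => ?_
  · rw [Test.holds_lt, hb.n, h1] at h; omega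
  · rw [Test.holds_eq, h1, hb.zero] at h; omega
  refine wp_seq ((wp_degProg hb hmax).mono le_rfl fun s₁ hu₁ h₁ _ => ?_)
  have hb₁ : Base G s₁ := hb.of_unch hu₁ (by simp [degProg_writesReg]) (by simp [degProg_writesArr])
  have hw : ∀ r, r ≤ 5 → s₁.reg r = s'.reg r := fun r hr =>
    hu₁.1 r (by rw [degProg_writesReg]; omega)
  refine wp_seq ⟨1, _, .const 7 2 s₁, le_rfl, fun hu₂ => ?_⟩
  have hb₂ : Base G (s₁.setReg 7 2) :=
    hb₁.of_unch hu₂ (by simp [Prog.WritesReg]) (by simp [Prog.WritesArr])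
  refine wp_ite (fun h => ?_) fun _ => wp_smallProg hb₂ hd hkn ?_ ?_ ?_
  · simp [State.setReg_reg, h₁] at h; omega
  · simp [State.setReg_reg, hw, h1]
  · simp [State.setReg_reg, hw, h2]
  · simp [State.setReg_reg, hw, h5]

open Classical in
theorem wp_mainProg_large {B : ℕ} (h : Start G k l s) (hmax : ∃ v < G.n, (G.nb v).length = G.d)
    (hk1 : 1 ≤ k) (hkn : k ≤ G.n) (hd : 2 ≤ G.d) (hB : ∀ M, optTime G M k ≤ B) :
    wp mainProg s (30 * ((G.n + 1) * (G.d + 1)) +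
      (k * (G.d + 1) + 2) * (B + 20 * (G.d + 1) + 40))
      (fun s' => s'.reg 0 = if G.Answer k l then 1 else 0) := by
  have hpos : 1 ≤ (G.n + 1) * (G.d + 1) := Nat.one_le_iff_ne_zero.2 (by positivity)
  refine (wp_mainProg (T := ((20 * ((G.n + 1) * (G.d + 1))) + (1 +
    (((k * (G.d + 1) + 2) * (B + 20 * (G.d + 1) + 40)) + 1))) + 1 + 1) h
    fun s' hb h1 h2 h5 hM => ?_).le (by omega)
  refine wp_ite (fun h => ?_) fun _ => wp_ite (fun h => ?_) fun _ => ?_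
  · rw [Test.holds_lt, hb.n, h1] at h; omega
  · rw [Test.holds_eq, h1, hb.zero] at h; omega
  refine wp_seq ((wp_degProg hb hmax).mono le_rfl fun s₁ hu₁ h₁ _ => ?_)
  have hb₁ : Base G s₁ := hb.of_unch hu₁ (by simp [degProg_writesReg]) (by simp [degProg_writesArr])
  have hw : ∀ r, r ≤ 5 → s₁.reg r = s'.reg r := fun r hr =>
    hu₁.1 r (by rw [degProg_writesReg]; omega)
  refine wp_seq ⟨1, _, .const 7 2 s₁, le_rfl, fun hu₂ => ?_⟩
  have hb₂ : Base G (s₁.setReg 7 2) :=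
    hb₁.of_unch hu₂ (by simp [Prog.WritesReg]) (by simp [Prog.WritesArr])
  refine wp_ite (fun _ => wp_largeProg hd hk1 hkn hB hb₂ ?_ ?_ ?_ ?_ fun x => ?_) fun h => ?_
  · simp [State.setReg_reg, hw, h1]
  · simp [State.setReg_reg, hw, h2]
  · simp [State.setReg_reg, hw, h5]
  · simp [State.setReg_reg, h₁]
  · rw [State.setReg_arr, hu₁.2 _ (degProg_writesArr 2), hM]
  · simp [State.setReg_reg, h₁] at h; omega

end

end

end RAM

/-! ## The running time -/

namespace PartialVC

open RAM

section optTime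

variable {G : ListGraph} {k : ℕ}

theorem length_roots_add_one_le {M : Finset ℕ} {σ : Node} (hσ : (outerSearch G M k).Ok σ) :
    ((outerSearch G M k).roots σ).length + 1 ≤ ((k + 1) * (G.d + 1)) ^ 2 := by
  have h := length_outer_roots_le σ hσ
  have h2 : (k + 1) * (k * (G.d ^ 2 + 1)) + 1 ≤ ((k + 1) * (G.d + 1)) ^ 2 := by ring_nf; omega
  omega

/-- With `Y = (k + 1)(d + 1)`, a visit costs `O(Y ^ 3)`, a node has fewer than `Y ^ 2` roots, and a
request contributes a further factor of at most `Y`; hence `Y ^ 6`. The inner searches cost only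
powers of `q`, which are below those of `15 / 4 * q`. The constant `2256` is `16 * 141`. -/
theorem optTime_le (hd : 2 ≤ G.d) (M : Finset ℕ) :
    (optTime G M k : ℝ) ≤ 3000000 * ((G.n + 1) * (((k : ℝ) + 1) * (G.d + 1)) ^ 6 *
      (15 / 4 * 2 ^ (G.d ^ 2 - G.d)) ^ k) := by
  set Y : ℝ := ((k : ℝ) + 1) * (G.d + 1) with hY
  set E := visitTime G k + 1 with hE
  set q : ℝ := 2 ^ (G.d ^ 2 - G.d) with hq
  have hk1 : (1 : ℝ) ≤ (k : ℝ) + 1 := by linarith [(Nat.cast_nonneg k : (0 : ℝ) ≤ k)]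
  have hd1 : (1 : ℝ) ≤ (G.d : ℝ) + 1 := by linarith [(Nat.cast_nonneg G.d : (0 : ℝ) ≤ G.d)]
  have hn1 : (1 : ℝ) ≤ (G.n : ℝ) + 1 := by linarith [(Nat.cast_nonneg G.n : (0 : ℝ) ≤ G.n)]
  have hY1 : 1 ≤ Y := one_le_mul_of_one_le_of_one_le hk1 hd1
  have hkY : (k : ℝ) + 1 ≤ Y := le_mul_of_one_le_right (by linarith) hd1
  have hY3 : (1 : ℝ) ≤ Y ^ 3 := one_le_pow₀ hY1
  have hq1 : 1 ≤ q := one_le_pow₀ (by norm_num)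
  have hEr : (E : ℝ) ≤ 141 * Y ^ 3 := by
    rw [hE, visitTime]; push_cast; rw [← hY]; linarith
  have hvr : (visitTime G k : ℝ) ≤ 141 * Y ^ 3 := by
    refine le_trans ?_ hEr; rw [hE]; exact_mod_cast Nat.le_succ _
  have hE0 : (0 : ℝ) ≤ E := Nat.cast_nonneg _
  set e : ℝ := 2256 * ((G.n + 1) * Y ^ 6) with he
  have hbase : Y ^ 3 ≤ (G.n + 1) * Y ^ 6 := by
    calc Y ^ 3 = 1 * (Y ^ 3 * 1) := by ring
      _ ≤ (G.n + 1) * (Y ^ 3 * Y ^ 3) := by gcongr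
      _ = _ := by ring
  have key := outer_cost_start_le (M := M) (k := k) hd hq E (outerFetchTime G k E) (e := e)
    (by rw [he]; linarith) (fun σ hσ hA => ?_)
  · have hβ1 : 1 ≤ (15 / 4 * q) ^ k := one_le_pow₀ (by linarith)
    have he1 : e ≤ e * (15 / 4 * q) ^ k := le_mul_of_one_le_right (by rw [he]; positivity) hβ1
    rw [optTime]
    push_cast
    rw [← hE]
    calc ((outerSearch G M k).cost E (outerFetchTime G k E) Node.start : ℝ) +
          (visitTime G k : ℝ) + 21 ≤ 1000 * e * (15 / 4 * q) ^ k + e := by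
          rw [he] at *; linarith
      _ ≤ 1001 * (e * (15 / 4 * q) ^ k) := by linarith
      _ = 1001 * 2256 * ((G.n + 1) * Y ^ 6 * (15 / 4 * q) ^ k) := by rw [he]; ring
      _ ≤ _ := by gcongr; norm_num
  · set r := k - σ.A.length with hr
    have hlen : (((outerSearch G M k).roots σ).length : ℝ) + 1 ≤ Y ^ 2 := by
      have := length_roots_add_one_le hσ
      have h2 : ((((outerSearch G M k).roots σ).length + 1 : ℕ) : ℝ) ≤
        (((k + 1) * (G.d + 1)) ^ 2 : ℕ) := by exact_mod_cast this
      push_cast at h2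
      exact h2
    have hqr : 1 ≤ q ^ r := one_le_pow₀ hq1
    have hR : (outerFetchTime G k E σ : ℝ) = 12 * (((k : ℝ) + 1) * (G.n + 1) * E * q ^ r) := by
      rw [outerFetchTime]; push_cast; rw [hq]
    have h1 : (E : ℝ) ≤ Y * (G.n + 1) * E * q ^ r := by
      calc (E : ℝ) = 1 * 1 * E * 1 := by ring
        _ ≤ Y * (G.n + 1) * E * q ^ r := by gcongr
    have h2 : (E : ℝ) + outerFetchTime G k E σ ≤ 13 * (Y * (G.n + 1) * E * q ^ r) := by
      rw [hR]
      have : ((k : ℝ) + 1) * (G.n + 1) * E * q ^ r ≤ Y * (G.n + 1) * E * q ^ r := by gcongr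
      linarith
    have h3 : (((outerSearch G M k).roots σ).length + 1 : ℝ) * (E + outerFetchTime G k E σ) ≤
        Y ^ 2 * (13 * (Y * (G.n + 1) * E * q ^ r)) := by
      refine mul_le_mul hlen h2 (by positivity) (by positivity)
    have h4 : Y * (G.n + 1) * E * q ^ r ≤ Y ^ 2 * (Y * (G.n + 1) * E * q ^ r) :=
      le_mul_of_one_le_left (by positivity) (one_le_pow₀ hY1)
    have h5 : (1 : ℝ) ≤ (15 / 4) ^ r := one_le_pow₀ (by norm_num)
    calc (((outerSearch G M k).roots σ).length + 1 : ℝ) * (E + outerFetchTime G k E σ) + 3 * E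
        ≤ 16 * (Y ^ 2 * (Y * (G.n + 1) * E * q ^ r)) := by linarith
      _ ≤ 16 * (Y ^ 2 * (Y * (G.n + 1) * (141 * Y ^ 3) * q ^ r)) := by gcongr
      _ = e * (1 * q ^ r) := by rw [he]; ring
      _ ≤ e * ((15 / 4) ^ r * q ^ r) := by gcongr
      _ = e * (15 / 4 * q) ^ r := by rw [mul_pow]

end optTime

theorem exists_pow_le_mul_pow (p : ℕ) {r : ℝ} (hr : 1 < r) :
    ∃ C : ℝ, 0 < C ∧ ∀ m : ℕ, ((m : ℝ) + 1) ^ p ≤ C * r ^ m := by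
  obtain ⟨B, hB⟩ := (tendsto_pow_const_div_const_pow_of_one_lt p hr).bddAbove_range
  refine ⟨(|B| + 1) * r, by positivity, fun m => ?_⟩
  have h : ((m + 1 : ℕ) : ℝ) ^ p / r ^ (m + 1) ≤ B := hB ⟨m + 1, rfl⟩
  rw [div_le_iff₀ (by positivity)] at h
  push_cast at h
  calc ((m : ℝ) + 1) ^ p ≤ B * r ^ (m + 1) := h
    _ ≤ (|B| + 1) * r ^ (m + 1) := by gcongr; linarith [le_abs_self B]
    _ = _ := by rw [pow_succ]; ring

/-- The running time is linear in `n`, but `n log n` bounds `n` up to a constant only from `n = 2`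
on; the maximum with one covers the rest. -/
theorem cast_add_one_le (n : ℕ) : (n : ℝ) + 1 ≤ 4 * max 1 ((n : ℝ) * Real.log n) := by
  rcases Nat.lt_or_ge n 2 with h | h
  · have h1 : (n : ℝ) ≤ 1 := by exact_mod_cast Nat.lt_succ_iff.1 h
    linarith [le_max_left 1 ((n : ℝ) * Real.log n)]
  · have h2 : (2 : ℝ) ≤ n := by exact_mod_cast h
    have h3 : Real.log 2 ≤ Real.log n := Real.log_le_log (by norm_num) h2
    have h4 := Real.log_two_gt_d9
    have h5 : (n : ℝ) * (1 / 2) ≤ n * Real.log n := by gcongr; linarith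
    linarith [le_max_right 1 ((n : ℝ) * Real.log n)]

/-- The exponential part of the running time absorbs every polynomial in `k` and `d`. -/
theorem exists_absorb : ∃ C : ℝ, 0 < C ∧ ∀ k d : ℕ, 1 ≤ k → 2 ≤ d →
    (((k : ℝ) + 1) * (d + 1)) ^ 7 * (15 / 4 * 2 ^ (d ^ 2 - d)) ^ k ≤ C * 2 ^ (k * d ^ 2) := by
  -- Since `16 / 15 * 15 / 4 = 4`, the factor `(16 / 15) ^ k` absorbs the polynomial in `k` while
  -- raising the base to `4 * q`. What is left of `2 ^ (d ^ 2)` is `2 ^ (d - 2)`; it absorbs the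
  -- polynomial in `d`, using `k ≥ 1`.
  obtain ⟨C₁, hC₁, h₁⟩ := exists_pow_le_mul_pow 7 (r := 16 / 15) (by norm_num)
  obtain ⟨C₂, hC₂, h₂⟩ := exists_pow_le_mul_pow 7 (r := 2) (by norm_num)
  refine ⟨C₁ * (4 * C₂), by positivity, fun k d hk hd => ?_⟩
  have hd2 : (2 : ℝ) ^ d = 4 * 2 ^ (d - 2) := by
    obtain ⟨c, rfl⟩ := Nat.exists_eq_add_of_le hd
    rw [pow_add, Nat.add_sub_cancel_left]; norm_num
  have h3 : (2 : ℝ) ^ (d - 2) ≤ (2 ^ (d - 2)) ^ k :=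
    le_self_pow₀ (one_le_pow₀ (by norm_num)) (by omega)
  have h4 : ((d : ℝ) + 1) ^ 7 ≤ 4 * C₂ * (2 ^ (d - 2)) ^ k := by
    calc ((d : ℝ) + 1) ^ 7 ≤ C₂ * 2 ^ d := h₂ d
      _ = 4 * C₂ * 2 ^ (d - 2) := by rw [hd2]; ring
      _ ≤ _ := by gcongr
  have h5 : ((2 : ℝ) ^ (d - 2)) ^ k * (4 * 2 ^ (d ^ 2 - d)) ^ k = 2 ^ (k * d ^ 2) := by
    have hdd : d ≤ d ^ 2 := Nat.le_self_pow (by norm_num) d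
    rw [← mul_pow, mul_comm k, pow_mul, show (4 : ℝ) = 2 ^ 2 by norm_num, ← pow_add, ← pow_add]
    congr 2
    omega
  have h6 : (16 / 15 : ℝ) ^ k * (15 / 4 * 2 ^ (d ^ 2 - d)) ^ k = (4 * 2 ^ (d ^ 2 - d)) ^ k := by
    rw [← mul_pow]; congr 1; ring
  calc (((k : ℝ) + 1) * (d + 1)) ^ 7 * (15 / 4 * 2 ^ (d ^ 2 - d)) ^ k
      = ((k : ℝ) + 1) ^ 7 * ((d : ℝ) + 1) ^ 7 * (15 / 4 * 2 ^ (d ^ 2 - d)) ^ k := by rw [mul_pow]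
    _ ≤ (C₁ * (16 / 15) ^ k) * (4 * C₂ * (2 ^ (d - 2)) ^ k) * (15 / 4 * 2 ^ (d ^ 2 - d)) ^ k := by
        gcongr
        exact h₁ k
    _ = C₁ * (4 * C₂) * ((2 ^ (d - 2)) ^ k *
          ((16 / 15) ^ k * (15 / 4 * 2 ^ (d ^ 2 - d)) ^ k)) := by ring
    _ = C₁ * (4 * C₂) * 2 ^ (k * d ^ 2) := by rw [h6, h5]

open Classical in
theorem decidesWithin_of_wp {p : Prog} {s : State} {T : ℕ} {yes : Prop} {R : ℝ}
    (h : wp p s T fun s' => s'.reg 0 = if yes then 1 else 0) (hT : (T : ℝ) ≤ R) :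
    DecidesWithin p s yes R := by
  obtain ⟨t, s', he, ht, hs⟩ := h
  refine ⟨t, s', he, le_trans (by exact_mod_cast ht) hT, ?_⟩
  by_cases hy : yes
  · exact Or.inl ⟨hy, by rw [hs, if_pos hy]⟩
  · exact Or.inr ⟨hy, by rw [hs, if_neg hy]⟩

theorem GraphInstance.start_init (I : GraphInstance) : Start I.listGraph I.k I.l I.init :=
  ⟨I.storedIn_init, rfl, rfl, rfl, rfl, fun _ => rfl⟩

theorem exists_decidesWithin_mainProg : ∃ K : ℝ, 0 ≤ K ∧ ∀ I : GraphInstance,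
    DecidesWithin mainProg I.init I.Yes
      (K * 2 ^ (I.k * I.Δ ^ 2) * max 1 ((I.n : ℝ) * Real.log (I.n : ℝ))) := by
  obtain ⟨C, hC, hab⟩ := exists_absorb
  -- The summand `480 = 60 * 4 * 2` serves the cases without search. In the other, `7000000` is
  -- multiplied by the `4` from `cast_add_one_le`.
  refine ⟨480 + 28000000 * C, by positivity, fun I => ?_⟩
  rw [I.yes_iff]
  have hst := I.start_init
  have hn := cast_add_one_le I.n
  set G := I.listGraph with hG
  have hGn : G.n = I.n := rfl
  have hGd : G.d = I.Δ := rfl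
  set L := max 1 ((I.n : ℝ) * Real.log (I.n : ℝ)) with hL
  have hL1 : 1 ≤ L := le_max_left _ _
  have hP1 : (1 : ℝ) ≤ 2 ^ (I.k * I.Δ ^ 2) := one_le_pow₀ (by norm_num)
  have hlow : 480 * L ≤ (480 + 28000000 * C) * 2 ^ (I.k * I.Δ ^ 2) * L := by
    gcongr
    calc (480 : ℝ) = 480 * 1 := by ring
      _ ≤ (480 + 28000000 * C) * 2 ^ (I.k * I.Δ ^ 2) := by
        gcongr; linarith
  rcases Nat.lt_or_ge G.n I.k with hk | hkn
  · exact decidesWithin_of_wp (wp_mainProg_of_lt hst hk) (by push_cast; linarith)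
  rcases Nat.eq_zero_or_pos I.k with hk0 | hk1
  · rw [hk0] at hst
    have := decidesWithin_of_wp (wp_mainProg_zero hst) (R := 480 * L) (by push_cast; linarith)
    rw [← hk0] at this
    obtain ⟨t, s', he, ht, h⟩ := this
    exact ⟨t, s', he, ht.trans hlow, h⟩
  have hmax := I.exists_length_nb (by omega)
  rcases Nat.lt_or_ge G.d 2 with hd | hd
  · refine decidesWithin_of_wp (wp_mainProg_small hst hmax hk1 hkn (by omega)) (le_trans ?_ hlow)
    have hd' : (G.d : ℝ) ≤ 1 := by exact_mod_cast Nat.lt_succ_iff.1 hd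
    have h1 : ((G.n : ℝ) + 1) * (G.d + 1) ≤ (4 * L) * (1 + 1) := by
      rw [hGn]; gcongr
    push_cast
    linarith
  · set Y : ℝ := ((I.k : ℝ) + 1) * (G.d + 1) with hY
    set β : ℝ := (15 / 4 * 2 ^ (G.d ^ 2 - G.d)) ^ I.k with hβ
    have hk1' : (1 : ℝ) ≤ (I.k : ℝ) + 1 := by linarith [(Nat.cast_nonneg I.k : (0 : ℝ) ≤ I.k)]
    have hd1 : (1 : ℝ) ≤ (G.d : ℝ) + 1 := by linarith [(Nat.cast_nonneg G.d : (0 : ℝ) ≤ G.d)]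
    have hn1 : (1 : ℝ) ≤ (G.n : ℝ) + 1 := by linarith [(Nat.cast_nonneg G.n : (0 : ℝ) ≤ G.n)]
    have hY1 : 1 ≤ Y := one_le_mul_of_one_le_of_one_le hk1' hd1
    have hdY : (G.d : ℝ) + 1 ≤ Y := le_mul_of_one_le_left (by linarith) hk1'
    have hβ1 : 1 ≤ β := one_le_pow₀ (by
      have : (1 : ℝ) ≤ 2 ^ (G.d ^ 2 - G.d) := one_le_pow₀ (by norm_num)
      linarith)
    set F : ℝ := (G.n + 1) * Y ^ 6 * β with hF
    have hF0 : 0 ≤ F := by positivity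
    set B := ⌊3000000 * F⌋₊ with hB
    have hBF : (B : ℝ) ≤ 3000000 * F := Nat.floor_le (by positivity)
    refine decidesWithin_of_wp (wp_mainProg_large (B := B) hst hmax hk1 hkn hd
      fun M => Nat.le_floor (optTime_le hd M)) ?_
    have hYF : Y * F = (G.n + 1) * (Y ^ 7 * β) := by rw [hF]; ring
    have h1 : ((G.n : ℝ) + 1) * (G.d + 1) ≤ Y * F := by
      calc ((G.n : ℝ) + 1) * (G.d + 1) ≤ (G.n + 1) * Y := by gcongr
        _ = Y * ((G.n + 1) * 1 * 1) := by ring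
        _ ≤ Y * F := by
          rw [hF]; gcongr; exact one_le_pow₀ hY1
    have h2 : (I.k : ℝ) * (G.d + 1) + 2 ≤ 2 * Y := by rw [hY]; linarith
    have hYF' : Y ≤ F := by
      calc Y = 1 * Y * 1 := by ring
        _ ≤ (G.n + 1) * Y ^ 6 * β := by
          gcongr; exact le_self_pow₀ hY1 (by norm_num)
    have h3 : (B : ℝ) + 20 * (G.d + 1) + 40 ≤ 3000060 * F := by linarith
    have h4 : ((I.k : ℝ) * (G.d + 1) + 2) * (B + 20 * (G.d + 1) + 40) ≤
        2 * Y * (3000060 * F) := mul_le_mul h2 h3 (by positivity) (by positivity)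
    have h5 : Y ^ 7 * β ≤ C * 2 ^ (I.k * I.Δ ^ 2) := hab I.k G.d hk1 hd
    push_cast
    calc 30 * (((G.n : ℝ) + 1) * (G.d + 1)) +
          ((I.k : ℝ) * (G.d + 1) + 2) * (B + 20 * (G.d + 1) + 40)
        ≤ 7000000 * (Y * F) := by linarith [mul_nonneg (zero_le_one.trans hY1) hF0]
      _ = 7000000 * ((G.n + 1) * (Y ^ 7 * β)) := by rw [hYF]
      _ ≤ 7000000 * ((4 * L) * (C * 2 ^ (I.k * I.Δ ^ 2))) := by rw [hGn]; gcongr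
      _ = 28000000 * C * 2 ^ (I.k * I.Δ ^ 2) * L := by ring
      _ ≤ _ := by gcongr; linarith

theorem computable_const_mul_pow (a c : ℕ) : Computable fun k => a * c ^ k := by
  have h : Primrec fun k : ℕ => (Nat.rec a (fun _ x => x * c) k : ℕ) :=
    Primrec.nat_rec₁ a (Primrec.nat_mul.comp₂ Primrec₂.right (Primrec₂.const c))
  refine (h.of_eq fun k => ?_).to_comp
  induction k with
  | zero => simp
  | succ k ih => simp only [ih, pow_succ, mul_assoc]

theorem boundedDegree_isFPT (d : ℕ) : (boundedDegree d).IsFPT := by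
  obtain ⟨K, hK, h⟩ := exists_decidesWithin_mainProg
  -- The number `⌈K⌉₊` is a fixed constant, so `f` is computable however `K` was obtained. The
  -- exponent `2` suffices because `n log n ≤ n ^ 2` and `n + 1 ≤ |I|`.
  refine ⟨mainProg, fun k => ⌈K⌉₊ * (2 ^ d ^ 2) ^ k, 2, computable_const_mul_pow _ _, fun I => ?_⟩
  obtain ⟨t, s', he, ht, hs⟩ := h I.1
  refine ⟨t, s', he, ht.trans ?_, hs⟩
  have hsize : I.1.n + 1 ≤ (boundedDegree d).size I := by
    simp only [boundedDegree, GraphInstance.size]; omega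
  have hsize' : (I.1.n : ℝ) + 1 ≤ (boundedDegree d).size I := by exact_mod_cast hsize
  have hn0 : (0 : ℝ) ≤ I.1.n := Nat.cast_nonneg _
  have hmax : max 1 ((I.1.n : ℝ) * Real.log I.1.n) ≤ ((boundedDegree d).size I : ℝ) ^ 2 := by
    have hsq : ((I.1.n : ℝ) + 1) ^ 2 ≤ ((boundedDegree d).size I : ℝ) ^ 2 := by gcongr
    refine max_le (by nlinarith) (le_trans ?_ hsq)
    have : Real.log I.1.n ≤ I.1.n := Real.log_le_self hn0
    nlinarith
  have hpow : (2 : ℝ) ^ (I.1.k * I.1.Δ ^ 2) ≤ (2 ^ d ^ 2) ^ I.1.k := by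
    rw [← pow_mul, mul_comm (d ^ 2)]
    refine pow_le_pow_right₀ (by norm_num) (Nat.mul_le_mul_left _ (Nat.pow_le_pow_left I.2 2))
  push_cast
  have hceil : K ≤ ⌈K⌉₊ := Nat.le_ceil K
  change _ ≤ ((⌈K⌉₊ : ℝ) * (2 ^ d ^ 2) ^ I.1.k) * _
  gcongr

end PartialVC

theorem mainTheorem6 :
    (∃ (p : RAM.Prog) (K : ℝ), ∀ I : PartialVC.GraphInstance,
      RAM.DecidesWithin p I.init I.Yes
        (K * 2 ^ (I.k * I.Δ ^ 2) * max 1 ((I.n : ℝ) * Real.log (I.n : ℝ)))) ∧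
    (∀ d : ℕ, (PartialVC.boundedDegree d).IsFPT) := by
  obtain ⟨K, -, h⟩ := PartialVC.exists_decidesWithin_mainProg
  exact ⟨⟨RAM.mainProg, K, h⟩, PartialVC.boundedDegree_isFPT⟩
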